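/- Let $K=\mathbb Q(\sqrt2)$ with ring of integers $\mathcal O_K$, and consider the quaternion algebra $\left(\frac{-1,-1}{K}\right)$ with standard basis $1,\mathbf i,\mathbf j,\mathbf k$ and reduced norm $\operatorname{nrd}(a+b\mathbf i+c\mathbf j+d\mathbf k)=a^2+b^2+c^2+d^2$. Let $$\mathcal G=\mathcal O_K\oplus\mathcal O_K\,2\mathbf i\oplus\mathcal O_K\frac{\mathbf i+\mathbf j}{\sqrt2}\oplus\mathcal O_K\frac{(1+\sqrt2)+(\sqrt2-1)\mathbf i+\mathbf j+\mathbf k}2,$$ an order contained in the cubian order $$\mathcal O_K\oplus\mathcal O_K\frac{1+\mathbf i}{\sqrt2}\oplus\mathcal O_K\frac{1+\mathbf j}{\sqrt2}\oplus\mathcal O_K\frac{1+\mathbf i+\mathbf j+\mathbf k}2 .$$ For $\alpha\in\mathcal O_K$ write $r_{\mathcal G}(\alpha)=\#\{\mathbf q\in\mathcal G : \operatorname{nrd}(\mathbf q)=\alpha\}$. Let $\alpha\in\mathcal O_K$ be totally positive, and let $e\ge 0$ be the integer with $\alpha\in(\sqrt2)^e\mathcal O_K$ and $\alpha\notin(\sqrt2)^{e+1}\mathcal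 O_K$. Then $r_{\mathcal G}(\alpha)$ is finite and $$r_{\mathcal G}(\alpha)=4\left(\sum_{\substack{\delta\mathcal O_K\mid\alpha\mathcal O_K\\ \sqrt2\mathcal O_K\,\nmid\,\delta\mathcal O_K}}\operatorname{N}(\delta\mathcal O_K)\right)\cdot\begin{cases}1,&e=0,\\ 2\cdot2,&e=1,\\ 3\cdot2^2,&e=2,\\ 2(2^2+\cdots+2^e)+2\cdot2^e-2^2,&e\ge3,\end{cases}$$ where the sum runs over the principal ideals $\delta\mathcal O_K$ of $\mathcal O_K$ that divide $\alpha\mathcal O_K$ and are not divisible by $\sqrt2\mathcal O_K$, each counted once, and $\operatorname{N}$ is the absolute ideal norm. -/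

import Mathlib

open scoped Quaternion NumberField

namespace CubianSuborder

/-! ### The field `K = ℚ(√2)` -/

theorem rat_sq_ne_two (r : ℚ) : r ^ 2 ≠ 2 + 0 * r := by
  intro h
  have h2 : IsSquare (2 : ℚ) := ⟨r, by linarith [sq r]⟩
  rw [show (2 : ℚ) = ((2 : ℕ) : ℚ) by norm_num, Rat.isSquare_natCast_iff] at h2
  exact Nat.prime_two.prime.irreducible.not_isSquare h2

instance factSqNeTwo : Fact (∀ r : ℚ, r ^ 2 ≠ 2 + 0 * r) := ⟨rat_sq_ne_two⟩

/-- The field `ℚ(√2) = ℚ ⊕ ℚ√2`. -/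
abbrev K : Type := QuadraticAlgebra ℚ 2 0

/-- The element `√2` of `ℚ(√2)`. -/
def rt : K := ⟨0, 1⟩

theorem rt_mul_rt : rt * rt = 2 := by
  ext <;> simp [rt, QuadraticAlgebra.re_ofNat, QuadraticAlgebra.im_ofNat]

instance numberFieldK : NumberField K where
  to_charZero := inferInstance
  to_finiteDimensional := by
    have h : FiniteDimensional ℚ (QuadraticAlgebra ℚ 2 0) := inferInstance
    exact h

/-- The element `√2` of the ring of integers of `ℚ(√2)`. -/
def rtInt : 𝓞 K :=
  ⟨rt, (IsIntegral.of_pow (n := 2) (by norm_num) (by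
    rw [sq, rt_mul_rt]; exact isIntegral_algebraMap (R := ℤ) (x := (2 : ℤ))) : IsIntegral ℤ rt)⟩

/-- `α` is totally positive: its image under every real embedding of `K` is positive. -/
def TotallyPositive (α : 𝓞 K) : Prop :=
  ∀ σ : K →+* ℝ, 0 < σ (α : K)

/-! ### Orders in the quaternion algebra `(-1, -1)` over `K`

`ℍ[K,-1,-1]` is the quaternion algebra with `i² = j² = -1`, `ij = -ji = k`, and `⟨a, b, c, d⟩` is
the quaternion `a + b i + c j + d k`. -/

/-- The coordinatewise algebra structure; naming it makes it the preferred one among the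
(equal) structures that Mathlib provides. -/
instance algebraQuaternion : Algebra (𝓞 K) ℍ[K,-1,-1] := QuaternionAlgebra.instAlgebra

/-- The `𝓞 K`-basis `1`, `(1 + i)/√2`, `(1 + j)/√2`, `(1 + i + j + k)/2`. -/
def cubianBasis : Fin 4 → ℍ[K,-1,-1] :=
  ![⟨1, 0, 0, 0⟩, ⟨1 / rt, 1 / rt, 0, 0⟩, ⟨1 / rt, 0, 1 / rt, 0⟩, ⟨1 / 2, 1 / 2, 1 / 2, 1 / 2⟩]

/-- The `𝓞 K`-basis `1`, `2i`, `(i + j)/√2`, `((1 + √2) + (√2 - 1) i + j + k)/2`. -/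
def gBasis : Fin 4 → ℍ[K,-1,-1] :=
  ![⟨1, 0, 0, 0⟩, ⟨0, 2, 0, 0⟩, ⟨0, 1 / rt, 1 / rt, 0⟩,
    ⟨(1 + rt) / 2, (rt - 1) / 2, 1 / 2, 1 / 2⟩]

theorem one_div_rt : (1 / rt : K) = ⟨0, 1 / 2⟩ := by
  have h : rt ≠ 0 := by
    intro h; have := congrArg QuadraticAlgebra.im h; simp [rt] at this
  rw [div_eq_iff h]
  ext <;> simp [rt, QuadraticAlgebra.re_one, QuadraticAlgebra.im_one]

theorem half_eq : (1 / 2 : K) = ⟨1 / 2, 0⟩ := by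
  rw [div_eq_iff two_ne_zero]
  ext <;> simp [QuadraticAlgebra.re_one, QuadraticAlgebra.im_one, QuadraticAlgebra.re_ofNat, QuadraticAlgebra.im_ofNat]

theorem neg_one_eq : (-1 : K) = ⟨-1, 0⟩ := by
  ext <;> simp [QuadraticAlgebra.re_one, QuadraticAlgebra.im_one]

theorem cubianBasis_eq : cubianBasis =
    ![⟨⟨1, 0⟩, ⟨0, 0⟩, ⟨0, 0⟩, ⟨0, 0⟩⟩, ⟨⟨0, 1 / 2⟩, ⟨0, 1 / 2⟩, ⟨0, 0⟩, ⟨0, 0⟩⟩,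
      ⟨⟨0, 1 / 2⟩, ⟨0, 0⟩, ⟨0, 1 / 2⟩, ⟨0, 0⟩⟩,
      ⟨⟨1 / 2, 0⟩, ⟨1 / 2, 0⟩, ⟨1 / 2, 0⟩, ⟨1 / 2, 0⟩⟩] := by
  simp only [cubianBasis, one_div_rt, half_eq]; rfl

theorem gBasis_eq : gBasis =
    ![⟨⟨1, 0⟩, ⟨0, 0⟩, ⟨0, 0⟩, ⟨0, 0⟩⟩, ⟨⟨0, 0⟩, ⟨2, 0⟩, ⟨0, 0⟩, ⟨0, 0⟩⟩,
      ⟨⟨0, 0⟩, ⟨0, 1 / 2⟩, ⟨0, 1 / 2⟩, ⟨0, 0⟩⟩,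
      ⟨⟨1 / 2, 1 / 2⟩, ⟨-1 / 2, 1 / 2⟩, ⟨1 / 2, 0⟩, ⟨1 / 2, 0⟩⟩] := by
  have h1 : (1 + rt) / 2 = (⟨1 / 2, 1 / 2⟩ : K) := by
    rw [div_eq_iff two_ne_zero]
    ext <;> simp [rt, QuadraticAlgebra.re_one, QuadraticAlgebra.im_one, QuadraticAlgebra.re_ofNat, QuadraticAlgebra.im_ofNat]
  have h2 : (rt - 1) / 2 = (⟨-1 / 2, 1 / 2⟩ : K) := by
    rw [div_eq_iff two_ne_zero]
    ext <;> simp [rt, QuadraticAlgebra.re_one, QuadraticAlgebra.im_one, QuadraticAlgebra.re_ofNat, QuadraticAlgebra.im_ofNat]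
  simp only [gBasis, h1, h2, one_div_rt, half_eq]; rfl

/-- The integer `p + q√2`. -/
def ofPair (x : ℤ × ℤ) : 𝓞 K := x.1 + x.2 * rtInt

theorem coe_ofPair (x : ℤ × ℤ) : (ofPair x : K) = ⟨x.1, x.2⟩ := by
  have h : ((rtInt : 𝓞 K) : K) = rt := rfl
  have h' : (ofPair x : K) = x.1 + x.2 * rt := by simp [ofPair, h]
  rw [h']
  ext <;> simp [rt]

theorem mem_span_of_coords (v : Fin 4 → ℍ[K,-1,-1]) (x : ℍ[K,-1,-1]) (c : Fin 4 → ℤ × ℤ)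
    (h : x = ∑ i, (⟨(c i).1, (c i).2⟩ : K) • v i) :
    x ∈ Submodule.span (𝓞 K) (Set.range v) := by
  rw [Submodule.mem_span_range_iff_exists_fun]
  refine ⟨fun i => ofPair (c i), ?_⟩
  rw [h]
  refine Finset.sum_congr rfl fun i _ => ?_
  rw [← coe_ofPair]
  exact (algebraMap_smul K (ofPair (c i)) (v i)).symm

theorem span_mul_mem (v : Fin 4 → ℍ[K,-1,-1])
    (h : ∀ i j, v i * v j ∈ Submodule.span (𝓞 K) (Set.range v)) (x y : ℍ[K,-1,-1])
    (hx : x ∈ Submodule.span (𝓞 K) (Set.range v)) (hy : y ∈ Submodule.span (𝓞 K) (Set.range v)) :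
    x * y ∈ Submodule.span (𝓞 K) (Set.range v) := by
  have hle : Submodule.span (𝓞 K) (Set.range v) * Submodule.span (𝓞 K) (Set.range v) ≤
      Submodule.span (𝓞 K) (Set.range v) := by
    rw [Submodule.span_mul_span, Submodule.span_le]
    rintro _ ⟨_, ⟨i, rfl⟩, _, ⟨j, rfl⟩, rfl⟩
    exact h i j
  exact hle (Submodule.mul_mem_mul hx hy)

theorem cubianBasis_mul (i j : Fin 4) :
    cubianBasis i * cubianBasis j ∈ Submodule.span (𝓞 K) (Set.range cubianBasis) := by
  apply mem_span_of_coords _ _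
    ((![![![(1, 0), (0, 0), (0, 0), (0, 0)], ![(0, 0), (1, 0), (0, 0), (0, 0)],
          ![(0, 0), (0, 0), (1, 0), (0, 0)], ![(0, 0), (0, 0), (0, 0), (1, 0)]],
        ![![(0, 0), (1, 0), (0, 0), (0, 0)], ![(-1, 0), (0, 1), (0, 0), (0, 0)],
          ![(0, 0), (0, 0), (0, 0), (1, 0)], ![(0, 0), (0, 0), (-1, 0), (0, 1)]],
        ![![(0, 0), (0, 0), (1, 0), (0, 0)], ![(-1, 0), (0, 1), (0, 1), (-1, 0)],
          ![(-1, 0), (0, 0), (0, 1), (0, 0)], ![(0, -1), (1, 0), (1, 0), (0, 0)]],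
        ![![(0, 0), (0, 0), (0, 0), (1, 0)], ![(0, -1), (1, 0), (1, 0), (0, 0)],
          ![(0, 0), (-1, 0), (0, 0), (0, 1)], ![(-1, 0), (0, 0), (0, 0), (1, 0)]]] :
      Fin 4 → Fin 4 → Fin 4 → ℤ × ℤ) i j)
  rw [cubianBasis_eq]
  rw [Fin.sum_univ_four]
  fin_cases i <;> fin_cases j <;>
    (simp [QuaternionAlgebra.mk_mul_mk, QuaternionAlgebra.smul_mk, QuaternionAlgebra.mk_add_mk,
      QuadraticAlgebra.mk_mul_mk, neg_one_eq]; try norm_num [QuadraticAlgebra.ext_iff])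

theorem gBasis_mul (i j : Fin 4) :
    gBasis i * gBasis j ∈ Submodule.span (𝓞 K) (Set.range gBasis) := by
  apply mem_span_of_coords _ _
    ((![![![(1, 0), (0, 0), (0, 0), (0, 0)], ![(0, 0), (1, 0), (0, 0), (0, 0)],
          ![(0, 0), (0, 0), (1, 0), (0, 0)], ![(0, 0), (0, 0), (0, 0), (1, 0)]],
        ![![(0, 0), (1, 0), (0, 0), (0, 0)], ![(-4, 0), (0, 0), (0, 0), (0, 0)],
          ![(-2, -2), (-1, 1), (-2, 0), (0, 2)], ![(0, -2), (2, 0), (0, -2), (2, 0)]],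
        ![![(0, 0), (0, 0), (1, 0), (0, 0)], ![(2, 0), (1, -1), (2, 0), (0, -2)],
          ![(-1, 0), (0, 0), (0, 0), (0, 0)], ![(-1, 0), (-1, 1), (-1, 1), (-1, 1)]],
        ![![(0, 0), (0, 0), (0, 0), (1, 0)], ![(2, 0), (-1, 1), (0, 2), (-2, 0)],
          ![(0, 0), (1, -1), (2, 0), (1, -1)], ![(-2, 0), (0, 0), (0, 0), (1, 1)]]] :
      Fin 4 → Fin 4 → Fin 4 → ℤ × ℤ) i j)
  rw [gBasis_eq]
  rw [Fin.sum_univ_four]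
  fin_cases i <;> fin_cases j <;>
    (simp [QuaternionAlgebra.mk_mul_mk, QuaternionAlgebra.smul_mk, QuaternionAlgebra.mk_add_mk,
      QuadraticAlgebra.mk_mul_mk, neg_one_eq]; try norm_num [QuadraticAlgebra.ext_iff])

/-- The cubian order
`𝓞 K ⊕ 𝓞 K (1 + i)/√2 ⊕ 𝓞 K (1 + j)/√2 ⊕ 𝓞 K (1 + i + j + k)/2`. -/
def cubianOrder : Subalgebra (𝓞 K) ℍ[K,-1,-1] :=
  (Submodule.span (𝓞 K) (Set.range cubianBasis)).toSubalgebra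
    (Submodule.subset_span ⟨0, rfl⟩) (span_mul_mem cubianBasis cubianBasis_mul)

/-- The order
`𝓞 K ⊕ 𝓞 K 2i ⊕ 𝓞 K (i + j)/√2 ⊕ 𝓞 K ((1 + √2) + (√2 - 1) i + j + k)/2`. -/
def gOrder : Subalgebra (𝓞 K) ℍ[K,-1,-1] :=
  (Submodule.span (𝓞 K) (Set.range gBasis)).toSubalgebra
    (Submodule.subset_span ⟨0, rfl⟩) (span_mul_mem gBasis gBasis_mul)

theorem gOrder_le_cubianOrder : gOrder ≤ cubianOrder := by
  have h : Submodule.span (𝓞 K) (Set.range gBasis) ≤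
      Submodule.span (𝓞 K) (Set.range cubianBasis) := by
    rw [Submodule.span_le]
    rintro _ ⟨i, rfl⟩
    apply mem_span_of_coords _ _
      ((![![(1, 0), (0, 0), (0, 0), (0, 0)], ![(-2, 0), (0, 2), (0, 0), (0, 0)],
          ![(0, -1), (1, 0), (1, 0), (0, 0)], ![(1, 0), (1, -1), (0, 0), (1, 0)]] :
        Fin 4 → Fin 4 → ℤ × ℤ) i)
    rw [cubianBasis_eq, gBasis_eq]
    rw [Fin.sum_univ_four]
    fin_cases i <;>
      (simp [QuaternionAlgebra.smul_mk, QuaternionAlgebra.mk_add_mk,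
      QuadraticAlgebra.mk_mul_mk]; try norm_num [QuadraticAlgebra.ext_iff])
  exact h

theorem gBasis_linearIndependent : LinearIndependent (𝓞 K) gBasis := by
  have hrt : rt ≠ 0 := by
    intro h; have := congrArg QuadraticAlgebra.im h; simp [rt] at this
  have h : LinearIndependent K gBasis := by
    rw [Fintype.linearIndependent_iff]
    intro c hc
    rw [Fin.sum_univ_four] at hc
    have h0 := congrArg QuaternionAlgebra.re hc
    have h1 := congrArg QuaternionAlgebra.imI hc
    have h2 := congrArg QuaternionAlgebra.imJ hc
    have h3 := congrArg QuaternionAlgebra.imK hc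
    simp [gBasis] at h0 h1 h2 h3
    simp [h3, hrt] at h0 h1 h2
    simp [h2] at h1
    intro i
    fin_cases i <;> assumption
  exact h.restrict_scalars' (𝓞 K)

/-! ### Counting representations -/

/-- The reduced norm `q q̄` of a quaternion. -/
def reducedNorm (q : ℍ[K,-1,-1]) : K := (q * star q).re

theorem algebraMap_reducedNorm (q : ℍ[K,-1,-1]) :
    algebraMap K ℍ[K,-1,-1] (reducedNorm q) = q * star q := by
  ext <;> simp [reducedNorm] <;> ring

theorem reducedNorm_eq (q : ℍ[K,-1,-1]) :
    reducedNorm q = q.re ^ 2 + q.imI ^ 2 + q.imJ ^ 2 + q.imK ^ 2 := by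
  simp [reducedNorm]; ring

/-- The number (in `ℕ∞`) of elements of the order `G` of reduced norm `α`. -/
noncomputable def repCount (G : Subalgebra (𝓞 K) ℍ[K,-1,-1]) (α : 𝓞 K) : ℕ∞ :=
  Set.encard {q : ℍ[K,-1,-1] | q ∈ G ∧ reducedNorm q = (α : K)}

/-- The ideals `δ 𝓞 K` that divide `α 𝓞 K` and are not divisible by `√2 𝓞 K`. -/
def oddDivisors (α : 𝓞 K) : Set (Ideal (𝓞 K)) :=
  {I | (∃ δ : 𝓞 K, I = Ideal.span {δ}) ∧ I ∣ Ideal.span {α} ∧ ¬ Ideal.span {rtInt} ∣ I}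

theorem oddDivisors_finite {α : 𝓞 K} (hα : α ≠ 0) : (oddDivisors α).Finite := by
  have h : (Ideal.span {α} : Ideal (𝓞 K)) ≠ 0 := by
    simpa [Ideal.zero_eq_bot, Ideal.span_singleton_eq_bot] using hα
  have hfin : {I : Ideal (𝓞 K) | I ∣ Ideal.span {α}}.Finite :=
    @Set.toFinite _ _ (@Finite.of_fintype _ (UniqueFactorizationMonoid.fintypeSubtypeDvd _ h))
  exact hfin.subset fun I hI => hI.2.1

/-- The sum of the norms of the ideals in `oddDivisors α`, a finite sum when `α ≠ 0`. -/
noncomputable def oddDivisorSum (α : 𝓞 K) : ℕ :=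
  ∑ᶠ I ∈ oddDivisors α, Ideal.absNorm I

/-- The factor depending on the `√2`-adic valuation. In the last case `e ≥ 3`, so that the
subtraction does not truncate. -/
def levelFactor : ℕ → ℕ
  | 0 => 1
  | 1 => 2 * 2
  | 2 => 3 * 2 ^ 2
  | e => 2 * (∑ j ∈ Finset.Icc 2 e, 2 ^ j) + 2 * 2 ^ e - 2 ^ 2

end CubianSuborder

open scoped Quaternion NumberField

namespace CubianSuborder

/-! ### Arithmetic of `ℤ[√2]` -/

/-! The quaternion algebra has class number one here and is unramified at √2, so the count splits
into a part at odd primes, handled by Hecke relations on the cubian order, and a part at √2, handled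
by explicit isometries of quaternary forms.

Odd part. The cubian order is norm-Euclidean (`exists_norm_reducedNorm_sub_lt_one`), so its left
ideals are principal (`exists_left_generator`). Let π be a totally positive prime not dividing 2,
with residue field of size N. Modulo π the order becomes the 2×2 matrices, and an element whose norm
is divisible by π kills either exactly one line of the plane, or all N + 1 of them when π divides
it. The elements killing a given line form a left ideal generated by an element of norm π. Double
counting gives r(πα) + N r(α/π) = (N + 1) r(α) (`cubianSphere_hecke`). Starting from the 48 elements
of norm 1, this makes r(β) equal to 48 times the sum of norms of ideal divisors, for every totally
positive β prime to √2 (`cubianSphere_odd`). Totally positive units are squares, so totally positive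
generators may be chosen freely.

Part at √2. Let `form0`, ..., `form3` be the norm forms of a chain of orders, the first being the
cubian order and the last the order of the theorem, and let p = 2 + √2 be the totally positive
generator of the prime above 2. Modulo √2, three hyperplanes through a common plane cover the whole
space, because the residue field has two elements. Each of the corresponding sublattices is
isometric to a form of the chain, possibly scaled by p, and so is their common intersection.
Inclusion-exclusion yields, with r₀, ..., r₃ the representation numbers, r₀(α) + 2r₀(α/p) = 3r₁(α),
r₁(α) + 2r₁(α/p) = 2r₂(α) + r₀(α/p), r₂(α) + 2r₂(α/p) = 2r₃(α) + r₁(α/p). The isotropic vectors of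
`form0` modulo √2 are covered by three planes, which gives the Hecke relation r₀(pα) + 2r₀(α/p) =
3r₀(α). For α = pᵉβ with β odd, these recursions in e are solved from the initial value r₀(β)
(`enat_recursion`). All counts live in ℕ∞, and finiteness comes out of the recursion. -/

theorem norm_eq (x : K) : x.norm = x.re ^ 2 - 2 * x.im ^ 2 := by
  rw [QuadraticAlgebra.norm_def]; ring

theorem rtInt_sq : rtInt ^ 2 = 2 := by
  apply NumberField.RingOfIntegers.ext
  rw [sq]
  exact rt_mul_rt

theorem rat_exists_int_of_sq {q : ℚ} {n : ℤ} (h : q ^ 2 = n) : ∃ k : ℤ, q = k := by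
  have hq : IsIntegral ℤ q := IsIntegral.of_pow (n := 2) (by norm_num) (by
    rw [h]; exact isIntegral_algebraMap (R := ℤ) (x := n))
  obtain ⟨k, hk⟩ := IsIntegrallyClosed.isIntegral_iff.1 hq
  exact ⟨k, by simpa using hk.symm⟩

/-- Trace and norm are rational integers m and n, and parity considerations on m² − 8b² = 4n, where
b is the coefficient of √2, force both coordinates to be integral. -/
theorem exists_ofPair (x : 𝓞 K) : ∃ a b : ℤ, x = ofPair (a, b) := by
  have hx : IsIntegral ℤ (x : K) := x.isIntegral_coe
  have hs : IsIntegral ℤ (star (x : K)) := by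
    have := hx.map (starRingEnd K).toIntAlgHom
    exact this
  have ht : IsIntegral ℤ ((2 * (x : K).re : ℚ)) := by
    have h := hx.add hs
    have e : (x : K) + star (x : K) = algebraMap ℚ K (2 * (x : K).re) := by
      ext <;> simp [two_mul]
    rw [e] at h
    exact (isIntegral_algebraMap_iff (algebraMap ℚ K).injective).1 h
  have hn : IsIntegral ℤ ((x : K).norm) := by
    have h := hx.mul hs
    rw [← QuadraticAlgebra.algebraMap_norm_eq_mul_star] at h
    exact (isIntegral_algebraMap_iff (algebraMap ℚ K).injective).1 h
  obtain ⟨m, hm⟩ := IsIntegrallyClosed.isIntegral_iff.1 ht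
  obtain ⟨n, hn⟩ := IsIntegrallyClosed.isIntegral_iff.1 hn
  rw [norm_eq] at hn
  simp only [eq_intCast] at hm hn
  -- The factor 4 makes the square visibly an integer; the two superfluous factors of 2 are removed
  -- by parity afterwards.
  have hk : (4 * (x : K).im) ^ 2 = ((2 * (m ^ 2 - 4 * n) : ℤ) : ℚ) := by
    push_cast; rw [hm, hn]; ring
  obtain ⟨k, hk'⟩ := rat_exists_int_of_sq hk
  have h1 : k ^ 2 = 2 * (m ^ 2 - 4 * n) := by
    rw [hk'] at hk; exact_mod_cast hk
  have h2 : Even k := by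
    have : Even (k ^ 2) := by rw [h1]; exact even_two_mul _
    exact (Int.even_pow.1 this).1
  obtain ⟨l, rfl⟩ := h2.two_dvd
  have h3 : 2 * l ^ 2 = m ^ 2 - 4 * n := by linarith [h1, mul_pow 2 l 2]
  have h4 : Even m := by
    have : Even (m ^ 2) := ⟨l ^ 2 + 2 * n, by linarith⟩
    exact (Int.even_pow.1 this).1
  obtain ⟨a, rfl⟩ := h4.two_dvd
  have h5 : Even l := by
    have : Even (l ^ 2) := ⟨a ^ 2 - n, by nlinarith [h3]⟩
    exact (Int.even_pow.1 this).1
  obtain ⟨b, rfl⟩ := h5.two_dvd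
  refine ⟨a, b, NumberField.RingOfIntegers.ext ?_⟩
  rw [coe_ofPair]
  push_cast at hm hk'
  ext
  · show (x : K).re = a
    linarith
  · show (x : K).im = b
    linarith

theorem norm_ofPair (a b : ℤ) : (ofPair (a, b) : K).norm = ((a ^ 2 - 2 * b ^ 2 : ℤ) : ℚ) := by
  rw [coe_ofPair, norm_eq]; push_cast; rfl

theorem ofPair_inj {x y : ℤ × ℤ} (h : ofPair x = ofPair y) : x = y := by
  have := congrArg (fun z : 𝓞 K => (z : K)) h
  simp only [coe_ofPair] at this
  have h1 := congrArg QuadraticAlgebra.re this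
  have h2 := congrArg QuadraticAlgebra.im this
  simp only [Int.cast_inj] at h1 h2
  exact Prod.ext h1 h2

/-- The absolute value of the field norm of an algebraic integer. -/
noncomputable def natNorm (x : 𝓞 K) : ℕ := (x : K).norm.num.natAbs

theorem natNorm_cast (x : 𝓞 K) : (natNorm x : ℚ) = |(x : K).norm| := by
  obtain ⟨a, b, rfl⟩ := exists_ofPair x
  rw [natNorm, norm_ofPair, Rat.num_intCast, Nat.cast_natAbs, Int.cast_abs]

theorem natNorm_eq_zero {x : 𝓞 K} : natNorm x = 0 ↔ x = 0 := by
  rw [← Nat.cast_eq_zero (R := ℚ), natNorm_cast, abs_eq_zero,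
    QuadraticAlgebra.norm_eq_zero_iff_eq_zero]
  simp

theorem natNorm_mul (x y : 𝓞 K) : natNorm (x * y) = natNorm x * natNorm y := by
  rw [← Nat.cast_inj (R := ℚ), Nat.cast_mul, natNorm_cast, natNorm_cast, natNorm_cast,
    ← abs_mul, ← map_mul]; rfl

theorem isUnit_of_natNorm {x : 𝓞 K} (h : natNorm x = 1) : IsUnit x := by
  have h' := natNorm_cast x
  obtain ⟨a, b, rfl⟩ := exists_ofPair x
  rw [h, norm_ofPair] at h'
  have h1 : |a ^ 2 - 2 * b ^ 2| = 1 := by exact_mod_cast h'.symm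
  have h2 : ofPair (a, b) * ofPair (a, -b) = ((a ^ 2 - 2 * b ^ 2 : ℤ) : 𝓞 K) := by
    simp only [ofPair]; push_cast; linear_combination (-(b : 𝓞 K) ^ 2) * rtInt_sq
  have h3 : IsUnit (((a ^ 2 - 2 * b ^ 2 : ℤ) : 𝓞 K)) :=
    (Int.isUnit_iff_abs_eq.2 h1).map (Int.castRingHom (𝓞 K))
  rw [← h2] at h3
  exact isUnit_of_mul_isUnit_left h3

/-- Rounding both coordinates leaves a remainder with coordinates at most 1/2 in absolute value,
where a² − 2b² lies between −1/2 and 1/4. Hence ℤ[√2] is norm-Euclidean. -/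
theorem exists_norm_sub_lt_one (z : K) : ∃ y : 𝓞 K, |(z - y).norm| < 1 := by
  refine ⟨ofPair (round z.re, round z.im), ?_⟩
  rw [coe_ofPair, norm_eq]
  have h1 := abs_sub_round z.re
  have h2 := abs_sub_round z.im
  simp only [QuadraticAlgebra.re_sub, QuadraticAlgebra.im_sub]
  rw [abs_le] at h1 h2
  rw [abs_lt]
  constructor <;> nlinarith

instance : IsPrincipalIdealRing (𝓞 K) where
  principal I := by
    by_cases hI : I = ⊥
    · rw [hI]; exact ⟨0, by simp⟩
    obtain ⟨x0, hx0, hx0'⟩ := Submodule.exists_mem_ne_zero_of_ne_bot hI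
    have hne : {x | x ∈ I ∧ x ≠ 0}.Nonempty := ⟨x0, hx0, hx0'⟩
    obtain ⟨x, ⟨hx, hx'⟩, hmin⟩ :=
      (InvImage.wf natNorm Nat.lt_wfRel.wf).has_min _ hne
    refine ⟨x, le_antisymm (fun y hy => ?_) ?_⟩
    · obtain ⟨c, hc⟩ := exists_norm_sub_lt_one ((y : K) / x)
      have hxK : (x : K) ≠ 0 := by simpa using hx'
      have hlt : natNorm (y - c * x) < natNorm x := by
        rw [← Nat.cast_lt (α := ℚ), natNorm_cast, natNorm_cast]
        have e : ((y - c * x : 𝓞 K) : K) = ((y : K) / x - c) * x := by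
          push_cast; field_simp
        rw [e, map_mul, abs_mul]
        have : 0 < |(x : K).norm| := by
          rw [abs_pos, Ne, QuadraticAlgebra.norm_eq_zero_iff_eq_zero]; exact hxK
        nlinarith
      have hz : y - c * x = 0 := by
        by_contra h0
        exact hmin _ ⟨I.sub_mem hy (I.mul_mem_left c hx), h0⟩ hlt
      rw [sub_eq_zero.1 hz]
      exact Submodule.mem_span_singleton.2 ⟨c, rfl⟩
    · exact (Submodule.span_singleton_le_iff_mem _ _).2 hx

/-! ### Divisibility by `√2` -/

theorem rtInt_dvd_ofPair {a b : ℤ} : rtInt ∣ ofPair (a, b) ↔ 2 ∣ a := by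
  constructor
  · rintro ⟨y, hy⟩
    obtain ⟨c, d, rfl⟩ := exists_ofPair y
    have : ofPair (a, b) = ofPair (2 * d, c) := by
      rw [hy]; simp only [ofPair]; push_cast; linear_combination (d : 𝓞 K) * rtInt_sq
    have := ofPair_inj this
    simp only [Prod.mk.injEq] at this
    exact ⟨d, this.1⟩
  · rintro ⟨d, rfl⟩
    refine ⟨ofPair (b, d), ?_⟩
    simp only [ofPair]
    push_cast
    linear_combination (-(d : 𝓞 K)) * rtInt_sq

theorem not_rtInt_dvd_one : ¬ rtInt ∣ (1 : 𝓞 K) := by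
  have : (1 : 𝓞 K) = ofPair (1, 0) := by simp [ofPair]
  rw [this, rtInt_dvd_ofPair]; norm_num

theorem rtInt_ne_zero : rtInt ≠ 0 := by
  intro h
  have := rtInt_sq
  rw [h] at this
  norm_num at this

/-- The residue field at √2 has two elements, so divisibility by √2 behaves like parity. This
reduces incidence questions between linear conditions modulo √2 to propositional logic. -/
theorem rtInt_dvd_add_iff {x y : 𝓞 K} : rtInt ∣ x + y ↔ (rtInt ∣ x ↔ rtInt ∣ y) := by
  obtain ⟨a, b, rfl⟩ := exists_ofPair x
  obtain ⟨c, d, rfl⟩ := exists_ofPair y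
  have : ofPair (a, b) + ofPair (c, d) = ofPair (a + c, b + d) := by
    simp only [ofPair]; push_cast; ring
  rw [this, rtInt_dvd_ofPair, rtInt_dvd_ofPair, rtInt_dvd_ofPair]
  omega

theorem prime_rtInt : Prime rtInt := by
  refine ⟨rtInt_ne_zero, fun h => not_rtInt_dvd_one h.dvd, fun x y h => ?_⟩
  obtain ⟨a, b, rfl⟩ := exists_ofPair x
  obtain ⟨c, d, rfl⟩ := exists_ofPair y
  have e : ofPair (a, b) * ofPair (c, d) = ofPair (a * c + 2 * (b * d), a * d + b * c) := by
    simp only [ofPair]; push_cast; linear_combination ((b : 𝓞 K) * d) * rtInt_sq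
  rw [e, rtInt_dvd_ofPair, Int.dvd_add_left (dvd_mul_right _ _)] at h
  rw [rtInt_dvd_ofPair, rtInt_dvd_ofPair]
  exact Int.prime_two.dvd_mul.1 h

/-! ### Total positivity -/

/-- Total positivity in terms of trace and norm. -/
def TotPos (x : K) : Prop := 0 < x.re ∧ 0 < x.norm

theorem TotPos.mul {x y : K} (hx : TotPos x) (hy : TotPos y) : TotPos (x * y) := by
  refine ⟨?_, by rw [map_mul]; exact mul_pos hx.2 hy.2⟩
  obtain ⟨h1, h2⟩ := hx
  obtain ⟨h3, h4⟩ := hy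
  rw [norm_eq] at h2 h4
  simp only [QuadraticAlgebra.re_mul]
  have h5 : |2 * x.im * y.im| < x.re * y.re := by
    apply abs_lt_of_sq_lt_sq _ (by positivity)
    have : 4 * x.im ^ 2 * y.im ^ 2 ≤ 2 * x.im ^ 2 * y.re ^ 2 := by
      nlinarith [mul_nonneg (sq_nonneg x.im) h4.le]
    have : 2 * x.im ^ 2 * y.re ^ 2 < x.re ^ 2 * y.re ^ 2 := by
      apply mul_lt_mul_of_pos_right _ (by positivity); linarith
    nlinarith
  rw [abs_lt] at h5
  linarith [h5.1]

theorem TotPos.of_mul {x y : K} (hx : TotPos x) (hy : TotPos (x * y)) : TotPos y := by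
  have hn : 0 < y.norm := by
    have := hy.2
    rw [map_mul] at this
    exact pos_of_mul_pos_right this hx.2.le
  refine ⟨?_, hn⟩
  by_contra hre
  have hne : y.re ≠ 0 := by
    intro h0
    rw [norm_eq, h0] at hn
    nlinarith [sq_nonneg y.im]
  have hneg : TotPos (-y) := by
    refine ⟨?_, by rwa [QuadraticAlgebra.norm_neg]⟩
    rw [QuadraticAlgebra.re_neg]
    have := lt_of_le_of_ne (not_lt.1 hre) hne
    linarith
  have := (hx.mul hneg).1
  rw [mul_neg, QuadraticAlgebra.re_neg] at this
  linarith [hy.1]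

theorem TotPos.ne_zero {x : K} (hx : TotPos x) : x ≠ 0 := by
  rintro rfl
  simpa using hx.1

theorem totPos_one : TotPos 1 := by
  refine ⟨by simp [QuadraticAlgebra.re_one], by simp⟩

theorem TotallyPositive.totPos {α : 𝓞 K} (h : TotallyPositive α) : TotPos (α : K) := by
  have h2 : (√2 : ℝ) * √2 = 2 := Real.mul_self_sqrt (by norm_num)
  let f : {u : ℝ // u * u = (2 : ℚ) • 1 + (0 : ℚ) • u} → (K →+* ℝ) := fun u =>
    (QuadraticAlgebra.lift u).toRingHom
  have hf : ∀ u, f u (α : K) = (α : K).re + (α : K).im * u.1 := by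
    intro u
    simp [f, Rat.smul_def]
  have p1 := h (f ⟨√2, by simp [h2, Rat.smul_def]⟩)
  have p2 := h (f ⟨-√2, by simp [h2, Rat.smul_def]⟩)
  rw [hf] at p1 p2
  simp only at p1 p2
  constructor
  · have : (0 : ℝ) < (α : K).re := by linarith
    exact_mod_cast this
  · have : (0 : ℝ) < ((α : K).re : ℝ) ^ 2 - 2 * ((α : K).im : ℝ) ^ 2 := by
      nlinarith [mul_pos p1 p2]
    rw [norm_eq]
    exact_mod_cast this

theorem norm_unit (ε : (𝓞 K)ˣ) : |((ε : 𝓞 K) : K).norm| = 1 := by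
  have h : natNorm (ε : 𝓞 K) * natNorm ((ε⁻¹ : (𝓞 K)ˣ) : 𝓞 K) = 1 := by
    rw [← natNorm_mul, Units.mul_inv, ← Nat.cast_inj (R := ℚ), natNorm_cast]; simp
  rw [← natNorm_cast, Nat.eq_one_of_mul_eq_one_right h]; simp

/-- The unit 1 + √2 has norm −1, so together with −1 it realises every sign pattern under the two
real embeddings. -/
theorem exists_unit_mul_totPos {x : 𝓞 K} (hx : x ≠ 0) :
    ∃ ε : (𝓞 K)ˣ, TotPos ((x * ε : 𝓞 K) : K) := by
  have key : ∀ y : 𝓞 K, 0 < (y : K).norm → ∃ ε : (𝓞 K)ˣ, TotPos ((y * ε : 𝓞 K) : K) := by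
    intro y hy
    rcases lt_trichotomy (y : K).re 0 with h | h | h
    · refine ⟨-1, ?_, ?_⟩
      · simpa using h
      · simpa using hy
    · rw [norm_eq, h] at hy
      nlinarith [sq_nonneg (y : K).im]
    · exact ⟨1, by simpa using h, by simpa using hy⟩
  have hn : (x : K).norm ≠ 0 := by
    rw [Ne, QuadraticAlgebra.norm_eq_zero_iff_eq_zero]; simpa using hx
  rcases lt_or_gt_of_ne hn with h | h
  · have hu : (ofPair (1, 1)) * (ofPair (-1, 1)) = 1 := by
      simp only [ofPair]; push_cast; linear_combination rtInt_sq
    let u : (𝓞 K)ˣ := ⟨ofPair (1, 1), ofPair (-1, 1), hu, by rw [mul_comm]; exact hu⟩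
    have hun : ((u : 𝓞 K) : K).norm = -1 := by
      show (ofPair (1, 1) : K).norm = -1
      rw [norm_ofPair]; norm_num
    obtain ⟨ε, hε⟩ := key (x * u) (by push_cast; rw [map_mul, hun]; linarith)
    exact ⟨u * ε, by rw [Units.val_mul, ← mul_assoc]; exact hε⟩
  · exact key x h

/-- Such a unit has norm 1, hence solves Pell's equation a² − 2b² = 1 with a > 0, and the
fundamental solution 3 + 2√2 is the square of 1 + √2. -/
theorem exists_sq_of_totPos_unit {ε : (𝓞 K)ˣ} (hε : TotPos ((ε : 𝓞 K) : K)) :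
    ∃ η : (𝓞 K)ˣ, ε = η ^ 2 := by
  obtain ⟨a, b, hab⟩ := exists_ofPair (ε : 𝓞 K)
  have hn := norm_unit ε
  rw [abs_of_pos hε.2, hab, norm_ofPair] at hn
  have ha : 0 < a := by
    have := hε.1
    rw [hab, coe_ofPair] at this
    exact Int.cast_pos.1 this
  have hp : a ^ 2 - 2 * b ^ 2 = 1 := by exact_mod_cast hn
  let s : Pell.Solution₁ 2 := Pell.Solution₁.mk a b hp
  let f : Pell.Solution₁ 2 := Pell.Solution₁.mk 3 2 (by norm_num)
  have hf : Pell.IsFundamental f := by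
    refine ⟨by simp [f], by simp [f], fun {c} hc => ?_⟩
    show (3 : ℤ) ≤ c.x
    have h1 := c.prop
    by_contra h2
    have h3 : c.x = 2 := by omega
    rw [h3] at h1
    omega
  let v : Pell.Solution₁ 2 →* 𝓞 K :=
    { toFun := fun c => ofPair (c.x, c.y)
      map_one' := by simp [ofPair]
      map_mul' := fun c d => by
        simp only [ofPair, Pell.Solution₁.x_mul, Pell.Solution₁.y_mul]
        push_cast
        linear_combination (-(c.y : 𝓞 K) * d.y) * rtInt_sq }
  have hu : (ofPair (1, 1)) * (ofPair (-1, 1)) = 1 := by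
    simp only [ofPair]; push_cast; linear_combination rtInt_sq
  let u : (𝓞 K)ˣ := ⟨ofPair (1, 1), ofPair (-1, 1), hu, by rw [mul_comm]; exact hu⟩
  have hvf : v.toHomUnits f = u ^ 2 := by
    ext1
    show ofPair (3, 2) = ofPair (1, 1) ^ 2
    simp only [ofPair]; push_cast; linear_combination (-1 : 𝓞 K) * rtInt_sq
  have hvs : v.toHomUnits s = ε := by
    ext1
    exact hab.symm
  obtain ⟨n, hn | hn⟩ := hf.eq_zpow_or_neg_zpow s
  · refine ⟨u ^ n, ?_⟩
    rw [← hvs, hn, map_zpow, hvf]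
    rw [← zpow_natCast, ← zpow_natCast, ← zpow_mul, ← zpow_mul, mul_comm]
  · exfalso
    have h1 : 0 < (f ^ n).x := Pell.Solution₁.x_zpow_pos (by simp [f]) n
    have h2 : s.x = -(f ^ n).x := by rw [hn, Pell.Solution₁.x_neg]
    have h3 : s.x = a := rfl
    omega

/-! ### A chain of Eichler orders and their norm forms -/

/-- The norm form of the Eichler order of level `√2 ^ 0`. -/
def form0 {S : Type*} [CommRing S] (t : S) (v : Fin 4 → S) : S :=
  v 3 ^ 2 + v 2 ^ 2 + v 1 * v 2 + v 1 ^ 2 + v 0 * v 3 + v 0 ^ 2 + t * v 2 * v 3 + t * v 1 * v 3 +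
    t * v 0 * v 2 + t * v 0 * v 1

/-- The norm form of the Eichler order of level `√2 ^ 1`. -/
def form1 {S : Type*} [CommRing S] (t : S) (v : Fin 4 → S) : S :=
  2 * v 3 ^ 2 + v 2 * v 3 + v 2 ^ 2 + v 1 * v 3 + v 1 ^ 2 + v 0 * v 3 + v 0 ^ 2 + t * v 3 ^ 2 +
    t * v 2 * v 3 + t * v 1 * v 3 + t * v 0 * v 3 + t * v 0 * v 2

/-- The norm form of the Eichler order of level `√2 ^ 2`. -/
def form2 {S : Type*} [CommRing S] (t : S) (v : Fin 4 → S) : S :=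
  2 * v 3 ^ 2 + v 2 * v 3 + v 2 ^ 2 + v 1 * v 3 + v 1 ^ 2 + v 0 * v 3 + v 0 ^ 2 + t * v 3 ^ 2 +
    t * v 2 * v 3 + t * v 1 * v 3

/-- The norm form of the Eichler order of level `√2 ^ 3`. -/
def form3 {S : Type*} [CommRing S] (t : S) (v : Fin 4 → S) : S :=
  2 * v 3 ^ 2 + v 2 * v 3 + v 2 ^ 2 - 2 * v 1 * v 3 + 4 * v 1 ^ 2 + v 0 * v 3 + v 0 ^ 2 +
    2 * t * v 1 * v 3 + 2 * t * v 1 * v 2 + t * v 0 * v 3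

/-! ### Sublattices cut out by linear conditions modulo √2, and their norm forms -/

/-- The columns of `A` form a basis of the sublattice defined by `P`, and `B` is t times the inverse
of `A`. Thus a vector lies in the image of `A` as soon as `B` sends it to a multiple of t, and `Q`
restricted to the sublattice becomes s times `Q'`. In the applications below every hypothesis is a
polynomial identity modulo t² = 2. -/
theorem encard_sublattice {S : Type*} [CommRing S] [IsDomain S] {t : S} (ht0 : t ≠ 0)
    {Q Q' : (Fin 4 → S) → S} {P : (Fin 4 → S) → Prop} {s : S} (A B : Matrix (Fin 4) (Fin 4) S)
    (hAB : A * B = t • (1 : Matrix (Fin 4) (Fin 4) S))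
    (hBA : B * A = t • (1 : Matrix (Fin 4) (Fin 4) S))
    (hQ : ∀ w, Q (A.mulVec w) = s * Q' w) (hP : ∀ w, P (A.mulVec w))
    (hB : ∀ v, P v → ∃ w, B.mulVec v = t • w) (α : S) :
    {v | Q v = α ∧ P v}.encard = {w | s * Q' w = α}.encard := by
  have hinj : Function.Injective A.mulVec := by
    intro w w' h
    have h' := congrArg B.mulVec h
    simp only [Matrix.mulVec_mulVec, hBA, Matrix.smul_mulVec, Matrix.one_mulVec] at h'
    exact smul_right_injective _ ht0 h'
  have himg : {v | Q v = α ∧ P v} = A.mulVec '' {w | s * Q' w = α} := by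
    ext v
    constructor
    · rintro ⟨h1, h2⟩
      obtain ⟨w, hw⟩ := hB v h2
      have h3 : A.mulVec w = v := by
        apply smul_right_injective _ ht0
        simp only
        rw [← Matrix.mulVec_smul, ← hw, Matrix.mulVec_mulVec, hAB, Matrix.smul_mulVec,
          Matrix.one_mulVec]
      refine ⟨w, ?_, h3⟩
      rw [Set.mem_ofPred_eq, ← hQ, h3, h1]
    · rintro ⟨w, hw, rfl⟩
      exact ⟨(hQ w).trans hw, hP w⟩
  rw [himg, hinj.injOn.encard_image]

theorem encard_form0_fst {S : Type*} [CommRing S] [IsDomain S] {t : S}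
    (ht : t ^ 2 = 2) (ht0 : t ≠ 0) (α : S) :
    {v | form0 t v = α ∧ t ∣ v 1 + v 2 + v 3}.encard =
      {w | 1 * form1 t w = α}.encard := by
  refine encard_sublattice (t := t) ht0
    (!![-1, 1, -t, 0; 0, -t, 1, -1; 0, 0, 1, 0; 0, 0, -t, -1])
    (!![-t, -1, -1 + t, 1; 0, -1, 1 + t, 1; 0, 0, t, 0; 0, 0, -2, -t])
    ?_ ?_ (fun w => ?_) (fun w => ?_) (fun v => ?_) α
  · ext i j; fin_cases i <;> fin_cases j <;>
      (simp [Matrix.mul_apply, Fin.sum_univ_four]; try (ring_nf; try simp only [ht]; try ring_nf))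
  · ext i j; fin_cases i <;> fin_cases j <;>
      (simp [Matrix.mul_apply, Fin.sum_univ_four]; try (ring_nf; try simp only [ht]; try ring_nf))
  · simp [form0, form1, Matrix.mulVec, dotProduct, Fin.sum_univ_four]
    linear_combination (2 * w 2 * w 3 - w 2 ^ 2 + w 1 * w 3 + w 0 * w 1 + 2 * t * w 1 * w 2) * ht
  · exact ⟨-w 2 - w 1 - t * w 3 + t * w 2, by
      simp [Matrix.mulVec, dotProduct, Fin.sum_univ_four]
      linear_combination (w 3 - w 2) * ht⟩
  · rintro ⟨s0, h0⟩
    refine ⟨![s0 + v 2 - v 0 - t * v 2 - t * v 1, s0 + v 2 - t * v 1, v 2, -v 3 - t * v 2], ?_⟩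
    ext i; fin_cases i
    · simp [Matrix.mulVec, dotProduct, Fin.sum_univ_four]
      linear_combination h0 + (v 2 + v 1) * ht
    · simp [Matrix.mulVec, dotProduct, Fin.sum_univ_four]
      linear_combination h0 + (v 1) * ht
    · simp [Matrix.mulVec, dotProduct, Fin.sum_univ_four]
    · simp [Matrix.mulVec, dotProduct, Fin.sum_univ_four]
      linear_combination (v 2) * ht

theorem encard_form0_snd {S : Type*} [CommRing S] [IsDomain S] {t : S}
    (ht : t ^ 2 = 2) (ht0 : t ≠ 0) (α : S) :
    {v | form0 t v = α ∧ t ∣ v 0 + v 1 + v 3}.encard =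
      {w | 1 * form1 t w = α}.encard := by
  refine encard_sublattice (t := t) ht0
    (!![1, -1, 0, -1; -t, 0, 0, -1; -t, t, -1, 0; 1, -1, 0, 0])
    (!![1, -1, 0, -1; 1, -1, 0, -1 - t; 0, 0, -t, -2; -t, 0, 0, t])
    ?_ ?_ (fun w => ?_) (fun w => ?_) (fun v => ?_) α
  · ext i j; fin_cases i <;> fin_cases j <;>
      (simp [Matrix.mul_apply, Fin.sum_univ_four]; try (ring_nf; try simp only [ht]; try ring_nf))
  · ext i j; fin_cases i <;> fin_cases j <;>
      (simp [Matrix.mul_apply, Fin.sum_univ_four]; try (ring_nf; try simp only [ht]; try ring_nf))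
  · simp [form0, form1, Matrix.mulVec, dotProduct, Fin.sum_univ_four]
    linear_combination (-w 1 * w 3 - w 1 ^ 2 + 2 * w 0 * w 3 + 3 * w 0 * w 1 - w 0 ^ 2) * ht
  · exact ⟨-w 0 - t * w 3 - t * w 1 + t * w 0, by
      simp [Matrix.mulVec, dotProduct, Fin.sum_univ_four]
      linear_combination (w 3 + w 1 - w 0) * ht⟩
  · rintro ⟨s0, h0⟩
    refine ⟨![s0 + -t * v 3 - t * v 1, s0 + -v 3 - t * v 3 - t * v 1, -v 2 - t * v 3, v 3 - v 0],
      ?_⟩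
    ext i; fin_cases i
    · simp [Matrix.mulVec, dotProduct, Fin.sum_univ_four]
      linear_combination h0 + (v 3 + v 1) * ht
    · simp [Matrix.mulVec, dotProduct, Fin.sum_univ_four]
      linear_combination h0 + (v 3 + v 1) * ht
    · simp [Matrix.mulVec, dotProduct, Fin.sum_univ_four]
      linear_combination (v 3) * ht
    · simp [Matrix.mulVec, dotProduct, Fin.sum_univ_four]
      linear_combination (0) * ht

theorem encard_form0_thd {S : Type*} [CommRing S] [IsDomain S] {t : S}
    (ht : t ^ 2 = 2) (ht0 : t ≠ 0) (α : S) :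
    {v | form0 t v = α ∧ t ∣ v 0 + v 2}.encard =
      {w | 1 * form1 t w = α}.encard := by
  refine encard_sublattice (t := t) ht0
    (!![0, 0, 0, -1; 0, 0, -1, 0; 0, -t, 0, -1; -1, 1, 0, 0])
    (!![1, 0, -1, -t; 1, 0, -1, 0; 0, -t, 0, 0; -t, 0, 0, 0])
    ?_ ?_ (fun w => ?_) (fun w => ?_) (fun v => ?_) α
  · ext i j; fin_cases i <;> fin_cases j <;>
      (simp [Matrix.mul_apply, Fin.sum_univ_four])
  · ext i j; fin_cases i <;> fin_cases j <;>
      (simp [Matrix.mul_apply, Fin.sum_univ_four])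
  · simp [form0, form1, Matrix.mulVec, dotProduct, Fin.sum_univ_four]
    linear_combination (w 1 * w 3 + w 0 * w 1) * ht
  · exact ⟨-w 1 - t * w 3, by
      simp [Matrix.mulVec, dotProduct, Fin.sum_univ_four]
      linear_combination (w 3) * ht⟩
  · rintro ⟨s0, h0⟩
    refine ⟨![s0 + -v 3 - t * v 2, s0 + -t * v 2, -v 1, -v 0], ?_⟩
    ext i; fin_cases i
    · simp [Matrix.mulVec, dotProduct, Fin.sum_univ_four]
      linear_combination h0 + (v 2) * ht
    · simp [Matrix.mulVec, dotProduct, Fin.sum_univ_four]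
      linear_combination h0 + (v 2) * ht
    · simp [Matrix.mulVec, dotProduct, Fin.sum_univ_four]
    · simp [Matrix.mulVec, dotProduct, Fin.sum_univ_four]

theorem encard_form0_inter {S : Type*} [CommRing S] [IsDomain S] {t : S}
    (ht : t ^ 2 = 2) (ht0 : t ≠ 0) (α : S) :
    {v | form0 t v = α ∧ (t ∣ v 0 + v 2 ∧ t ∣ v 1 + v 2 + v 3)}.encard =
      {w | (2 + t) * form0 t w = α}.encard := by
  refine encard_sublattice (t := t) ht0
    (!![-1 - t, -1, 0, 1; 1, -1, -1, -t; 1, -1, 0, -1 - t; -t, t, -1, 1])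
    (!![1 - t, -1 + t, -2 + t, 1 - t; 1 - t, -2 + t, -1 + t, 2 - t; 0, -1, -1 + t, 1 - t; 0, -1 +
      t, -1, 1 - t])
    ?_ ?_ (fun w => ?_) (fun w => ?_) (fun v => ?_) α
  · ext i j; fin_cases i <;> fin_cases j <;>
      (simp [Matrix.mul_apply, Fin.sum_univ_four]; try (ring_nf; try simp only [ht]; try ring_nf))
  · ext i j; fin_cases i <;> fin_cases j <;>
      (simp [Matrix.mul_apply, Fin.sum_univ_four]; try (ring_nf; try simp only [ht]; try ring_nf))
  · simp [form0, Matrix.mulVec, dotProduct, Fin.sum_univ_four]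
    linear_combination (-w 3 ^ 2 + w 2 * w 3 - w 1 * w 2 - w 1 ^ 2 + 4 * w 0 * w 3 + w 0 * w 2 +
      2 * w 0 * w 1 - w 0 ^ 2 - 2 * t * w 1 * w 3 + 4 * t * w 0 * w 3) * ht
  · exact ⟨⟨-w 3 - w 0 - t * w 1, by
      simp [Matrix.mulVec, dotProduct, Fin.sum_univ_four]
      linear_combination (w 1) * ht⟩, ⟨-2 * w 3 + w 1 - w 0 - t * w 2 - t * w 1 + t * w 0, by
      simp [Matrix.mulVec, dotProduct, Fin.sum_univ_four]
      linear_combination (w 2 + w 1 - w 0) * ht⟩⟩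
  · rintro ⟨⟨s0, h0⟩, ⟨s1, h1⟩⟩
    refine ⟨![s0 + s1 + -v 3 + v 2 + v 1 - v 0 - 2 * t * v 2 - t * v 1, s0 + -v 3 + v 2 + v 1 -
      v 0 + t * v 3 - t * v 2 - t * v 1, s1 + -v 3 + v 2 - t * v 2 - t * v 1, s1 + -v 3 + v 1 -
        t * v 2 - t * v 1], ?_⟩
    ext i; fin_cases i
    · simp [Matrix.mulVec, dotProduct, Fin.sum_univ_four]
      linear_combination h0 + h1 + (2 * v 2 + v 1) * ht
    · simp [Matrix.mulVec, dotProduct, Fin.sum_univ_four]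
      linear_combination h0 + (-v 3 + v 2 + v 1) * ht
    · simp [Matrix.mulVec, dotProduct, Fin.sum_univ_four]
      linear_combination h1 + (v 2 + v 1) * ht
    · simp [Matrix.mulVec, dotProduct, Fin.sum_univ_four]
      linear_combination h1 + (v 2 + v 1) * ht

theorem encard_form1_fst {S : Type*} [CommRing S] [IsDomain S] {t : S}
    (ht : t ^ 2 = 2) (ht0 : t ≠ 0) (α : S) :
    {v | form1 t v = α ∧ t ∣ v 1 + v 2 + v 3}.encard =
      {w | 1 * form2 t w = α}.encard := by
  refine encard_sublattice (t := t) ht0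
    (!![-1, 1, 1, t; 0, 0, 1, 0; 0, -t, 1, -1; 0, 0, -t, -1])
    (!![-t, 1, -1, -1; 0, 1 + t, -1, 1; 0, t, 0, 0; 0, -2, 0, -t])
    ?_ ?_ (fun w => ?_) (fun w => ?_) (fun v => ?_) α
  · ext i j; fin_cases i <;> fin_cases j <;>
      (simp [Matrix.mul_apply, Fin.sum_univ_four]; try (ring_nf; try simp only [ht]; try ring_nf))
  · ext i j; fin_cases i <;> fin_cases j <;>
      (simp [Matrix.mul_apply, Fin.sum_univ_four]; try (ring_nf; try simp only [ht]; try ring_nf))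
  · simp [form1, form2, Matrix.mulVec, dotProduct, Fin.sum_univ_four]
    linear_combination (-w 3 ^ 2 + 3 * w 2 * w 3 - w 2 ^ 2 + w 1 * w 3 - w 1 * w 2 + w 0 * w 2 +
      w 0 * w 1 - t * w 2 * w 3 + t * w 2 ^ 2 - t * w 1 * w 3 + t * w 1 * w 2) * ht
  · exact ⟨-w 2 - w 1 - t * w 3 + t * w 2, by
      simp [Matrix.mulVec, dotProduct, Fin.sum_univ_four]
      linear_combination (w 3 - w 2) * ht⟩
  · rintro ⟨s0, h0⟩
    refine ⟨![s0 + -v 0 - t * v 3 - t * v 2, s0 + v 1 - t * v 2, v 1, -v 3 - t * v 1], ?_⟩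
    ext i; fin_cases i
    · simp [Matrix.mulVec, dotProduct, Fin.sum_univ_four]
      linear_combination h0 + (v 3 + v 2) * ht
    · simp [Matrix.mulVec, dotProduct, Fin.sum_univ_four]
      linear_combination h0 + (v 2) * ht
    · simp [Matrix.mulVec, dotProduct, Fin.sum_univ_four]
    · simp [Matrix.mulVec, dotProduct, Fin.sum_univ_four]
      linear_combination (v 1) * ht

theorem encard_form1_snd {S : Type*} [CommRing S] [IsDomain S] {t : S}
    (ht : t ^ 2 = 2) (ht0 : t ≠ 0) (α : S) :
    {v | form1 t v = α ∧ t ∣ v 0 + v 3}.encard =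
      {w | 1 * form2 t w = α}.encard := by
  refine encard_sublattice (t := t) ht0
    (!![0, t, 0, 1; -1, 1 + t, 0, 1 + t; 0, t, -1, 1; 0, -2, 0, -1 - t])
    (!![1, -t, 0, -1; 1 + t, 0, 0, 1; t, 0, -t, 0; -2, 0, 0, -t])
    ?_ ?_ (fun w => ?_) (fun w => ?_) (fun v => ?_) α
  · ext i j; fin_cases i <;> fin_cases j <;>
      (simp [Matrix.mul_apply, Fin.sum_univ_four]; try (ring_nf; try simp only [ht]; try ring_nf))
  · ext i j; fin_cases i <;> fin_cases j <;>
      (simp [Matrix.mul_apply, Fin.sum_univ_four]; try (ring_nf; try simp only [ht]; try ring_nf))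
  · simp [form1, form2, Matrix.mulVec, dotProduct, Fin.sum_univ_four]
    linear_combination (w 2 * w 3 - w 1 * w 3 - w 1 * w 2 - 3 * w 1 ^ 2 + w 0 * w 3 -
      3 * t * w 1 * w 3 + t * w 1 ^ 2) * ht
  · exact ⟨-w 3 + w 1 - t * w 1, by
      simp [Matrix.mulVec, dotProduct, Fin.sum_univ_four]
      linear_combination (w 1) * ht⟩
  · rintro ⟨s0, h0⟩
    refine ⟨![s0 + -v 1 - t * v 3, s0 + v 0, -v 2 + v 0, -v 3 - t * v 0], ?_⟩
    ext i; fin_cases i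
    · simp [Matrix.mulVec, dotProduct, Fin.sum_univ_four]
      linear_combination h0 + (v 3) * ht
    · simp [Matrix.mulVec, dotProduct, Fin.sum_univ_four]
      linear_combination h0 + (0) * ht
    · simp [Matrix.mulVec, dotProduct, Fin.sum_univ_four]
      linear_combination (0) * ht
    · simp [Matrix.mulVec, dotProduct, Fin.sum_univ_four]
      linear_combination (v 0) * ht

theorem encard_form1_thd {S : Type*} [CommRing S] [IsDomain S] {t : S}
    (ht : t ^ 2 = 2) (ht0 : t ≠ 0) (α : S) :
    {v | form1 t v = α ∧ t ∣ v 0 + v 1 + v 2}.encard =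
      {w | (2 + t) * form0 t w = α}.encard := by
  refine encard_sublattice (t := t) ht0
    (!![-1, -1 - t, 0, 0; 0, 0, 0, 1 + t; -1, 1, 0, 1 + t; 0, 0, -1, -1 - t])
    (!![1 - t, 1, -1, 0; 1 - t, 1 - t, -1 + t, 0; 0, -t, 0, -t; 0, 2 - t, 0, 0])
    ?_ ?_ (fun w => ?_) (fun w => ?_) (fun v => ?_) α
  · ext i j; fin_cases i <;> fin_cases j <;>
      (simp [Matrix.mul_apply, Fin.sum_univ_four]; try (ring_nf; try simp only [ht]; try ring_nf))
  · ext i j; fin_cases i <;> fin_cases j <;>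
      (simp [Matrix.mul_apply, Fin.sum_univ_four]; try (ring_nf; try simp only [ht]; try ring_nf))
  · simp [form1, form0, Matrix.mulVec, dotProduct, Fin.sum_univ_four]
    linear_combination (-w 2 * w 3 - w 1 * w 3 + w 1 * w 2 + w 0 * w 3 - w 0 * w 2 -
      t * w 3 ^ 2) * ht
  · exact ⟨2 * w 3 - w 1 + t * w 3 - t * w 0, by
      simp [Matrix.mulVec, dotProduct, Fin.sum_univ_four]
      linear_combination (-w 3 + w 0) * ht⟩
  · rintro ⟨s0, h0⟩
    refine ⟨![s0 + -v 0 - t * v 2, s0 + v 2 - v 1 - v 0 - t * v 2, -v 3 - v 1, -v 1 + t * v 1], ?_⟩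
    ext i; fin_cases i
    · simp [Matrix.mulVec, dotProduct, Fin.sum_univ_four]
      linear_combination h0 + (v 2) * ht
    · simp [Matrix.mulVec, dotProduct, Fin.sum_univ_four]
      linear_combination h0 + (v 2) * ht
    · simp [Matrix.mulVec, dotProduct, Fin.sum_univ_four]
      linear_combination (0) * ht
    · simp [Matrix.mulVec, dotProduct, Fin.sum_univ_four]
      linear_combination (-v 1) * ht

theorem encard_form1_inter {S : Type*} [CommRing S] [IsDomain S] {t : S}
    (ht : t ^ 2 = 2) (ht0 : t ≠ 0) (α : S) :
    {v | form1 t v = α ∧ (t ∣ v 0 + v 1 + v 2 ∧ t ∣ v 1 + v 2 + v 3)}.encard =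
      {w | (2 + t) * form1 t w = α}.encard := by
  refine encard_sublattice (t := t) ht0
    (!![1 + t, -1, 1, 0; 1 + t, 0, 2 + t, 1 + t; 0, 1 + t, 1, 1 + t; -1 - t, -1, -1 - t, -2 - t])
    (!![1, 1 - t, -1 + t, 0; 1, 0, t, 1; 0, 1, -1 + t, 1; -1, 1 - t, -1, -t])
    ?_ ?_ (fun w => ?_) (fun w => ?_) (fun v => ?_) α
  · ext i j; fin_cases i <;> fin_cases j <;>
      (simp [Matrix.mul_apply, Fin.sum_univ_four]; try (ring_nf; try simp only [ht]; try ring_nf))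
  · ext i j; fin_cases i <;> fin_cases j <;>
      (simp [Matrix.mul_apply, Fin.sum_univ_four]; try (ring_nf; try simp only [ht]; try ring_nf))
  · simp [form1, Matrix.mulVec, dotProduct, Fin.sum_univ_four]
    linear_combination (-w 3 ^ 2 - w 2 * w 3 - w 2 ^ 2 - 3 * w 1 * w 3 - w 1 ^ 2 - w 0 * w 3 -
      2 * w 0 * w 2 - t * w 3 ^ 2 - t * w 2 * w 3 - t * w 1 * w 3 - t * w 1 * w 2 -
        t * w 0 * w 3 - t * w 0 * w 2 - t * w 0 ^ 2) * ht
  · exact ⟨⟨2 * w 3 + w 2 + w 1 + 2 * w 0 + t * w 3 + 2 * t * w 2 + t * w 0, by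
      simp [Matrix.mulVec, dotProduct, Fin.sum_univ_four]
      linear_combination (-w 3 - 2 * w 2 - w 0) * ht⟩, ⟨w 3 + w 1 + t * w 2, by
      simp [Matrix.mulVec, dotProduct, Fin.sum_univ_four]
      linear_combination (-w 2) * ht⟩⟩
  · rintro ⟨⟨s0, h0⟩, ⟨s1, h1⟩⟩
    refine ⟨![s0 + v 2 - v 1 - t * v 2, s0 + s1 + v 2 - t * v 2 - t * v 1, s1 + v 2 - t * v 2,
      s0 + -v 3 - v 1 - t * v 2 - t * v 0], ?_⟩
    ext i; fin_cases i
    · simp [Matrix.mulVec, dotProduct, Fin.sum_univ_four]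
      linear_combination h0 + (v 2) * ht
    · simp [Matrix.mulVec, dotProduct, Fin.sum_univ_four]
      linear_combination h0 + h1 + (v 2 + v 1) * ht
    · simp [Matrix.mulVec, dotProduct, Fin.sum_univ_four]
      linear_combination h1 + (v 2) * ht
    · simp [Matrix.mulVec, dotProduct, Fin.sum_univ_four]
      linear_combination h0 + (v 2 + v 0) * ht

theorem encard_form2_fst {S : Type*} [CommRing S] [IsDomain S] {t : S}
    (ht : t ^ 2 = 2) (ht0 : t ≠ 0) (α : S) :
    {v | form2 t v = α ∧ t ∣ v 1 + v 3}.encard =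
      {w | 1 * form3 t w = α}.encard := by
  refine encard_sublattice (t := t) ht0
    (!![-1, t, 0, -t; 0, 2 + t, 0, -1; 0, 2, -1, -1; 0, -2 * t, 0, -1 + t])
    (!![-t, 2 + t, 0, 2 + t; 0, 1 - t, 0, -1; 0, 2, -t, t; 0, -2 * t, 0, -2 - t])
    ?_ ?_ (fun w => ?_) (fun w => ?_) (fun v => ?_) α
  · ext i j; fin_cases i <;> fin_cases j <;>
      (simp [Matrix.mul_apply, Fin.sum_univ_four]; try (ring_nf; try simp only [ht]; try ring_nf))
  · ext i j; fin_cases i <;> fin_cases j <;>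
      (simp [Matrix.mul_apply, Fin.sum_univ_four]; try (ring_nf; try simp only [ht]; try ring_nf))
  · simp [form2, form3, Matrix.mulVec, dotProduct, Fin.sum_univ_four]
    linear_combination (-2 * w 3 ^ 2 - w 2 * w 3 + 5 * w 1 * w 3 + 2 * w 1 * w 2 - 2 * w 1 ^ 2 +
      t * w 3 ^ 2 - 3 * t * w 1 * w 3 + 2 * t * w 1 ^ 2) * ht
  · exact ⟨w 3 - w 1 - t * w 3 + t * w 1, by
      simp [Matrix.mulVec, dotProduct, Fin.sum_univ_four]
      linear_combination (w 3 - w 1) * ht⟩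
  · rintro ⟨s0, h0⟩
    refine ⟨![v 3 + v 1 - v 0 + t * v 3 + t * v 1, s0 + -v 1 - t * v 3, v 3 - v 2 + t * v 1,
      -v 3 - 2 * v 1 - t * v 3], ?_⟩
    ext i; fin_cases i
    · simp [Matrix.mulVec, dotProduct, Fin.sum_univ_four]
      linear_combination (-v 3 - v 1) * ht
    · simp [Matrix.mulVec, dotProduct, Fin.sum_univ_four]
      linear_combination h0 + (v 3) * ht
    · simp [Matrix.mulVec, dotProduct, Fin.sum_univ_four]
      linear_combination (-v 1) * ht
    · simp [Matrix.mulVec, dotProduct, Fin.sum_univ_four]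
      linear_combination (v 3) * ht

theorem encard_form2_snd {S : Type*} [CommRing S] [IsDomain S] {t : S}
    (ht : t ^ 2 = 2) (ht0 : t ≠ 0) (α : S) :
    {v | form2 t v = α ∧ t ∣ v 0 + v 2 + v 3}.encard =
      {w | 1 * form3 t w = α}.encard := by
  refine encard_sublattice (t := t) ht0
    (!![0, -1 + t, 1, 1; -1, 2 + t, 1 + t, 0; 0, 3 + t, 1 + t, t; 0, -2 * t, -2, -1])
    (!![-1 - t, -t, -1 - t, -3 - 2 * t; 1 - t, 0, 1, 1; 1 - t, 0, -1 - t, -1 - 2 * t; 2, 0, 2,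
      2 + t])
    ?_ ?_ (fun w => ?_) (fun w => ?_) (fun v => ?_) α
  · ext i j; fin_cases i <;> fin_cases j <;>
      (simp [Matrix.mul_apply, Fin.sum_univ_four]; try (ring_nf; try simp only [ht]; try ring_nf))
  · ext i j; fin_cases i <;> fin_cases j <;>
      (simp [Matrix.mul_apply, Fin.sum_univ_four]; try (ring_nf; try simp only [ht]; try ring_nf))
  · simp [form2, form3, Matrix.mulVec, dotProduct, Fin.sum_univ_four]
    linear_combination (-2 * w 2 * w 3 - 2 * w 2 ^ 2 + 2 * w 1 * w 3 - 5 * w 1 ^ 2 +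
      2 * w 0 * w 1 - 2 * t * w 1 * w 3 - 4 * t * w 1 * w 2) * ht
  · exact ⟨w 3 + w 2 + t * w 1, by
      simp [Matrix.mulVec, dotProduct, Fin.sum_univ_four]
      linear_combination (-w 1) * ht⟩
  · rintro ⟨s0, h0⟩
    refine ⟨![s0 + -2 * v 3 - v 2 - v 1 - v 0 - 2 * t * v 3 - t * v 2 - t * v 0, s0 + -v 0, s0 +
      -2 * v 3 - v 2 - v 0 - t * v 3 - t * v 2, v 3 + t * v 3 + t * v 2 + t * v 0], ?_⟩
    ext i; fin_cases i
    · simp [Matrix.mulVec, dotProduct, Fin.sum_univ_four]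
      linear_combination h0 + (2 * v 3 + v 2 + v 0) * ht
    · simp [Matrix.mulVec, dotProduct, Fin.sum_univ_four]
      linear_combination h0 + (0) * ht
    · simp [Matrix.mulVec, dotProduct, Fin.sum_univ_four]
      linear_combination h0 + (v 3 + v 2) * ht
    · simp [Matrix.mulVec, dotProduct, Fin.sum_univ_four]
      linear_combination (-v 3 - v 2 - v 0) * ht

theorem encard_form2_thd {S : Type*} [CommRing S] [IsDomain S] {t : S}
    (ht : t ^ 2 = 2) (ht0 : t ≠ 0) (α : S) :
    {v | form2 t v = α ∧ t ∣ v 0 + v 1 + v 2}.encard =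
      {w | (2 + t) * form1 t w = α}.encard := by
  refine encard_sublattice (t := t) ht0
    (!![0, -1, 0, -1 - t; 0, 0, 1 + t, 0; 0, -1 - t, 1 + t, -1 - t; -1, 1, -1 - t, 0])
    (!![1, 1 - t, -1, -t; 1, 1, -1, 0; 0, 2 - t, 0, 0; -1, 1 - t, -1 + t, 0])
    ?_ ?_ (fun w => ?_) (fun w => ?_) (fun v => ?_) α
  · ext i j; fin_cases i <;> fin_cases j <;>
      (simp [Matrix.mul_apply, Fin.sum_univ_four]; try (ring_nf; try simp only [ht]; try ring_nf))
  · ext i j; fin_cases i <;> fin_cases j <;>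
      (simp [Matrix.mul_apply, Fin.sum_univ_four]; try (ring_nf; try simp only [ht]; try ring_nf))
  · simp [form2, form1, Matrix.mulVec, dotProduct, Fin.sum_univ_four]
    linear_combination (w 3 ^ 2 + w 2 * w 3 + w 1 * w 2 - w 0 * w 2 + w 0 * w 1 + t * w 2 * w 3 -
      t * w 2 ^ 2 + t * w 1 * w 2) * ht
  · exact ⟨-2 * w 3 + 2 * w 2 - w 1 - t * w 3 + t * w 2 - t * w 1, by
      simp [Matrix.mulVec, dotProduct, Fin.sum_univ_four]
      linear_combination (w 3 - w 2 + w 1) * ht⟩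
  · rintro ⟨s0, h0⟩
    refine ⟨![s0 + -v 3 - v 1 - t * v 2, s0 + -t * v 2, -v 1 + t * v 1, s0 + v 2 - v 1 -
      t * v 2 - t * v 0], ?_⟩
    ext i; fin_cases i
    · simp [Matrix.mulVec, dotProduct, Fin.sum_univ_four]
      linear_combination h0 + (v 2) * ht
    · simp [Matrix.mulVec, dotProduct, Fin.sum_univ_four]
      linear_combination h0 + (v 2) * ht
    · simp [Matrix.mulVec, dotProduct, Fin.sum_univ_four]
      linear_combination (-v 1) * ht
    · simp [Matrix.mulVec, dotProduct, Fin.sum_univ_four]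
      linear_combination h0 + (v 2 + v 0) * ht

theorem encard_form2_inter {S : Type*} [CommRing S] [IsDomain S] {t : S}
    (ht : t ^ 2 = 2) (ht0 : t ≠ 0) (α : S) :
    {v | form2 t v = α ∧ (t ∣ v 0 + v 1 + v 2 ∧ t ∣ v 1 + v 3)}.encard =
      {w | (2 + t) * form2 t w = α}.encard := by
  refine encard_sublattice (t := t) ht0
    (!![0, -1, 0, -1 - t; 1 + t, -1 - t, 1 + t, 0; 1 + t, 0, 1 + t, 1 + t; -1 - t, 1, -1, 0])
    (!![0, 1 - t, 0, -1; 1, -1, 1, 0; 1, 0, 1, 1; -1, -1 + t, 1 - t, 0])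
    ?_ ?_ (fun w => ?_) (fun w => ?_) (fun v => ?_) α
  · ext i j; fin_cases i <;> fin_cases j <;>
      (simp [Matrix.mul_apply, Fin.sum_univ_four]; try (ring_nf; try simp only [ht]; try ring_nf))
  · ext i j; fin_cases i <;> fin_cases j <;>
      (simp [Matrix.mul_apply, Fin.sum_univ_four]; try (ring_nf; try simp only [ht]; try ring_nf))
  · simp [form2, Matrix.mulVec, dotProduct, Fin.sum_univ_four]
    linear_combination (w 3 ^ 2 + w 1 * w 2 - 2 * w 0 * w 2 + w 0 * w 1 - t * w 0 * w 3 -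
      2 * t * w 0 * w 2 + t * w 0 * w 1 - t * w 0 ^ 2) * ht
  · exact ⟨⟨2 * w 2 - w 1 + 2 * w 0 + t * w 2 - t * w 1 + t * w 0, by
      simp [Matrix.mulVec, dotProduct, Fin.sum_univ_four]
      linear_combination (-w 2 + w 1 - w 0) * ht⟩, ⟨w 2 - w 1, by
      simp [Matrix.mulVec, dotProduct, Fin.sum_univ_four]
      linear_combination (0) * ht⟩⟩
  · rintro ⟨⟨s0, h0⟩, ⟨s1, h1⟩⟩
    refine ⟨![s1 + -v 1 - t * v 3, s0 + -t * v 1, s0 + s1 + -t * v 1, s0 + -v 2 + v 1 - t * v 1 -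
      t * v 0], ?_⟩
    ext i; fin_cases i
    · simp [Matrix.mulVec, dotProduct, Fin.sum_univ_four]
      linear_combination h1 + (v 3) * ht
    · simp [Matrix.mulVec, dotProduct, Fin.sum_univ_four]
      linear_combination h0 + (v 1) * ht
    · simp [Matrix.mulVec, dotProduct, Fin.sum_univ_four]
      linear_combination h0 + h1 + (v 1) * ht
    · simp [Matrix.mulVec, dotProduct, Fin.sum_univ_four]
      linear_combination h0 + (v 1 + v 0) * ht

/-- Together with `encard_form0_inter` and `encard_form0_inter_thd` this treats the three planes
modulo √2 on which `form0` vanishes; each gives a copy of the full form scaled by 2 + √2. -/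
theorem encard_form0_inter_snd {S : Type*} [CommRing S] [IsDomain S] {t : S}
    (ht : t ^ 2 = 2) (ht0 : t ≠ 0) (α : S) :
    {v | form0 t v = α ∧ (t ∣ v 1 + v 3 ∧ t ∣ v 0 + v 2 + v 3)}.encard =
      {w | (2 + t) * form0 t w = α}.encard := by
  refine encard_sublattice (t := t) ht0
    (!![-1, -1 - t, -t, -1; 0, 0, 1, -1; -1, 1, 1, t; 0, 0, -1 - t, -1])
    (!![1 - t, -2 + t, -1, 1 - t; 1 - t, -1 + t, -1 + t, 2 - t; 0, -1 + t, 0, 1 - t; 0, -1, 0,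
      1 - t])
    ?_ ?_ (fun w => ?_) (fun w => ?_) (fun v => ?_) α
  · ext i j; fin_cases i <;> fin_cases j <;>
      (simp [Matrix.mul_apply, Fin.sum_univ_four]; try (ring_nf; try simp only [ht]; try ring_nf))
  · ext i j; fin_cases i <;> fin_cases j <;>
      (simp [Matrix.mul_apply, Fin.sum_univ_four]; try (ring_nf; try simp only [ht]; try ring_nf))
  · simp [form0, Matrix.mulVec, dotProduct, Fin.sum_univ_four]
    linear_combination (-w 3 ^ 2 - w 2 ^ 2 - w 1 * w 3 - w 1 * w 2 - w 0 * w 3 + w 0 * w 2 -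
      2 * t * w 2 * w 3 - t * w 1 * w 3) * ht
  · exact ⟨⟨-w 2 - t * w 3, by
      simp [Matrix.mulVec, dotProduct, Fin.sum_univ_four]
      linear_combination (w 3) * ht⟩, ⟨w 3 - 2 * w 2 - w 1 - t * w 3 - t * w 0, by
      simp [Matrix.mulVec, dotProduct, Fin.sum_univ_four]
      linear_combination (w 3 + w 0) * ht⟩⟩
  · rintro ⟨⟨s0, h0⟩, ⟨s1, h1⟩⟩
    refine ⟨![s1 + -v 3 + v 1 - v 0 - t * v 2 - t * v 1, s0 + s1 + -v 3 + v 2 + v 1 - v 0 -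
      t * v 2 - t * v 1, s0 + -v 3 + v 1 - t * v 1, s0 + -v 3 - t * v 1], ?_⟩
    ext i; fin_cases i
    · simp [Matrix.mulVec, dotProduct, Fin.sum_univ_four]
      linear_combination h1 + (v 2 + v 1) * ht
    · simp [Matrix.mulVec, dotProduct, Fin.sum_univ_four]
      linear_combination h0 + h1 + (v 2 + v 1) * ht
    · simp [Matrix.mulVec, dotProduct, Fin.sum_univ_four]
      linear_combination h0 + (v 1) * ht
    · simp [Matrix.mulVec, dotProduct, Fin.sum_univ_four]
      linear_combination h0 + (v 1) * ht

theorem encard_form0_inter_thd {S : Type*} [CommRing S] [IsDomain S] {t : S}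
    (ht : t ^ 2 = 2) (ht0 : t ≠ 0) (α : S) :
    {v | form0 t v = α ∧ (t ∣ v 0 + v 1 + v 2 + v 3 ∧ t ∣ v 0 + v 1)}.encard =
      {w | (2 + t) * form0 t w = α}.encard := by
  refine encard_sublattice (t := t) ht0
    (!![-1, -1 - t, 0, -1 - t; -1, 1, 0, 1 + t; 0, 0, -1, 1; 0, 0, -1, -1 - t])
    (!![1 - t, -1, -1 + t, 1 - t; 1 - t, -1 + t, -2 + t, 2 - t; 0, 0, -1, 1 - t; 0, 0, -1 + t,
      1 - t])
    ?_ ?_ (fun w => ?_) (fun w => ?_) (fun v => ?_) α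
  · ext i j; fin_cases i <;> fin_cases j <;>
      (simp [Matrix.mul_apply, Fin.sum_univ_four]; try (ring_nf; try simp only [ht]; try ring_nf))
  · ext i j; fin_cases i <;> fin_cases j <;>
      (simp [Matrix.mul_apply, Fin.sum_univ_four]; try (ring_nf; try simp only [ht]; try ring_nf))
  · simp [form0, Matrix.mulVec, dotProduct, Fin.sum_univ_four]
    linear_combination (-2 * w 3 ^ 2 - 3 * w 1 * w 3 + w 1 * w 2 + w 0 * w 3 - w 0 * w 2 -
      2 * t * w 3 ^ 2 - t * w 1 * w 3) * ht
  · exact ⟨⟨-w 3 - w 1 - t * w 2 - t * w 0, by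
      simp [Matrix.mulVec, dotProduct, Fin.sum_univ_four]
      linear_combination (w 2 + w 0) * ht⟩, ⟨-w 1 - t * w 0, by
      simp [Matrix.mulVec, dotProduct, Fin.sum_univ_four]
      linear_combination (w 0) * ht⟩⟩
  · rintro ⟨⟨s0, h0⟩, ⟨s1, h1⟩⟩
    refine ⟨![s0 + -v 3 + v 2 - v 0 - t * v 2 - t * v 1, s1 + -v 3 + v 2 + v 1 - v 0 + t * v 3 -
      t * v 2 - t * v 1, s0 + s1 + -v 3 - t * v 2 - t * v 1 - t * v 0, s0 + s1 + -v 3 + v 2 -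
        t * v 2 - t * v 1 - t * v 0], ?_⟩
    ext i; fin_cases i
    · simp [Matrix.mulVec, dotProduct, Fin.sum_univ_four]
      linear_combination h0 + (v 2 + v 1) * ht
    · simp [Matrix.mulVec, dotProduct, Fin.sum_univ_four]
      linear_combination h1 + (-v 3 + v 2 + v 1) * ht
    · simp [Matrix.mulVec, dotProduct, Fin.sum_univ_four]
      linear_combination h0 + h1 + (v 2 + v 1 + v 0) * ht
    · simp [Matrix.mulVec, dotProduct, Fin.sum_univ_four]
      linear_combination h0 + h1 + (v 2 + v 1 + v 0) * ht

/-! ### Inclusion-exclusion along the chain of forms -/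

/-- When all pairwise intersections coincide, points of `D` are counted three times on the right.
The identity is kept free of subtraction because it is used in ℕ∞ before finiteness is known. -/
theorem encard_add_two_mul_inter {V : Type*} {S A B C D : Set V} (hS : S = A ∪ B ∪ C)
    (hAB : A ∩ B = D) (hAC : A ∩ C = D) (hBC : B ∩ C = D) :
    S.encard + 2 * D.encard = A.encard + B.encard + C.encard := by
  have h1 := Set.encard_union_add_encard_inter (A ∪ B) C
  have h2 := Set.encard_union_add_encard_inter A B
  rw [Set.union_inter_distrib_right, hAC, hBC, Set.union_self, ← hS] at h1
  rw [hAB] at h2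
  rw [← h2, add_right_comm, ← h1]
  ring

/-- The three linear forms add up to zero modulo √2. Hence at least one of them is divisible by √2
at every vector, and any two being divisible forces the third. The same mechanism drives the next
two relations. -/
theorem encard_form0_add (α : 𝓞 K) :
    {v | form0 rtInt v = α}.encard + 2 * {v | (2 + rtInt) * form0 rtInt v = α}.encard =
      3 * {v | form1 rtInt v = α}.encard := by
  have ht := rtInt_sq
  have h0 := rtInt_ne_zero
  have h := encard_add_two_mul_inter (S := {v | form0 rtInt v = α})
    (A := {v | form0 rtInt v = α ∧ rtInt ∣ v 1 + v 2 + v 3})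
    (B := {v | form0 rtInt v = α ∧ rtInt ∣ v 0 + v 1 + v 3})
    (C := {v | form0 rtInt v = α ∧ rtInt ∣ v 0 + v 2})
    (D := {v | form0 rtInt v = α ∧ (rtInt ∣ v 0 + v 2 ∧ rtInt ∣ v 1 + v 2 + v 3)})
    (by ext v; simp only [Set.mem_ofPred_eq, Set.mem_union, rtInt_dvd_add_iff]; tauto)
    (by ext v; simp only [Set.mem_ofPred_eq, Set.mem_inter_iff, rtInt_dvd_add_iff]; tauto)
    (by ext v; simp only [Set.mem_ofPred_eq, Set.mem_inter_iff, rtInt_dvd_add_iff]; tauto)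
    (by ext v; simp only [Set.mem_ofPred_eq, Set.mem_inter_iff, rtInt_dvd_add_iff]; tauto)
  rw [encard_form0_fst ht h0, encard_form0_snd ht h0, encard_form0_thd ht h0,
    encard_form0_inter ht h0] at h
  simp only [one_mul] at h
  rw [h]; ring

/-- Here the three sublattices are no longer alike: two descend to the next form of the chain, while
the third climbs back to the previous form scaled by 2 + √2. The same happens one level further
down. -/
theorem encard_form1_add (α : 𝓞 K) :
    {v | form1 rtInt v = α}.encard + 2 * {v | (2 + rtInt) * form1 rtInt v = α}.encard =
      2 * {v | form2 rtInt v = α}.encard + {v | (2 + rtInt) * form0 rtInt v = α}.encard := by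
  have ht := rtInt_sq
  have h0 := rtInt_ne_zero
  have h := encard_add_two_mul_inter (S := {v | form1 rtInt v = α})
    (A := {v | form1 rtInt v = α ∧ rtInt ∣ v 1 + v 2 + v 3})
    (B := {v | form1 rtInt v = α ∧ rtInt ∣ v 0 + v 3})
    (C := {v | form1 rtInt v = α ∧ rtInt ∣ v 0 + v 1 + v 2})
    (D := {v | form1 rtInt v = α ∧ (rtInt ∣ v 0 + v 1 + v 2 ∧ rtInt ∣ v 1 + v 2 + v 3)})
    (by ext v; simp only [Set.mem_ofPred_eq, Set.mem_union, rtInt_dvd_add_iff]; tauto)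
    (by ext v; simp only [Set.mem_ofPred_eq, Set.mem_inter_iff, rtInt_dvd_add_iff]; tauto)
    (by ext v; simp only [Set.mem_ofPred_eq, Set.mem_inter_iff, rtInt_dvd_add_iff]; tauto)
    (by ext v; simp only [Set.mem_ofPred_eq, Set.mem_inter_iff, rtInt_dvd_add_iff]; tauto)
  rw [encard_form1_fst ht h0, encard_form1_snd ht h0, encard_form1_thd ht h0,
    encard_form1_inter ht h0] at h
  simp only [one_mul] at h
  rw [h]; ring

theorem encard_form2_add (α : 𝓞 K) :
    {v | form2 rtInt v = α}.encard + 2 * {v | (2 + rtInt) * form2 rtInt v = α}.encard =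
      2 * {v | form3 rtInt v = α}.encard + {v | (2 + rtInt) * form1 rtInt v = α}.encard := by
  have ht := rtInt_sq
  have h0 := rtInt_ne_zero
  have h := encard_add_two_mul_inter (S := {v | form2 rtInt v = α})
    (A := {v | form2 rtInt v = α ∧ rtInt ∣ v 1 + v 3})
    (B := {v | form2 rtInt v = α ∧ rtInt ∣ v 0 + v 2 + v 3})
    (C := {v | form2 rtInt v = α ∧ rtInt ∣ v 0 + v 1 + v 2})
    (D := {v | form2 rtInt v = α ∧ (rtInt ∣ v 0 + v 1 + v 2 ∧ rtInt ∣ v 1 + v 3)})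
    (by ext v; simp only [Set.mem_ofPred_eq, Set.mem_union, rtInt_dvd_add_iff]; tauto)
    (by ext v; simp only [Set.mem_ofPred_eq, Set.mem_inter_iff, rtInt_dvd_add_iff]; tauto)
    (by ext v; simp only [Set.mem_ofPred_eq, Set.mem_inter_iff, rtInt_dvd_add_iff]; tauto)
    (by ext v; simp only [Set.mem_ofPred_eq, Set.mem_inter_iff, rtInt_dvd_add_iff]; tauto)
  rw [encard_form2_fst ht h0, encard_form2_snd ht h0, encard_form2_thd ht h0,
    encard_form2_inter ht h0] at h
  simp only [one_mul] at h
  rw [h]; ring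

/-! ### The Hecke relation at √2 for the cubian form -/

/-- Since 1 + √2 is a unit, 2 + √2 generates the same ideal as √2. It has norm 2 and is totally
positive, as a scaling factor of definite forms must be, whereas √2 has norm −2. -/
theorem two_add_rtInt_eq : 2 + rtInt = rtInt * (1 + rtInt) := by
  linear_combination -rtInt_sq

theorem two_add_rtInt_ne_zero : 2 + rtInt ≠ 0 := by
  intro h
  have h1 : (2 + rtInt) * (2 - rtInt) = 2 := by linear_combination -rtInt_sq
  rw [h, zero_mul] at h1
  exact two_ne_zero h1.symm

theorem two_add_rtInt_dvd_iff {x : 𝓞 K} : 2 + rtInt ∣ x ↔ rtInt ∣ x := by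
  rw [two_add_rtInt_eq]
  refine ⟨fun h => (dvd_mul_right _ _).trans h, ?_⟩
  rintro ⟨y, rfl⟩
  exact ⟨(rtInt - 1) * y, by linear_combination (-rtInt * y) * rtInt_sq⟩

theorem form0_smul (c : 𝓞 K) (v : Fin 4 → 𝓞 K) :
    form0 rtInt (c • v) = c ^ 2 * form0 rtInt v := by
  simp only [form0, Pi.smul_apply, smul_eq_mul]; ring

/-- Modulo √2 the terms carrying the factor t disappear, and the remaining form over the field with
two elements is hyperbolic. Its isotropic vectors are the union of the three planes of one ruling,
checked here on all sixteen residue classes. -/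
theorem rtInt_dvd_form0 (v : Fin 4 → 𝓞 K) : rtInt ∣ form0 rtInt v ↔
    (rtInt ∣ v 0 + v 2 ∧ rtInt ∣ v 1 + v 2 + v 3) ∨ (rtInt ∣ v 1 + v 3 ∧ rtInt ∣ v 0 + v 2 + v 3) ∨
    (rtInt ∣ v 0 + v 1 + v 2 + v 3 ∧ rtInt ∣ v 0 + v 1) := by
  have e : form0 rtInt v = v 3 * v 3 + v 2 * v 2 + v 1 * v 2 + v 1 * v 1 + v 0 * v 3 + v 0 * v 0 +
      rtInt * (v 2 * v 3 + v 1 * v 3 + v 0 * v 2 + v 0 * v 1) := by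
    rw [form0]; ring
  rw [e]
  simp only [rtInt_dvd_add_iff, prime_rtInt.dvd_mul, dvd_refl, true_or, iff_true]
  by_cases h0 : rtInt ∣ v 0 <;> by_cases h1 : rtInt ∣ v 1 <;> by_cases h2 : rtInt ∣ v 2 <;>
    by_cases h3 : rtInt ∣ v 3 <;> simp [h0, h1, h2, h3]

/-- A vector of norm (2 + √2)α is isotropic modulo √2, so it lies in one of three planes, any two of
which meet only in zero. The common intersection is therefore √2 times the lattice, and rescaling by
2 + √2 turns it into the solutions at α/(2 + √2). -/
theorem encard_form0_two_add_rtInt_mul (α : 𝓞 K) :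
    {v | form0 rtInt v = (2 + rtInt) * α}.encard +
        2 * {v | (2 + rtInt) * form0 rtInt v = α}.encard =
      3 * {v | form0 rtInt v = α}.encard := by
  have ht := rtInt_sq
  have h0 := rtInt_ne_zero
  have hd : ∀ v : Fin 4 → 𝓞 K, form0 rtInt v = (2 + rtInt) * α →
      (rtInt ∣ v 0 + v 2 ∧ rtInt ∣ v 1 + v 2 + v 3) ∨ (rtInt ∣ v 1 + v 3 ∧ rtInt ∣ v 0 + v 2 + v 3) ∨
      (rtInt ∣ v 0 + v 1 + v 2 + v 3 ∧ rtInt ∣ v 0 + v 1) := by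
    intro v hv
    rw [← rtInt_dvd_form0, hv]
    exact Dvd.dvd.mul_right (two_add_rtInt_dvd_iff.1 dvd_rfl) _
  have h := encard_add_two_mul_inter
    (S := {v | form0 rtInt v = (2 + rtInt) * α})
    (A := {v | form0 rtInt v = (2 + rtInt) * α ∧ (rtInt ∣ v 0 + v 2 ∧ rtInt ∣ v 1 + v 2 + v 3)})
    (B := {v | form0 rtInt v = (2 + rtInt) * α ∧ (rtInt ∣ v 1 + v 3 ∧ rtInt ∣ v 0 + v 2 + v 3)})
    (C := {v | form0 rtInt v = (2 + rtInt) * α ∧ (rtInt ∣ v 0 + v 1 + v 2 + v 3 ∧ rtInt ∣ v 0 +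
      v 1)})
    (D := {v | form0 rtInt v = (2 + rtInt) * α ∧ (rtInt ∣ v 0 ∧ rtInt ∣ v 1 ∧ rtInt ∣ v 2 ∧
      rtInt ∣ v 3)})
    (by ext v; have := hd v; simp only [Set.mem_ofPred_eq, Set.mem_union]; tauto)
    (by ext v; simp only [Set.mem_ofPred_eq, Set.mem_inter_iff, rtInt_dvd_add_iff]; tauto)
    (by ext v; simp only [Set.mem_ofPred_eq, Set.mem_inter_iff, rtInt_dvd_add_iff]; tauto)
    (by ext v; simp only [Set.mem_ofPred_eq, Set.mem_inter_iff, rtInt_dvd_add_iff]; tauto)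
  rw [encard_form0_inter ht h0, encard_form0_inter_snd ht h0, encard_form0_inter_thd ht h0] at h
  have h1 : {w : Fin 4 → 𝓞 K | (2 + rtInt) * form0 rtInt w = (2 + rtInt) * α} =
      {v | form0 rtInt v = α} := by
    ext v
    exact mul_right_inj' two_add_rtInt_ne_zero
  have h2 : {v | form0 rtInt v = (2 + rtInt) * α ∧ (rtInt ∣ v 0 ∧ rtInt ∣ v 1 ∧ rtInt ∣ v 2 ∧
    rtInt ∣ v 3)} =
      (fun w => (2 + rtInt) • w) '' {v | (2 + rtInt) * form0 rtInt v = α} := by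
    ext v
    simp only [Set.mem_ofPred_eq, Set.mem_image]
    constructor
    · rintro ⟨hv, hdv⟩
      simp only [← two_add_rtInt_dvd_iff] at hdv
      obtain ⟨⟨a, ha⟩, ⟨b, hb⟩, ⟨c, hc⟩, ⟨d, hd⟩⟩ := hdv
      have hw : (2 + rtInt) • ![a, b, c, d] = v := by
        ext1 i; fin_cases i <;> simp [ha, hb, hc, hd]
      refine ⟨![a, b, c, d], ?_, hw⟩
      rw [← hw, form0_smul] at hv
      apply mul_left_cancel₀ two_add_rtInt_ne_zero
      rw [← hv]; ring
    · rintro ⟨w, hw, rfl⟩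
      refine ⟨by rw [form0_smul, ← hw]; ring, ?_⟩
      simp only [← two_add_rtInt_dvd_iff, Pi.smul_apply, smul_eq_mul]
      exact ⟨dvd_mul_right _ _, dvd_mul_right _ _, dvd_mul_right _ _, dvd_mul_right _ _⟩
  rw [h1, h2, (smul_right_injective _ two_add_rtInt_ne_zero).injOn.encard_image] at h
  rw [h]; ring

/-! ### The reduced norm -/

theorem reducedNorm_mul (x y : ℍ[K,-1,-1]) :
    reducedNorm (x * y) = reducedNorm x * reducedNorm y := by
  simp only [reducedNorm_eq, QuaternionAlgebra.re_mul, QuaternionAlgebra.imI_mul,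
    QuaternionAlgebra.imJ_mul, QuaternionAlgebra.imK_mul]
  ring

theorem reducedNorm_star (x : ℍ[K,-1,-1]) : reducedNorm (star x) = reducedNorm x := by
  simp [reducedNorm_eq]

theorem reducedNorm_re (q : ℍ[K,-1,-1]) : (reducedNorm q).re =
    (q.re.re ^ 2 + q.imI.re ^ 2 + q.imJ.re ^ 2 + q.imK.re ^ 2) +
      2 * (q.re.im ^ 2 + q.imI.im ^ 2 + q.imJ.im ^ 2 + q.imK.im ^ 2) := by
  simp only [reducedNorm_eq, sq, QuadraticAlgebra.re_add, QuadraticAlgebra.re_mul]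
  ring

theorem reducedNorm_im (q : ℍ[K,-1,-1]) : (reducedNorm q).im =
    2 * (q.re.re * q.re.im + q.imI.re * q.imI.im + q.imJ.re * q.imJ.im +
      q.imK.re * q.imK.im) := by
  simp only [reducedNorm_eq, sq, QuadraticAlgebra.im_add, QuadraticAlgebra.im_mul]
  ring

/-- With U, W the square lengths of the rational and √2 parts and X their scalar product, the norm
is (U + 2W)² − 8X² = (U − 2W)² + 8(UW − X²). Lagrange's identity writes UW − X² as a sum of squares.
-/
theorem norm_reducedNorm_nonneg (q : ℍ[K,-1,-1]) : 0 ≤ (reducedNorm q).norm := by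
  have key : ∀ a b c d x y z w : ℚ,
      0 ≤ ((a ^ 2 + b ^ 2 + c ^ 2 + d ^ 2) + 2 * (x ^ 2 + y ^ 2 + z ^ 2 + w ^ 2)) ^ 2 -
        2 * (2 * (a * x + b * y + c * z + d * w)) ^ 2 := by
    intro a b c d x y z w
    have e : ((a ^ 2 + b ^ 2 + c ^ 2 + d ^ 2) + 2 * (x ^ 2 + y ^ 2 + z ^ 2 + w ^ 2)) ^ 2 -
        2 * (2 * (a * x + b * y + c * z + d * w)) ^ 2 =
        ((a ^ 2 + b ^ 2 + c ^ 2 + d ^ 2) - 2 * (x ^ 2 + y ^ 2 + z ^ 2 + w ^ 2)) ^ 2 +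
        8 * ((a * y - b * x) ^ 2 + (a * z - c * x) ^ 2 + (a * w - d * x) ^ 2 + (b * z - c * y) ^ 2 +
          (b * w - d * y) ^ 2 + (c * w - d * z) ^ 2) := by ring
    rw [e]; positivity
  rw [norm_eq, reducedNorm_re, reducedNorm_im]
  exact key _ _ _ _ _ _ _ _

theorem reducedNorm_eq_zero {q : ℍ[K,-1,-1]} : reducedNorm q = 0 ↔ q = 0 := by
  constructor
  · intro h
    have h1 := congrArg QuadraticAlgebra.re h
    rw [reducedNorm_re, QuadraticAlgebra.re_zero] at h1
    have hz : ∀ a b c d x y z w : ℚ, (a ^ 2 + b ^ 2 + c ^ 2 + d ^ 2) +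
        2 * (x ^ 2 + y ^ 2 + z ^ 2 + w ^ 2) = 0 → (a = 0 ∧ b = 0 ∧ c = 0 ∧ d = 0) ∧
          (x = 0 ∧ y = 0 ∧ z = 0 ∧ w = 0) := by
      intro a b c d x y z w h
      refine ⟨⟨?_, ?_, ?_, ?_⟩, ?_, ?_, ?_, ?_⟩ <;> rw [← sq_eq_zero_iff] <;>
        linarith [sq_nonneg a, sq_nonneg b, sq_nonneg c, sq_nonneg d, sq_nonneg x, sq_nonneg y,
          sq_nonneg z, sq_nonneg w]
    obtain ⟨⟨h1, h2, h3, h4⟩, h5, h6, h7, h8⟩ := hz _ _ _ _ _ _ _ _ h1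
    ext <;> assumption
  · rintro rfl
    simp [reducedNorm_eq]

theorem totPos_reducedNorm {q : ℍ[K,-1,-1]} (hq : q ≠ 0) : TotPos (reducedNorm q) := by
  have h0 : reducedNorm q ≠ 0 := by rwa [Ne, reducedNorm_eq_zero]
  have hn : 0 < (reducedNorm q).norm := by
    refine lt_of_le_of_ne (norm_reducedNorm_nonneg q) (Ne.symm ?_)
    rwa [Ne, QuadraticAlgebra.norm_eq_zero_iff_eq_zero]
  refine ⟨lt_of_le_of_ne (by rw [reducedNorm_re]; positivity) fun h => ?_, hn⟩
  rw [norm_eq, ← h] at hn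
  nlinarith [sq_nonneg (reducedNorm q).im]

theorem mul_star_self_eq (q : ℍ[K,-1,-1]) : q * star q = reducedNorm q • 1 := by
  rw [← algebraMap_reducedNorm, Algebra.algebraMap_eq_smul_one]

theorem star_mul_self_eq (q : ℍ[K,-1,-1]) : star q * q = reducedNorm q • 1 := by
  have := mul_star_self_eq (star q)
  rwa [star_star, reducedNorm_star] at this

theorem mul_right_cancel_quaternion {x y z : ℍ[K,-1,-1]} (hz : z ≠ 0) (h : x * z = y * z) :
    x = y := by
  have h1 := congrArg (· * star z) h
  simp only [mul_assoc, mul_star_self_eq, mul_smul_comm, mul_one] at h1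
  exact smul_right_injective _ (by rwa [Ne, reducedNorm_eq_zero]) h1

/-! ### The cubian order in coordinates -/

theorem smul_eq_coe_smul (a : 𝓞 K) (x : ℍ[K,-1,-1]) : a • x = (a : K) • x :=
  (algebraMap_smul K a x).symm

theorem reducedNorm_smul (a : K) (q : ℍ[K,-1,-1]) :
    reducedNorm (a • q) = a ^ 2 * reducedNorm q := by
  simp only [reducedNorm_eq, QuaternionAlgebra.re_smul, QuaternionAlgebra.imI_smul,
    QuaternionAlgebra.imJ_smul, QuaternionAlgebra.imK_smul, smul_eq_mul]
  ring

theorem rt_ne_zero : rt ≠ 0 := by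
  intro h; have := congrArg QuadraticAlgebra.im h; simp [rt] at this

theorem one_div_rt_eq : 1 / rt = rt / 2 := by
  rw [div_eq_div_iff rt_ne_zero two_ne_zero, rt_mul_rt, one_mul]

theorem coe_rtInt : ((rtInt : 𝓞 K) : K) = rt := rfl

theorem cubian_sum (c : Fin 4 → 𝓞 K) : ∑ i, c i • cubianBasis i =
    ⟨c 0 + (c 1 + c 2) * (rt / 2) + c 3 / 2, c 1 * (rt / 2) + c 3 / 2,
      c 2 * (rt / 2) + c 3 / 2, c 3 / 2⟩ := by
  simp only [Fin.sum_univ_four, smul_eq_coe_smul, cubianBasis, one_div_rt_eq]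
  ext1 <;> simp [Algebra.smul_def, NumberField.RingOfIntegers.coe_eq_algebraMap] <;> ring

theorem g_sum (c : Fin 4 → 𝓞 K) : ∑ i, c i • gBasis i =
    ⟨c 0 + c 3 * ((1 + rt) / 2), 2 * c 1 + c 2 * (rt / 2) + c 3 * ((rt - 1) / 2),
      c 2 * (rt / 2) + c 3 / 2, c 3 / 2⟩ := by
  simp only [Fin.sum_univ_four, smul_eq_coe_smul, gBasis, one_div_rt_eq]
  ext1 <;> simp [Algebra.smul_def, NumberField.RingOfIntegers.coe_eq_algebraMap] <;> ring

theorem map_form0 {S T : Type*} [CommRing S] [CommRing T] (f : S →+* T) (t : S) (v : Fin 4 → S) :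
    f (form0 t v) = form0 (f t) (f ∘ v) := by
  simp [form0]

theorem map_form3 {S T : Type*} [CommRing S] [CommRing T] (f : S →+* T) (t : S) (v : Fin 4 → S) :
    f (form3 t v) = form3 (f t) (f ∘ v) := by
  simp [form3, map_ofNat]

theorem reducedNorm_cubian_sum (c : Fin 4 → 𝓞 K) :
    reducedNorm (∑ i, c i • cubianBasis i) = (form0 rtInt c : 𝓞 K) := by
  have hr : rt ^ 2 = 2 := by rw [sq, rt_mul_rt]
  rw [cubian_sum, reducedNorm_eq, NumberField.RingOfIntegers.coe_eq_algebraMap (form0 _ _),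
    map_form0 (algebraMap (𝓞 K) K)]
  simp only [form0, Function.comp, ← NumberField.RingOfIntegers.coe_eq_algebraMap, coe_rtInt]
  generalize (c 0 : K) = x, (c 1 : K) = y, (c 2 : K) = z, (c 3 : K) = w
  field_simp
  linear_combination ((y + z) ^ 2 + y ^ 2 + z ^ 2) * hr

theorem reducedNorm_g_sum (c : Fin 4 → 𝓞 K) :
    reducedNorm (∑ i, c i • gBasis i) = (form3 rtInt c : 𝓞 K) := by
  have hr : rt ^ 2 = 2 := by rw [sq, rt_mul_rt]
  rw [g_sum, reducedNorm_eq, NumberField.RingOfIntegers.coe_eq_algebraMap (form3 _ _),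
    map_form3 (algebraMap (𝓞 K) K)]
  simp only [form3, Function.comp, ← NumberField.RingOfIntegers.coe_eq_algebraMap, coe_rtInt]
  generalize (c 0 : K) = x, (c 1 : K) = y, (c 2 : K) = z, (c 3 : K) = w
  field_simp
  linear_combination (2 * z ^ 2 + 2 * w ^ 2 + 2 * z * w) * hr

theorem cubianBasis_linearIndependent : LinearIndependent (𝓞 K) cubianBasis := by
  rw [Fintype.linearIndependent_iff]
  intro c hc
  rw [cubian_sum] at hc
  have h0 := congrArg QuaternionAlgebra.re hc
  have h1 := congrArg QuaternionAlgebra.imI hc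
  have h2 := congrArg QuaternionAlgebra.imJ hc
  have h3 := congrArg QuaternionAlgebra.imK hc
  simp at h0 h1 h2 h3
  simp [h3, rt_ne_zero] at h0 h1 h2
  simp [h2, h1] at h0
  intro i
  fin_cases i <;> assumption

theorem encard_span_reducedNorm {v : Fin 4 → ℍ[K,-1,-1]} (hv : LinearIndependent (𝓞 K) v)
    {Q : (Fin 4 → 𝓞 K) → 𝓞 K} (hQ : ∀ c, reducedNorm (∑ i, c i • v i) = (Q c : 𝓞 K)) (α : 𝓞 K) :
    Set.encard {q | q ∈ Submodule.span (𝓞 K) (Set.range v) ∧ reducedNorm q = (α : K)} =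
      {c | Q c = α}.encard := by
  have hinj : Function.Injective fun c : Fin 4 → 𝓞 K => ∑ i, c i • v i := by
    intro c d h
    have := Fintype.linearIndependent_iff.1 hv (c - d) (by
      simp only [Pi.sub_apply, sub_smul, Finset.sum_sub_distrib]
      exact sub_eq_zero.2 h)
    funext i
    exact sub_eq_zero.1 (this i)
  rw [← hinj.injOn.encard_image]
  congr 1
  ext q
  simp only [Set.mem_ofPred_eq, Set.mem_image, Submodule.mem_span_range_iff_exists_fun]
  constructor
  · rintro ⟨⟨c, rfl⟩, h⟩
    rw [hQ] at h
    exact ⟨c, NumberField.RingOfIntegers.ext h, rfl⟩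
  · rintro ⟨c, hc, rfl⟩
    exact ⟨⟨c, rfl⟩, by rw [hQ, hc]⟩

theorem repCount_gOrder (α : 𝓞 K) : repCount gOrder α = {c | form3 rtInt c = α}.encard :=
  encard_span_reducedNorm gBasis_linearIndependent reducedNorm_g_sum α

theorem repCount_cubianOrder (α : 𝓞 K) :
    repCount cubianOrder α = {c | form0 rtInt c = α}.encard :=
  encard_span_reducedNorm cubianBasis_linearIndependent reducedNorm_cubian_sum α

theorem mem_cubianOrder_iff_sum {q : ℍ[K,-1,-1]} :
    q ∈ cubianOrder ↔ ∃ c : Fin 4 → 𝓞 K, ∑ i, c i • cubianBasis i = q :=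
  Submodule.mem_span_range_iff_exists_fun (𝓞 K)

theorem exists_reducedNorm_eq {q : ℍ[K,-1,-1]} (hq : q ∈ cubianOrder) :
    ∃ n : 𝓞 K, reducedNorm q = n := by
  obtain ⟨c, rfl⟩ := mem_cubianOrder_iff_sum.1 hq
  exact ⟨_, reducedNorm_cubian_sum c⟩

/-- The quaternion with coordinates `(p i + r i * √2) / 2`. -/
def halfQuaternion (p r : Fin 4 → ℤ) : ℍ[K,-1,-1] :=
  ⟨⟨p 0 / 2, r 0 / 2⟩, ⟨p 1 / 2, r 1 / 2⟩, ⟨p 2 / 2, r 2 / 2⟩, ⟨p 3 / 2, r 3 / 2⟩⟩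

/-- The congruences that describe the cubian order in half-integral coordinates. -/
def CubianCongruence (p r : Fin 4 → ℤ) : Prop :=
  (2 ∣ p 0 - p 3 ∧ 2 ∣ p 1 - p 3 ∧ 2 ∣ p 2 - p 3) ∧ 2 ∣ r 0 + r 1 + r 2 + r 3

theorem halfQuaternion_mem {p r : Fin 4 → ℤ} (h : CubianCongruence p r) :
    halfQuaternion p r ∈ cubianOrder := by
  obtain ⟨⟨⟨a, ha⟩, ⟨b, hb⟩, ⟨c, hc⟩⟩, ⟨d, hd⟩⟩ := h
  apply mem_span_of_coords _ _
    ![(a - b - c, d - r 1 - r 2), (r 1 - r 3, b), (r 2 - r 3, c), (p 3, r 3)]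
  have e0 : (p 0 : ℚ) = 2 * a + p 3 := by exact_mod_cast (by omega : p 0 = 2 * a + p 3)
  have e1 : (p 1 : ℚ) = 2 * b + p 3 := by exact_mod_cast (by omega : p 1 = 2 * b + p 3)
  have e2 : (p 2 : ℚ) = 2 * c + p 3 := by exact_mod_cast (by omega : p 2 = 2 * c + p 3)
  have e3 : (r 0 : ℚ) = 2 * d - r 1 - r 2 - r 3 := by
    exact_mod_cast (by omega : r 0 = 2 * d - r 1 - r 2 - r 3)
  rw [cubianBasis_eq, Fin.sum_univ_four]
  simp only [halfQuaternion, e0, e1, e2, e3]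
  ext <;> simp <;> ring

theorem exists_halfQuaternion {q : ℍ[K,-1,-1]} (hq : q ∈ cubianOrder) :
    ∃ p r, CubianCongruence p r ∧ q = halfQuaternion p r := by
  obtain ⟨c, rfl⟩ := mem_cubianOrder_iff_sum.1 hq
  choose a b hab using fun i => exists_ofPair (c i)
  refine ⟨![2 * a 0 + 2 * (b 1 + b 2) + a 3, 2 * b 1 + a 3, 2 * b 2 + a 3, a 3],
    ![2 * b 0 + (a 1 + a 2) + b 3, a 1 + b 3, a 2 + b 3, b 3], ?_, ?_⟩
  · simp [CubianCongruence]
    omega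
  · have hc : ∀ i, (c i : K) = ⟨a i, b i⟩ := fun i => by rw [hab, coe_ofPair]
    simp only [smul_eq_coe_smul, hc, cubianBasis_eq, Fin.sum_univ_four, halfQuaternion]
    ext <;> simp <;> ring

theorem star_mem_cubianOrder {q : ℍ[K,-1,-1]} (hq : q ∈ cubianOrder) :
    star q ∈ cubianOrder := by
  obtain ⟨p, r, ⟨⟨h1, h2, h3⟩, h4⟩, rfl⟩ := exists_halfQuaternion hq
  have e : star (halfQuaternion p r) =
      halfQuaternion ![p 0, -p 1, -p 2, -p 3] ![r 0, -r 1, -r 2, -r 3] := by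
    ext <;> simp [halfQuaternion] <;> ring
  rw [e]
  apply halfQuaternion_mem
  simp [CubianCongruence]
  omega

/-! ### The cubian order is norm-Euclidean -/

theorem exists_round (g : ℚ) : ∃ n s : ℤ, ∃ a : ℚ, (s = 1 ∨ s = -1) ∧ g = n + s * a ∧
    0 ≤ a ∧ a ≤ 1 / 2 := by
  have h := abs_sub_round g
  rcases le_total 0 (g - round g) with h0 | h0
  · exact ⟨round g, 1, g - round g, Or.inl rfl, by push_cast; ring, h0,
    by rwa [abs_of_nonneg h0] at h⟩
  · exact ⟨round g, -1, -(g - round g), Or.inr rfl, by push_cast; ring, by linarith,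
      by rwa [abs_of_nonpos h0] at h⟩

/-- Adding the distance bounds from 0 and from (1/2, 1/2, 1/2, 1/2) gives Σ(aᵢ² − aᵢ/2) ≥ 0, while
every summand is nonpositive. So each aᵢ is 0 or 1/2 and their sum is 1, which is a deep hole of the
Hurwitz lattice. Its nearest lattice points then determine `w`. -/
theorem eq_zero_of_deep_hole {a w : Fin 4 → ℚ} (ha0 : ∀ i, 0 ≤ a i) (ha1 : ∀ i, a i ≤ 1 / 2)
    (key : ∀ k : Fin 4 → ℤ, (∀ i j, 2 ∣ k i - k j) → 1 / 2 ≤ ∑ i, (a i - k i / 2) ^ 2 ∧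
      (∑ i, (a i - k i / 2) ^ 2 = 1 / 2 → ∑ i, (a i - k i / 2) * w i = 0)) : w = 0 := by
  have k0 := key ![0, 0, 0, 0] (by decide)
  have k1 := key ![1, 1, 1, 1] (by decide)
  have f0 := key ![2, 0, 0, 0] (by decide)
  have f1 := key ![0, 2, 0, 0] (by decide)
  have f2 := key ![0, 0, 2, 0] (by decide)
  have f3 := key ![0, 0, 0, 2] (by decide)
  have g0 := key ![-1, 1, 1, 1] (by decide)
  have g1 := key ![1, -1, 1, 1] (by decide)
  have g2 := key ![1, 1, -1, 1] (by decide)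
  have g3 := key ![1, 1, 1, -1] (by decide)
  clear key
  simp only [Fin.sum_univ_four, Matrix.cons_val] at k0 k1 f0 f1 f2 f3 g0 g1 g2 g3
  push_cast at k0 k1 f0 f1 f2 f3 g0 g1 g2 g3
  have hq : ∀ i, a i ^ 2 ≤ a i / 2 := by
    intro i; nlinarith [ha0 i, ha1 i]
  have c0 := hq 0
  have c1 := hq 1
  have c2 := hq 2
  have c3 := hq 3
  have cases : ∀ x : ℚ, x ^ 2 = x / 2 → x = 0 ∨ x = 1 / 2 := by
    intro x h
    have : x * (x - 1 / 2) = 0 := by linarith [sq x]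
    rcases mul_eq_zero.1 this with h | h
    · exact Or.inl h
    · exact Or.inr (by linarith)
  have b0 : a 0 ^ 2 = a 0 / 2 := by linarith only [k0.1, k1.1, c0, c1, c2, c3]
  have b1 : a 1 ^ 2 = a 1 / 2 := by linarith only [k0.1, k1.1, c0, c1, c2, c3]
  have b2 : a 2 ^ 2 = a 2 / 2 := by linarith only [k0.1, k1.1, c0, c1, c2, c3]
  have b3 : a 3 ^ 2 = a 3 / 2 := by linarith only [k0.1, k1.1, c0, c1, c2, c3]
  have hsum : a 0 + a 1 + a 2 + a 3 = 1 := by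
    linarith only [k0.1, k1.1, b0, b1, b2, b3]
  have z0 := k0.2 (by linarith only [hsum, b0, b1, b2, b3])
  have z1 := k1.2 (by linarith only [hsum, b0, b1, b2, b3])
  -- Moving one coordinate of a nearest lattice point by 1, in the direction allowed by the value of
  -- that coordinate of `a`, gives another nearest point. The difference of the two orthogonality
  -- relations isolates a single coordinate of `w`.
  have w0 : w 0 = 0 := by
    rcases cases (a 0) b0 with h | h
    · linear_combination g0.2 (by linear_combination b0 + b1 + b2 + b3 - hsum / 2 + 2 * h) - z1
    · linear_combination z0 - f0.2 (by linear_combination b0 + b1 + b2 + b3 + hsum / 2 - 2 * h)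
  have w1 : w 1 = 0 := by
    rcases cases (a 1) b1 with h | h
    · linear_combination g1.2 (by linear_combination b0 + b1 + b2 + b3 - hsum / 2 + 2 * h) - z1
    · linear_combination z0 - f1.2 (by linear_combination b0 + b1 + b2 + b3 + hsum / 2 - 2 * h)
  have w2 : w 2 = 0 := by
    rcases cases (a 2) b2 with h | h
    · linear_combination g2.2 (by linear_combination b0 + b1 + b2 + b3 - hsum / 2 + 2 * h) - z1
    · linear_combination z0 - f2.2 (by linear_combination b0 + b1 + b2 + b3 + hsum / 2 - 2 * h)
  have w3 : w 3 = 0 := by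
    rcases cases (a 3) b3 with h | h
    · linear_combination g3.2 (by linear_combination b0 + b1 + b2 + b3 - hsum / 2 + 2 * h) - z1
    · linear_combination z0 - f3.2 (by linear_combination b0 + b1 + b2 + b3 + hsum / 2 - 2 * h)
  funext i
  fin_cases i
  exacts [w0, w1, w2, w3]

/-- Rounding to the Hurwitz lattice: the covering radius is `1 / √2`, and at a deep hole the
closest lattice points are in enough directions not to be all orthogonal to a given vector. -/
theorem exists_hurwitz_round (g : Fin 4 → ℚ) {v : Fin 4 → ℚ} (hne : v ≠ 0) :
    ∃ p : Fin 4 → ℤ, (∀ i j, 2 ∣ p i - p j) ∧ (∑ i, (g i - p i / 2) ^ 2 < 1 / 2 ∨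
      (∑ i, (g i - p i / 2) ^ 2 = 1 / 2 ∧ ∑ i, (g i - p i / 2) * v i ≠ 0)) := by
  by_contra! H
  -- Integral translations and sign changes preserve the Hurwitz lattice, so the point may be moved
  -- into the cube [0, 1/2]⁴.
  choose n s a hs hg ha0 ha1 using fun i => exists_round (g i)
  have hs2 : ∀ i, (s i : ℚ) ^ 2 = 1 := by
    intro i
    rcases hs i with h | h <;> rw [h] <;> norm_num
  have key : ∀ k : Fin 4 → ℤ, (∀ i j, 2 ∣ k i - k j) → 1 / 2 ≤ ∑ i, (a i - k i / 2) ^ 2 ∧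
      (∑ i, (a i - k i / 2) ^ 2 = 1 / 2 → ∑ i, (a i - k i / 2) * (s i * v i) = 0) := by
    intro k hk
    have h := H (fun i => 2 * n i + k i * s i) (by
      intro i j
      obtain ⟨c, hc⟩ := hk i j
      have hp : ∃ d, s i - s j = 2 * d := by
        rcases hs i with h | h <;> rcases hs j with h' | h' <;> rw [h, h']
        exacts [⟨0, rfl⟩, ⟨1, rfl⟩, ⟨-1, rfl⟩, ⟨0, rfl⟩]
      obtain ⟨d, hd⟩ := hp
      exact ⟨n i - n j + c * s i + k j * d, by linear_combination s i * hc + k j * hd⟩)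
    have e : ∀ i, g i - ((2 * n i + k i * s i : ℤ) : ℚ) / 2 = s i * (a i - k i / 2) := by
      intro i; rw [hg i]; push_cast; ring
    have e1 : ∀ i, (g i - ((2 * n i + k i * s i : ℤ) : ℚ) / 2) ^ 2 = (a i - k i / 2) ^ 2 := by
      intro i; rw [e, mul_pow, hs2, one_mul]
    have e2 : ∀ i, (g i - ((2 * n i + k i * s i : ℤ) : ℚ) / 2) * v i =
      (a i - k i / 2) * (s i * v i) := by
      intro i; rw [e]; ring
    simp only [e1, e2] at h
    exact h
  have hw : (fun i => (s i : ℚ) * v i) = 0 :=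
    eq_zero_of_deep_hole ha0 ha1 key
  apply hne
  funext i
  have hi := congrFun hw i
  refine (mul_eq_zero.1 hi).resolve_left fun h => ?_
  have := hs2 i
  rw [h] at this
  norm_num at this

/-- Rounding to the lattice of integral vectors with even coordinate sum. -/
theorem exists_even_round (y : Fin 4 → ℚ) : ∃ r : Fin 4 → ℤ,
    2 ∣ r 0 + r 1 + r 2 + r 3 ∧ ∑ i, (y i - r i) ^ 2 ≤ 1 := by
  -- The map (y₀, y₁) ↦ ((y₀ + y₁)/2, (y₁ − y₀)/2) in each coordinate plane is a rotation scaled by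
  -- 1/√2. It carries the even-sum lattice to the Hurwitz lattice and halves square distances.
  obtain ⟨p, hp, h⟩ := exists_hurwitz_round
    ![(y 0 + y 1) / 2, (y 1 - y 0) / 2, (y 2 + y 3) / 2, (y 3 - y 2) / 2] (v := 1) one_ne_zero
  obtain ⟨⟨a, ha⟩, ⟨b, hb⟩, ⟨c, hc⟩⟩ := And.intro (hp 0 3) (And.intro (hp 1 3) (hp 2 3))
  refine ⟨![a - b, a + b + p 3, c, c + p 3], ?_, ?_⟩
  · simp only [Matrix.cons_val]
    exact ⟨a + c + p 3, by ring⟩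
  · have e0 : (p 0 : ℚ) = 2 * a + p 3 := by exact_mod_cast (by omega : p 0 = 2 * a + p 3)
    have e1 : (p 1 : ℚ) = 2 * b + p 3 := by exact_mod_cast (by omega : p 1 = 2 * b + p 3)
    have e2 : (p 2 : ℚ) = 2 * c + p 3 := by exact_mod_cast (by omega : p 2 = 2 * c + p 3)
    have h' := h.elim le_of_lt fun h => h.1.le
    simp only [Fin.sum_univ_four, Matrix.cons_val, e0, e1, e2] at h' ⊢
    push_cast
    linarith

/-- In half-integral coordinates the rational and √2 parts can be rounded independently, the first
to the Hurwitz lattice (U ≤ 1/2), the second to half the even-sum lattice (W ≤ 1/4). The norm (U +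
2W)² − 8X² of the remainder is then at most 1. Equality would need U = 1/2, W = 1/4 and X = 0; when
U = 1/2 is reached, the rational part is rounded so that X ≠ 0, unless the √2 part vanishes and W =
0. -/
theorem exists_norm_reducedNorm_sub_lt_one (z : ℍ[K,-1,-1]) :
    ∃ y ∈ cubianOrder, (reducedNorm (z - y)).norm < 1 := by
  obtain ⟨r, hr, hr1⟩ := exists_even_round
    ![2 * z.re.im, 2 * z.imI.im, 2 * z.imJ.im, 2 * z.imK.im]
  set v : Fin 4 → ℚ :=
    ![z.re.im - r 0 / 2, z.imI.im - r 1 / 2, z.imJ.im - r 2 / 2, z.imK.im - r 3 / 2] with hv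
  have hp : ∃ p : Fin 4 → ℤ, (∀ i j, 2 ∣ p i - p j) ∧
      (∑ i, (![z.re.re, z.imI.re, z.imJ.re, z.imK.re] i - p i / 2) ^ 2 < 1 / 2 ∨
        (∑ i, (![z.re.re, z.imI.re, z.imJ.re, z.imK.re] i - p i / 2) ^ 2 ≤ 1 / 2 ∧
          (v = 0 ∨ ∑ i, (![z.re.re, z.imI.re, z.imJ.re, z.imK.re] i - p i / 2) * v i ≠ 0))) := by
    by_cases h0 : v = 0
    · obtain ⟨p, hp, h⟩ := exists_hurwitz_round ![z.re.re, z.imI.re, z.imJ.re, z.imK.re]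
        (v := 1) one_ne_zero
      exact ⟨p, hp, h.imp id fun h => ⟨h.1.le, Or.inl h0⟩⟩
    · obtain ⟨p, hp, h⟩ := exists_hurwitz_round ![z.re.re, z.imI.re, z.imJ.re, z.imK.re] h0
      exact ⟨p, hp, h.imp id fun h => ⟨h.1.le, Or.inr h.2⟩⟩
  obtain ⟨p, hp, hp1⟩ := hp
  refine ⟨halfQuaternion p r, halfQuaternion_mem ⟨⟨hp 0 3, hp 1 3, hp 2 3⟩, hr⟩, ?_⟩
  rw [norm_eq, reducedNorm_re, reducedNorm_im]
  simp only [halfQuaternion, QuaternionAlgebra.re_sub, QuaternionAlgebra.imI_sub,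
    QuaternionAlgebra.imJ_sub, QuaternionAlgebra.imK_sub, QuadraticAlgebra.re_sub,
    QuadraticAlgebra.im_sub]
  have hv0 : v = 0 → (z.re.im - r 0 / 2 = 0 ∧ z.imI.im - r 1 / 2 = 0) ∧
      z.imJ.im - r 2 / 2 = 0 ∧ z.imK.im - r 3 / 2 = 0 := fun h =>
    ⟨⟨congrFun h 0, congrFun h 1⟩, congrFun h 2, congrFun h 3⟩
  simp only [Fin.sum_univ_four, hv, Matrix.cons_val] at hr1 hp1 hv0
  have hW : (z.re.im - r 0 / 2) ^ 2 + (z.imI.im - r 1 / 2) ^ 2 + (z.imJ.im - r 2 / 2) ^ 2 +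
      (z.imK.im - r 3 / 2) ^ 2 ≤ 1 / 4 := by linarith
  have hU0 : 0 ≤ (z.re.re - p 0 / 2) ^ 2 + (z.imI.re - p 1 / 2) ^ 2 + (z.imJ.re - p 2 / 2) ^ 2 +
    (z.imK.re - p 3 / 2) ^ 2 := by positivity
  have hW0 : 0 ≤ (z.re.im - r 0 / 2) ^ 2 + (z.imI.im - r 1 / 2) ^ 2 + (z.imJ.im - r 2 / 2) ^ 2 +
      (z.imK.im - r 3 / 2) ^ 2 := by positivity
  have hlt : ∀ U W X : ℚ, 0 ≤ U → 0 ≤ W → W ≤ 1 / 4 → U < 1 / 2 ∨ (U ≤ 1 / 2 ∧ (W = 0 ∨ X ≠ 0)) →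
      (U + 2 * W) ^ 2 - 2 * (2 * X) ^ 2 < 1 := by
    intro U W X h1 h2 h3 h4
    rcases h4 with h | ⟨h, rfl | h0⟩
    · nlinarith [sq_nonneg X]
    · nlinarith [sq_nonneg X]
    · nlinarith [sq_pos_of_ne_zero h0]
  refine hlt _ _ _ hU0 hW0 hW (hp1.imp id fun h => ⟨h.1, h.2.imp (fun h => ?_) id⟩)
  obtain ⟨⟨z0, z1⟩, z2, z3⟩ := hv0 h
  rw [z0, z1, z2, z3]
  norm_num

/-! ### Left ideals of the cubian order are principal -/

/-- The absolute norm of an element of the cubian order. -/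
noncomputable def absNormQuaternion (q : ℍ[K,-1,-1]) : ℕ := (reducedNorm q).norm.num.natAbs

theorem absNormQuaternion_cast {q : ℍ[K,-1,-1]} (hq : q ∈ cubianOrder) :
    (absNormQuaternion q : ℚ) = (reducedNorm q).norm := by
  obtain ⟨n, hn⟩ := exists_reducedNorm_eq hq
  have h := natNorm_cast n
  rw [← hn, abs_of_nonneg (norm_reducedNorm_nonneg q)] at h
  rw [← h, absNormQuaternion, natNorm, hn]

theorem inv_smul_star_mul (x y : ℍ[K,-1,-1]) (hx : x ≠ 0) :
    y * ((reducedNorm x)⁻¹ • star x) * x = y := by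
  have h0 : reducedNorm x ≠ 0 := by rwa [Ne, reducedNorm_eq_zero]
  rw [mul_assoc, smul_mul_assoc, star_mul_self_eq, smul_smul, inv_mul_cancel₀ h0, one_smul, mul_one]

/-- The Euclidean argument: a nonzero element of least absolute norm divides every element of the
left ideal on the right. -/
theorem exists_left_generator (I : AddSubgroup ℍ[K,-1,-1]) (hO : ∀ q ∈ I, q ∈ cubianOrder)
    (hI : ∀ y ∈ cubianOrder, ∀ q ∈ I, y * q ∈ I) (h0 : ∃ q ∈ I, q ≠ 0) :
    ∃ x ∈ I, x ≠ 0 ∧ ∀ q ∈ I, ∃ y ∈ cubianOrder, q = y * x := by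
  obtain ⟨x0, hx0, hx0'⟩ := h0
  have hne : {x | x ∈ I ∧ x ≠ 0}.Nonempty := ⟨x0, hx0, hx0'⟩
  obtain ⟨x, ⟨hx, hx'⟩, hmin⟩ :=
    (InvImage.wf absNormQuaternion Nat.lt_wfRel.wf).has_min _ hne
  refine ⟨x, hx, hx', fun q hq => ?_⟩
  obtain ⟨y, hy, hlt⟩ :=
    exists_norm_reducedNorm_sub_lt_one (q * ((reducedNorm x)⁻¹ • star x))
  refine ⟨y, hy, ?_⟩
  have e : q - y * x = (q * ((reducedNorm x)⁻¹ • star x) - y) * x := by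
    rw [sub_mul, inv_smul_star_mul _ _ hx']
  have hmem : q - y * x ∈ I := I.sub_mem hq (hI y hy x hx)
  have hlt' : absNormQuaternion (q - y * x) < absNormQuaternion x := by
    rw [← Nat.cast_lt (α := ℚ), absNormQuaternion_cast (hO _ hmem),
      absNormQuaternion_cast (hO _ hx), e, reducedNorm_mul, map_mul]
    have := (totPos_reducedNorm hx').2
    nlinarith
  by_contra hne
  exact hmin _ ⟨hmem, fun h => hne (sub_eq_zero.1 h)⟩ hlt'

/-! ### Reduction of quaternions modulo an odd prime -/

/-- Extension of scalars from the Lipschitz order. -/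
def ofLipschitz : ℍ[𝓞 K,-1,-1] →+* ℍ[K,-1,-1] where
  toFun b := ⟨b.re, b.imI, b.imJ, b.imK⟩
  map_one' := by ext <;> simp
  map_zero' := by ext <;> simp
  map_add' a b := by ext1 <;> simp
  map_mul' a b := by ext1 <;> simp

theorem ofLipschitz_injective : Function.Injective ofLipschitz := by
  intro a b h
  have h0 := congrArg QuaternionAlgebra.re h
  have h1 := congrArg QuaternionAlgebra.imI h
  have h2 := congrArg QuaternionAlgebra.imJ h
  have h3 := congrArg QuaternionAlgebra.imK h
  ext1
  exacts [NumberField.RingOfIntegers.ext h0, NumberField.RingOfIntegers.ext h1,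
    NumberField.RingOfIntegers.ext h2, NumberField.RingOfIntegers.ext h3]

theorem ofLipschitz_smul (a : 𝓞 K) (b : ℍ[𝓞 K,-1,-1]) :
    ofLipschitz (a • b) = (a : K) • ofLipschitz b := by
  ext1 <;> simp [ofLipschitz] <;> exact (Algebra.smul_def _ _).symm

theorem coe_smul_mem {q : ℍ[K,-1,-1]} (a : 𝓞 K) (hq : q ∈ cubianOrder) :
    (a : K) • q ∈ cubianOrder := by
  rw [← smul_eq_coe_smul]
  exact cubianOrder.smul_mem hq a

theorem ofLipschitz_mem (b : ℍ[𝓞 K,-1,-1]) : ofLipschitz b ∈ cubianOrder := by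
  choose f g h using exists_ofPair
  have e : ofLipschitz b = halfQuaternion ![2 * f b.re, 2 * f b.imI, 2 * f b.imJ, 2 * f b.imK]
      ![2 * g b.re, 2 * g b.imI, 2 * g b.imJ, 2 * g b.imK] := by
    have hc : ∀ x : 𝓞 K, (x : K) = ⟨f x, g x⟩ := fun x => by
      conv_lhs => rw [h x]
      rw [coe_ofPair]
    simp only [ofLipschitz, RingHom.coe_mk, MonoidHom.coe_mk, OneHom.coe_mk, hc]
    ext <;> simp [halfQuaternion]
  rw [e]
  apply halfQuaternion_mem
  simp [CubianCongruence]
  omega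

/-- Modulo an odd prime 2 is invertible, so reducing 2q instead of q loses nothing and avoids the
denominators of the cubian basis. -/
theorem exists_ofLipschitz_eq_two_mul {q : ℍ[K,-1,-1]} (hq : q ∈ cubianOrder) :
    ∃ b, ofLipschitz b = 2 * q := by
  obtain ⟨p, r, -, rfl⟩ := exists_halfQuaternion hq
  refine ⟨⟨ofPair (p 0, r 0), ofPair (p 1, r 1), ofPair (p 2, r 2), ofPair (p 3, r 3)⟩, ?_⟩
  rw [two_mul]
  simp only [ofLipschitz, RingHom.coe_mk, MonoidHom.coe_mk, OneHom.coe_mk, coe_ofPair]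
  ext <;> simp [halfQuaternion]

section Reduction

variable {F : Type*} [Field F] (f : 𝓞 K →+* F) {x y : F}

/-- The splitting of the quaternion algebra over a field in which `x ^ 2 + y ^ 2 = -1`. -/
def splitting (hxy : x ^ 2 + y ^ 2 = -1) : ℍ[𝓞 K,-1,-1] →+* Matrix (Fin 2) (Fin 2) F where
  toFun b := !![f b.re + f b.imJ * x - f b.imK * y, -f b.imI + f b.imJ * y + f b.imK * x;
    f b.imI + f b.imJ * y + f b.imK * x, f b.re - f b.imJ * x + f b.imK * y]
  map_one' := by ext i j; fin_cases i <;> fin_cases j <;> simp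
  map_zero' := by ext i j; fin_cases i <;> fin_cases j <;> simp
  map_add' a b := by ext i j; fin_cases i <;> fin_cases j <;> simp <;> ring
  map_mul' a b := by
    ext i j
    fin_cases i <;> fin_cases j <;> simp [Matrix.mul_apply, Fin.sum_univ_two]
    · linear_combination (-(f a.imJ * f b.imJ) - f a.imK * f b.imK) * hxy
    · linear_combination (f a.imK * f b.imJ - f a.imJ * f b.imK) * hxy
    · linear_combination (f a.imJ * f b.imK - f a.imK * f b.imJ) * hxy
    · linear_combination (-(f a.imJ * f b.imJ) - f a.imK * f b.imK) * hxy

variable (hxy : x ^ 2 + y ^ 2 = -1)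

theorem det_splitting (b : ℍ[𝓞 K,-1,-1]) : (splitting f hxy b).det =
    f (b.re ^ 2 + b.imI ^ 2 + b.imJ ^ 2 + b.imK ^ 2) := by
  simp [splitting, Matrix.det_fin_two]
  linear_combination (-(f b.imJ) ^ 2 - (f b.imK) ^ 2) * hxy

theorem splitting_smul (a : 𝓞 K) (b : ℍ[𝓞 K,-1,-1]) :
    splitting f hxy (a • b) = f a • splitting f hxy b := by
  ext i j
  fin_cases i <;> fin_cases j <;> simp [splitting] <;> ring

theorem splitting_eq_zero_iff (h2 : (2 : F) ≠ 0) {b : ℍ[𝓞 K,-1,-1]} :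
    splitting f hxy b = 0 ↔ f b.re = 0 ∧ f b.imI = 0 ∧ f b.imJ = 0 ∧ f b.imK = 0 := by
  constructor
  · intro h
    have h00 := congrFun (congrFun h 0) 0
    have h01 := congrFun (congrFun h 0) 1
    have h10 := congrFun (congrFun h 1) 0
    have h11 := congrFun (congrFun h 1) 1
    simp [splitting] at h00 h01 h10 h11
    have h4 : (4 : F) ≠ 0 := by
      have : (4 : F) = 2 * 2 := by norm_num
      rw [this]; exact mul_ne_zero h2 h2
    refine ⟨?_, ?_, ?_, ?_⟩ <;> apply mul_left_cancel₀ h2 <;> rw [mul_zero]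
    · linear_combination h00 + h11
    · linear_combination h10 - h01
    · linear_combination -x * (h00 - h11) - y * (h01 + h10) + 2 * f b.imJ * hxy
    · linear_combination y * (h00 - h11) - x * (h01 + h10) + 2 * f b.imK * hxy
  · rintro ⟨h0, h1, h2, h3⟩
    ext i j
    fin_cases i <;> fin_cases j <;> simp [splitting, h0, h1, h2, h3]

theorem splitting_surjective (h2 : (2 : F) ≠ 0) (hf : Function.Surjective f) :
    Function.Surjective (splitting f hxy) := by
  intro A
  obtain ⟨a, ha⟩ := hf ((A 0 0 + A 1 1) / 2)
  obtain ⟨b, hb⟩ := hf ((A 1 0 - A 0 1) / 2)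
  obtain ⟨c, hc⟩ := hf ((-x * (A 0 0 - A 1 1) - y * (A 0 1 + A 1 0)) / 2)
  obtain ⟨d, hd⟩ := hf ((y * (A 0 0 - A 1 1) - x * (A 0 1 + A 1 0)) / 2)
  refine ⟨⟨a, b, c, d⟩, ?_⟩
  ext i j
  fin_cases i <;> fin_cases j <;> simp [splitting, ha, hb, hc, hd] <;> field_simp
  · linear_combination (A 1 1 - A 0 0) * hxy
  · linear_combination -(A 0 1 + A 1 0) * hxy
  · linear_combination -(A 0 1 + A 1 0) * hxy
  · linear_combination (A 0 0 - A 1 1) * hxy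

/-- The reduction of `q` annihilates the vector `v`. -/
def Annihilates (v : Fin 2 → F) (q : ℍ[K,-1,-1]) : Prop :=
  ∃ b, ofLipschitz b = 2 * q ∧ (splitting f hxy b).mulVec v = 0

variable {f hxy}

theorem annihilates_iff {v : Fin 2 → F} {q : ℍ[K,-1,-1]} {b : ℍ[𝓞 K,-1,-1]}
    (hb : ofLipschitz b = 2 * q) :
    Annihilates f hxy v q ↔ (splitting f hxy b).mulVec v = 0 := by
  constructor
  · rintro ⟨b', hb', h⟩
    rwa [ofLipschitz_injective (hb.trans hb'.symm)]
  · exact fun h => ⟨b, hb, h⟩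

theorem Annihilates.add {v : Fin 2 → F} {q q' : ℍ[K,-1,-1]} (h : Annihilates f hxy v q)
    (h' : Annihilates f hxy v q') : Annihilates f hxy v (q + q') := by
  obtain ⟨b, hb, h⟩ := h
  obtain ⟨b', hb', h'⟩ := h'
  exact ⟨b + b', by rw [map_add, hb, hb', mul_add],
    by rw [map_add, Matrix.add_mulVec, h, h', add_zero]⟩

theorem Annihilates.neg {v : Fin 2 → F} {q : ℍ[K,-1,-1]} (h : Annihilates f hxy v q) :
    Annihilates f hxy v (-q) := by
  obtain ⟨b, hb, h⟩ := h
  exact ⟨-b, by rw [map_neg, hb, mul_neg], by rw [map_neg, Matrix.neg_mulVec, h, neg_zero]⟩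

theorem annihilates_zero (v : Fin 2 → F) : Annihilates f hxy v 0 :=
  ⟨0, by simp, by simp⟩

theorem Annihilates.mul_left (h2 : (2 : F) ≠ 0) {v : Fin 2 → F} {p q : ℍ[K,-1,-1]}
    (hp : p ∈ cubianOrder) (hq : q ∈ cubianOrder) (h : Annihilates f hxy v q) :
    Annihilates f hxy v (p * q) := by
  obtain ⟨a, ha⟩ := exists_ofLipschitz_eq_two_mul hp
  obtain ⟨c, hc⟩ := exists_ofLipschitz_eq_two_mul (cubianOrder.mul_mem hp hq)
  obtain ⟨b, hb, h⟩ := h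
  refine ⟨c, hc, ?_⟩
  -- Doubling is not multiplicative: 2·(2pq) = (2p)(2q), so one factor 2 must be cancelled in `F`.
  have e : (2 : 𝓞 K) • c = a * b := by
    apply ofLipschitz_injective
    rw [ofLipschitz_smul, map_mul, ha, hb, hc]
    have : ((2 : 𝓞 K) : K) = 2 := map_ofNat (algebraMap (𝓞 K) K) 2
    rw [this, two_smul, two_mul, two_mul, two_mul]
    noncomm_ring
  have e' := congrArg (fun z => (splitting f hxy z).mulVec v) e
  simp only [splitting_smul, map_mul, ← Matrix.mulVec_mulVec, h, Matrix.mulVec_zero,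
    Matrix.smul_mulVec] at e'
  rw [map_ofNat] at e'
  exact (smul_eq_zero.1 e').resolve_left h2

end Reduction

/-! ### The Hecke recursion at an odd prime -/

theorem exists_sq_add_sq_eq_neg_one (F : Type*) [Field F] [Finite F] :
    ∃ x y : F, x ^ 2 + y ^ 2 = -1 := by
  obtain ⟨p, hp⟩ := CharP.exists F
  have : NeZero p := ⟨CharP.char_ne_zero_of_finite F p⟩
  obtain ⟨a, b, h⟩ := CharP.sq_add_sq F p (-1)
  exact ⟨a, b, by simpa using h⟩

section

variable {F : Type*} [Field F] {f : 𝓞 K →+* F} {x y : F} {hxy : x ^ 2 + y ^ 2 = -1} {π : 𝓞 K}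

/-- If the reduction of 2q vanishes then 2q = πc with c in the Lipschitz order. A Bézout relation 2u
+ wπ = 1 gives q = π(uc + wq), which descends divisibility from 2q to q. -/
theorem exists_smul_eq_iff (h2 : (2 : F) ≠ 0) (hker : ∀ a, f a = 0 ↔ π ∣ a) (hπ : Prime π)
    {q : ℍ[K,-1,-1]} (hq : q ∈ cubianOrder) {b : ℍ[𝓞 K,-1,-1]} (hb : ofLipschitz b = 2 * q) :
    (∃ z ∈ cubianOrder, q = (π : K) • z) ↔ splitting f hxy b = 0 := by
  constructor
  · rintro ⟨z, hz, rfl⟩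
    obtain ⟨c, hc⟩ := exists_ofLipschitz_eq_two_mul hz
    have e : b = π • c := by
      apply ofLipschitz_injective
      rw [hb, ofLipschitz_smul, hc, mul_smul_comm]
    rw [e, splitting_smul, (hker π).2 dvd_rfl, zero_smul]
  · intro h
    simp only [splitting_eq_zero_iff f hxy h2, hker] at h
    obtain ⟨⟨a0, h0⟩, ⟨a1, h1⟩, ⟨a2, h2'⟩, ⟨a3, h3⟩⟩ := h
    set c : ℍ[𝓞 K,-1,-1] := ⟨a0, a1, a2, a3⟩ with hc
    have e : b = π • c := by
      ext1 <;> simp [hc, h0, h1, h2', h3]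
    have hcop : IsCoprime (2 : 𝓞 K) π := by
      refine ((hπ.irreducible.coprime_iff_not_dvd).2 fun h => h2 ?_).symm
      rw [← hker, map_ofNat] at h
      exact h
    obtain ⟨u, w, huw⟩ := hcop
    have hπ0 : (π : K) ≠ 0 := by simpa using hπ.ne_zero
    have huwK : (u : K) * 2 + w * π = 1 := by
      have := congrArg (algebraMap (𝓞 K) K) huw
      rwa [map_add, map_mul, map_mul, map_ofNat, map_one] at this
    refine ⟨(u : K) • ofLipschitz c + (w : K) • q,
      cubianOrder.add_mem (coe_smul_mem u (ofLipschitz_mem c)) (coe_smul_mem w hq), ?_⟩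
    rw [e, ofLipschitz_smul] at hb
    rw [smul_add, smul_comm, hb, two_mul, ← two_smul K q, smul_smul, smul_smul, ← add_smul,
      mul_comm (π : K), huwK, one_smul]

theorem exists_splitting_mulVec_eq_zero (h2 : (2 : F) ≠ 0) (hf : Function.Surjective f)
    {v : Fin 2 → F} (hv : v ≠ 0) :
    ∃ b, splitting f hxy b ≠ 0 ∧ (splitting f hxy b).mulVec v = 0 := by
  obtain ⟨b, hb⟩ := splitting_surjective f hxy h2 hf !![v 1, -v 0; 0, 0]
  refine ⟨b, ?_, ?_⟩
  · intro h
    rw [hb] at h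
    apply hv
    have h0 := congrFun (congrFun h 0) 0
    have h1 := congrFun (congrFun h 0) 1
    simp at h0 h1
    ext i
    fin_cases i <;> simp [h0, h1]
  · rw [hb]
    ext i
    fin_cases i <;> simp [Matrix.mulVec, dotProduct, Fin.sum_univ_two]
    ring

/-- The elements killing `v` form a left ideal that contains all multiples of π, so it has a
generator whose norm divides π². The norm is not a unit, since 1 does not kill `v`. It is not
associated to π² either, since the generator would then be a multiple of π although some element
nonzero modulo π kills `v`. Hence it is π up to a unit. -/
theorem exists_annihilator_generator (h2 : (2 : F) ≠ 0) (hf : Function.Surjective f)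
    (hker : ∀ a, f a = 0 ↔ π ∣ a) (hπ : Prime π) (hpos : TotPos (π : K)) {v : Fin 2 → F}
    (hv : v ≠ 0) : ∃ g ∈ cubianOrder, reducedNorm g = π ∧
      ∀ q ∈ cubianOrder, Annihilates f hxy v q ↔ ∃ z ∈ cubianOrder, q = z * g := by
  let I : AddSubgroup ℍ[K,-1,-1] :=
    { carrier := {q | q ∈ cubianOrder ∧ Annihilates f hxy v q}
      zero_mem' := ⟨cubianOrder.zero_mem, annihilates_zero v⟩
      add_mem' := fun h h' => ⟨cubianOrder.add_mem h.1 h'.1, h.2.add h'.2⟩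
      neg_mem' := fun h => ⟨cubianOrder.neg_mem h.1, h.2.neg⟩ }
  have hIl : ∀ y ∈ cubianOrder, ∀ q ∈ I, y * q ∈ I := fun y hy q hq =>
    ⟨cubianOrder.mul_mem hy hq.1, Annihilates.mul_left h2 hy hq.1 hq.2⟩
  have hπ0 : (π : K) ≠ 0 := hpos.ne_zero
  have hπI : ∀ z ∈ cubianOrder, (π : K) • z ∈ I := by
    intro z hz
    have hm := coe_smul_mem π hz
    refine ⟨hm, ?_⟩
    obtain ⟨b, hb⟩ := exists_ofLipschitz_eq_two_mul hm
    refine ⟨b, hb, ?_⟩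
    rw [(exists_smul_eq_iff h2 hker hπ hm hb).1 ⟨z, hz, rfl⟩, Matrix.zero_mulVec]
  obtain ⟨g, hg, hg0, hgen⟩ := exists_left_generator I (fun q hq => hq.1) hIl
    ⟨(π : K) • 1, hπI 1 cubianOrder.one_mem, smul_ne_zero hπ0 one_ne_zero⟩
  obtain ⟨n, hn⟩ := exists_reducedNorm_eq hg.1
  have hposn : TotPos (n : K) := hn ▸ totPos_reducedNorm hg0
  obtain ⟨z, hz, hzg⟩ := hgen _ (hπI 1 cubianOrder.one_mem)
  obtain ⟨m, hm⟩ := exists_reducedNorm_eq hz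
  have hmn : π ^ 2 = m * n := by
    have h := congrArg reducedNorm hzg
    rw [reducedNorm_smul, reducedNorm_mul, hn, hm] at h
    apply NumberField.RingOfIntegers.ext
    have h1 : reducedNorm 1 = 1 := by simp [reducedNorm_eq]
    rw [h1, mul_one] at h
    push_cast
    exact h
  obtain ⟨i, hi, hass⟩ := (dvd_prime_pow hπ 2).1 ⟨m, by rw [hmn, mul_comm]⟩
  have key : Associated n π := by
    interval_cases i
    · exfalso
      rw [pow_zero, associated_one_iff_isUnit] at hass
      obtain ⟨u, hu⟩ := hass.exists_left_inv
      have h1 : (1 : ℍ[K,-1,-1]) ∈ I := by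
        have := hIl _ (coe_smul_mem u (star_mem_cubianOrder hg.1)) g hg
        rw [smul_mul_assoc, star_mul_self_eq, hn, smul_smul] at this
        have huK : (u : K) * n = 1 := by
          have := congrArg (fun z : 𝓞 K => (z : K)) hu
          simpa using this
        rwa [huK, one_smul] at this
      have h3 := (annihilates_iff (b := 2) (by rw [map_ofNat, mul_one])).1 h1.2
      rw [map_ofNat] at h3
      have h4 : (2 : F) • v = 0 := by
        have : (2 : Matrix (Fin 2) (Fin 2) F) = (2 : F) • 1 := by
          rw [two_smul, one_add_one_eq_two]
        rwa [this, Matrix.smul_mulVec, Matrix.one_mulVec] at h3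
      exact hv ((smul_eq_zero.1 h4).resolve_left h2)
    · rwa [pow_one] at hass
    · exfalso
      have hmu : IsUnit m := by
        obtain ⟨u, hu⟩ := hass
        rw [← hu] at hmn
        have h1 : n * u = n * m := by rw [hmn, mul_comm]
        have hn0 : n ≠ 0 := fun h => hposn.ne_zero (by rw [h]; simp)
        rw [← mul_left_cancel₀ hn0 h1]
        exact u.isUnit
      obtain ⟨u, hu⟩ := hmu.exists_left_inv
      have huK : (u : K) * m = 1 := by
        have := congrArg (fun z : 𝓞 K => (z : K)) hu
        simpa using this
      have hgπ : g = (π : K) • ((u : K) • star z) := by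
        have h := congrArg (star z * ·) hzg
        simp only [← mul_assoc, star_mul_self_eq, hm, smul_mul_assoc, one_mul, mul_smul_comm,
          mul_one] at h
        rw [smul_comm, h, smul_smul, huK, one_smul]
      obtain ⟨b, hb0, hbv⟩ := exists_splitting_mulVec_eq_zero (hxy := hxy) h2 hf hv
      have hbb : ofLipschitz (2 * b) = 2 * ofLipschitz b := by rw [map_mul, map_ofNat]
      have hbI : ofLipschitz b ∈ I := by
        refine ⟨ofLipschitz_mem b, 2 * b, hbb, ?_⟩
        rw [map_mul, ← Matrix.mulVec_mulVec, hbv, Matrix.mulVec_zero]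
      obtain ⟨w, hw, hwg⟩ := hgen _ hbI
      have h0 := (exists_smul_eq_iff (hxy := hxy) h2 hker hπ (ofLipschitz_mem b) hbb).1
        ⟨w * ((u : K) • star z),
          cubianOrder.mul_mem hw (coe_smul_mem u (star_mem_cubianOrder hz)), by
            rw [hwg, ← mul_smul_comm, ← hgπ]⟩
      have e : (2 : ℍ[𝓞 K,-1,-1]) * b = (2 : 𝓞 K) • b := by rw [two_mul, two_smul]
      rw [e, splitting_smul, map_ofNat] at h0
      exact hb0 ((smul_eq_zero.1 h0).resolve_left h2)
  -- Both norms are totally positive, so the unit between them is a square, and rescaling the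
  -- generator by its root makes the norm exactly π.
  obtain ⟨ε, hε⟩ := key
  have hεpos : TotPos ((ε : 𝓞 K) : K) := by
    apply hposn.of_mul
    rw [← map_mul, hε]
    exact hpos
  obtain ⟨η, hη⟩ := exists_sq_of_totPos_unit hεpos
  have hηK : (((η⁻¹ : (𝓞 K)ˣ) : 𝓞 K) : K) * ((η : 𝓞 K) : K) = 1 := by
    simp
  refine ⟨((η : 𝓞 K) : K) • g, coe_smul_mem _ hg.1, ?_, fun q hq => ⟨fun h => ?_, ?_⟩⟩
  · rw [reducedNorm_smul, hn, ← hε, hη]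
    push_cast
    rw [mul_comm]
  · obtain ⟨w, hw, rfl⟩ := hgen q ⟨hq, h⟩
    refine ⟨(((η⁻¹ : (𝓞 K)ˣ) : 𝓞 K) : K) • w, coe_smul_mem _ hw, ?_⟩
    rw [smul_mul_smul_comm, hηK, one_smul]
  · rintro ⟨w, hw, rfl⟩
    have := (hIl _ (coe_smul_mem η hw) g hg).2
    rwa [smul_mul_assoc, ← mul_smul_comm] at this

end

/-! ### Counting lines -/

theorem exists_unique_line {F : Type*} [Field F] {A : Matrix (Fin 2) (Fin 2) F} (hA : A ≠ 0)
    (hdet : A.det = 0) :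
    ∃ l : Projectivization F (Fin 2 → F), ∀ l', A.mulVec l'.rep = 0 ↔ l' = l := by
  obtain ⟨v, hv, hAv⟩ := Matrix.exists_mulVec_eq_zero_iff.2 hdet
  refine ⟨Projectivization.mk F v hv, fun l => ⟨fun h => ?_, ?_⟩⟩
  · set w := l.rep with hw
    have hw0 : w ≠ 0 := l.rep_nonzero
    have hl : l = Projectivization.mk F w hw0 := l.mk_rep.symm
    rw [hl, Projectivization.mk_eq_mk_iff']
    -- Two linearly independent kernel vectors would force every entry of `A` to vanish, by Cramer's
    -- rule.
    have hD : w 0 * v 1 - w 1 * v 0 = 0 := by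
      by_contra hD
      apply hA
      ext i j
      have h1 := congrFun h i
      have h2 := congrFun hAv i
      simp only [Matrix.mulVec, dotProduct, Fin.sum_univ_two, Pi.zero_apply] at h1 h2
      rw [Matrix.zero_apply]
      fin_cases j
      · refine (mul_eq_zero.1 ?_).resolve_right hD
        simp only [Fin.zero_eta]
        linear_combination v 1 * h1 - w 1 * h2
      · refine (mul_eq_zero.1 ?_).resolve_right hD
        simp only [Fin.mk_one]
        linear_combination w 0 * h2 - v 0 * h1
    by_cases hv0 : v 0 = 0
    · have hv1 : v 1 ≠ 0 := fun h1 => hv (by ext i; fin_cases i <;> simp [hv0, h1])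
      refine ⟨w 1 / v 1, ?_⟩
      ext i
      fin_cases i
      · rw [hv0, mul_zero, sub_zero] at hD
        simp [hv0, (mul_eq_zero.1 hD).resolve_right hv1]
      · simp [hv1]
    · refine ⟨w 0 / v 0, ?_⟩
      ext i
      fin_cases i
      · simp [hv0]
      · simp
        field_simp
        linear_combination hD
  · rintro rfl
    obtain ⟨a, ha⟩ := Projectivization.exists_smul_eq_mk_rep F v hv
    rw [← ha, Units.smul_def, Matrix.mulVec_smul, hAv, smul_zero]

/-- The elements of the cubian order of given reduced norm. -/
def cubianSphere (α : 𝓞 K) : Set ℍ[K,-1,-1] := {q | q ∈ cubianOrder ∧ reducedNorm q = (α : K)}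

/-- Double counting of pairs (line, element of norm πα killing the line). Right multiplication by
the generator `g l` identifies the elements attached to a line with those of norm α. Conversely an
element divisible by π is attached to all N + 1 lines, and any other to exactly one, because its
reduction is a nonzero singular matrix. -/
theorem cubianSphere_hecke {F : Type*} [Field F] [Finite F] {f : 𝓞 K →+* F} {π : 𝓞 K}
    (h2 : (2 : F) ≠ 0) (hf : Function.Surjective f) (hker : ∀ a, f a = 0 ↔ π ∣ a) (hπ : Prime π)
    (hpos : TotPos (π : K)) {α : 𝓞 K} (hfin : (cubianSphere α).Finite) :
    (cubianSphere (π * α)).Finite ∧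
      (cubianSphere (π * α)).ncard +
        Nat.card F * {q | q ∈ cubianOrder ∧ (π : K) * reducedNorm q = α}.ncard =
      (Nat.card F + 1) * (cubianSphere α).ncard := by
  classical
  obtain ⟨x, y, hxy⟩ := exists_sq_add_sq_eq_neg_one F
  have hπ0 : (π : K) ≠ 0 := hpos.ne_zero
  choose g hg hgn hgen using fun l : Projectivization F (Fin 2 → F) =>
    exists_annihilator_generator (hxy := hxy) h2 hf hker hπ hpos l.rep_nonzero
  have hg0 : ∀ l, g l ≠ 0 := by
    intro l h
    have := hgn l
    rw [h, reducedNorm_eq_zero.2 rfl] at this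
    exact hπ0 this.symm
  have hinj : ∀ l, Function.Injective (· * g l) := fun l z w h =>
    mul_right_cancel_quaternion (hg0 l) h
  have himg : ∀ l, {q | q ∈ cubianSphere (π * α) ∧ Annihilates f hxy l.rep q} =
      (· * g l) '' cubianSphere α := by
    intro l
    ext q
    constructor
    · rintro ⟨⟨hq, hqn⟩, ha⟩
      obtain ⟨z, hz, rfl⟩ := (hgen l q hq).1 ha
      refine ⟨z, ⟨hz, ?_⟩, rfl⟩
      rw [reducedNorm_mul, hgn] at hqn
      apply mul_left_cancel₀ hπ0
      rw [mul_comm, hqn]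
      push_cast
      rfl
    · rintro ⟨z, ⟨hz, hzn⟩, rfl⟩
      have hm := cubianOrder.mul_mem hz (hg l)
      refine ⟨⟨hm, ?_⟩, (hgen l _ hm).2 ⟨z, hz, rfl⟩⟩
      rw [reducedNorm_mul, hgn, hzn]
      push_cast
      rw [mul_comm]
  have hline : ∀ q ∈ cubianSphere (π * α), (∃ z ∈ cubianOrder, q = (π : K) • z) ∨
      ∃ l : Projectivization F (Fin 2 → F), ∀ l', Annihilates f hxy l'.rep q ↔ l' = l := by
    rintro q ⟨hq, hqn⟩
    obtain ⟨b, hb⟩ := exists_ofLipschitz_eq_two_mul hq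
    rw [exists_smul_eq_iff (hxy := hxy) h2 hker hπ hq hb]
    by_cases h0 : splitting f hxy b = 0
    · exact Or.inl h0
    · right
      simp only [annihilates_iff hb]
      refine exists_unique_line h0 ?_
      rw [det_splitting, hker]
      have hn := congrArg reducedNorm hb
      rw [reducedNorm_mul, hqn] at hn
      refine ⟨4 * α, NumberField.RingOfIntegers.ext ?_⟩
      have e2 : reducedNorm (2 : ℍ[K,-1,-1]) = 4 := by
        rw [← one_add_one_eq_two]
        simp [reducedNorm_eq]
        norm_num
      rw [reducedNorm_eq, e2] at hn
      change algebraMap (𝓞 K) K _ = algebraMap (𝓞 K) K _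
      simp only [map_add, map_pow, map_mul, map_ofNat] at hn ⊢
      refine Eq.trans hn ?_
      ring
  have hall : ∀ q ∈ cubianSphere (π * α), (∃ z ∈ cubianOrder, q = (π : K) • z) →
      ∀ l : Projectivization F (Fin 2 → F), Annihilates f hxy l.rep q := by
    rintro q ⟨hq, hqn⟩ hz l
    obtain ⟨b, hb⟩ := exists_ofLipschitz_eq_two_mul hq
    rw [exists_smul_eq_iff (hxy := hxy) h2 hker hπ hq hb] at hz
    rw [annihilates_iff hb, hz, Matrix.zero_mulVec]
  have hfin' : (cubianSphere (π * α)).Finite := by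
    have : Finite (Projectivization F (Fin 2 → F)) := inferInstance
    refine (Set.finite_iUnion (fun l => (hfin.image (· * g l)))).subset fun q hq => ?_
    rw [Set.mem_iUnion]
    rcases hline q hq with h | ⟨l, hl⟩
    · obtain ⟨v, hv⟩ := exists_ne (0 : Fin 2 → F)
      refine ⟨Projectivization.mk F v hv, ?_⟩
      rw [← himg]
      exact ⟨hq, hall q hq h _⟩
    · refine ⟨l, ?_⟩
      rw [← himg]
      exact ⟨hq, (hl l).2 rfl⟩
  refine ⟨hfin', ?_⟩
  have : Fintype (Projectivization F (Fin 2 → F)) := Fintype.ofFinite _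
  have hcard : Fintype.card (Projectivization F (Fin 2 → F)) = Nat.card F + 1 := by
    rw [← Nat.card_eq_fintype_card, Projectivization.card_of_finrank_two _ _ (by simp)]
  set T := hfin'.toFinset with hT
  have hdc := Finset.sum_card_bipartiteAbove_eq_sum_card_bipartiteBelow
    (s := (Finset.univ : Finset (Projectivization F (Fin 2 → F)))) (t := T)
    (fun l q => Annihilates f hxy l.rep q)
  have hleft : ∀ l ∈ (Finset.univ : Finset (Projectivization F (Fin 2 → F))),
      (T.bipartiteAbove (fun l q => Annihilates f hxy l.rep q) l).card =
        (cubianSphere α).ncard := by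
    intro l _
    rw [← Set.ncard_image_of_injective _ (hinj l), ← himg, ← Set.ncard_coe_finset]
    congr 1
    ext q
    simp [Finset.bipartiteAbove, hT]
  -- Writing N + 1 as 1 + N lets the contribution 1 be summed over all elements and the excess N
  -- only over the multiples of π.
  have hright : ∀ q ∈ T,
      (Finset.univ.bipartiteBelow
        (fun (l : Projectivization F (Fin 2 → F)) q => Annihilates f hxy l.rep q) q).card =
        1 + if ∃ z ∈ cubianOrder, q = (π : K) • z then Nat.card F else 0 := by
    intro q hq
    have hq' : q ∈ cubianSphere (π * α) := by simpa [hT] using hq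
    split_ifs with h
    · rw [Finset.bipartiteBelow, Finset.filter_true_of_mem fun l _ => hall q hq' h l,
        Finset.card_univ, hcard, add_comm]
    · obtain ⟨l, hl⟩ := (hline q hq').resolve_left h
      rw [Finset.bipartiteBelow, add_zero, Finset.card_eq_one]
      exact ⟨l, by ext l'; simp [hl]⟩
  rw [Finset.sum_congr rfl hleft, Finset.sum_congr rfl hright, Finset.sum_const, Finset.card_univ,
    hcard, smul_eq_mul, Finset.sum_add_distrib, ← Finset.sum_filter] at hdc
  rw [hdc]
  simp only [Finset.sum_const, smul_eq_mul, mul_one]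
  congr 1
  · rw [← Set.ncard_coe_finset, hT, Set.Finite.coe_toFinset]
  · rw [mul_comm, ← Set.ncard_coe_finset,
      ← Set.ncard_image_of_injective _ (smul_right_injective ℍ[K,-1,-1] hπ0)]
    congr 2
    ext q
    simp only [Set.mem_image, Set.mem_ofPred_eq, Finset.coe_filter, hT, Set.Finite.mem_toFinset]
    constructor
    · rintro ⟨z, ⟨hz, hzn⟩, rfl⟩
      refine ⟨⟨coe_smul_mem π hz, ?_⟩, z, hz, rfl⟩
      rw [reducedNorm_smul, sq, mul_assoc, hzn]
      push_cast
      rfl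
    · rintro ⟨⟨hq, hqn⟩, z, hz, rfl⟩
      refine ⟨z, ⟨hz, ?_⟩, rfl⟩
      rw [reducedNorm_smul, sq, mul_assoc] at hqn
      push_cast at hqn
      exact mul_left_cancel₀ hπ0 hqn

/-! ### The unit group of the cubian order -/

theorem card_hurwitz_units : ((Finset.Icc (-2 : ℤ) 2 ×ˢ Finset.Icc (-2 : ℤ) 2 ×ˢ
    Finset.Icc (-2 : ℤ) 2 ×ˢ Finset.Icc (-2 : ℤ) 2).filter fun p =>
      (2 ∣ p.1 - p.2.2.2 ∧ 2 ∣ p.2.1 - p.2.2.2 ∧ 2 ∣ p.2.2.1 - p.2.2.2) ∧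
        p.1 ^ 2 + p.2.1 ^ 2 + p.2.2.1 ^ 2 + p.2.2.2 ^ 2 = 4).card = 24 := by
  decide +kernel

theorem card_root_system : ((Finset.Icc (-1 : ℤ) 1 ×ˢ Finset.Icc (-1 : ℤ) 1 ×ˢ
    Finset.Icc (-1 : ℤ) 1 ×ˢ Finset.Icc (-1 : ℤ) 1).filter fun p =>
      p.1 ^ 2 + p.2.1 ^ 2 + p.2.2.1 ^ 2 + p.2.2.2 ^ 2 = 2).card = 24 := by
  decide +kernel

theorem reducedNorm_halfQuaternion_re (p r : Fin 4 → ℤ) :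
    4 * (reducedNorm (halfQuaternion p r)).re =
      ((p 0 ^ 2 + p 1 ^ 2 + p 2 ^ 2 + p 3 ^ 2 +
        2 * (r 0 ^ 2 + r 1 ^ 2 + r 2 ^ 2 + r 3 ^ 2) : ℤ) : ℚ) := by
  rw [reducedNorm_re]
  simp only [halfQuaternion]
  push_cast
  ring

theorem two_dvd_sum_sq_iff {a b c d : ℤ} :
    2 ∣ a ^ 2 + b ^ 2 + c ^ 2 + d ^ 2 ↔ 2 ∣ a + b + c + d := by
  have key : ∀ x : ℤ, ∃ k, x ^ 2 = x + 2 * k := by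
    intro x
    obtain ⟨m, rfl | rfl⟩ := Int.even_or_odd' x
    · exact ⟨2 * m ^ 2 - m, by ring⟩
    · exact ⟨2 * m ^ 2 + m, by ring⟩
  obtain ⟨k, hk⟩ := key a
  obtain ⟨l, hl⟩ := key b
  obtain ⟨m, hm⟩ := key c
  obtain ⟨n, hn⟩ := key d
  rw [hk, hl, hm, hn]
  omega

/-- For coordinates (pᵢ + rᵢ√2)/2, the rational part of the norm equation is Σpᵢ² + 2Σrᵢ² = 4. Since
Σrᵢ is even, so is Σrᵢ². Either r = 0, which leaves the 24 Hurwitz units, or p = 0 and Σrᵢ² = 2,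
which gives 24 more elements. -/
theorem cubianSphere_one : (cubianSphere 1).Finite ∧ (cubianSphere 1).ncard = 48 := by
  classical
  set P := (Finset.Icc (-2 : ℤ) 2 ×ˢ Finset.Icc (-2 : ℤ) 2 ×ˢ
    Finset.Icc (-2 : ℤ) 2 ×ˢ Finset.Icc (-2 : ℤ) 2).filter fun p =>
      (2 ∣ p.1 - p.2.2.2 ∧ 2 ∣ p.2.1 - p.2.2.2 ∧ 2 ∣ p.2.2.1 - p.2.2.2) ∧
        p.1 ^ 2 + p.2.1 ^ 2 + p.2.2.1 ^ 2 + p.2.2.2 ^ 2 = 4 with hP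
  set R := (Finset.Icc (-1 : ℤ) 1 ×ˢ Finset.Icc (-1 : ℤ) 1 ×ˢ
    Finset.Icc (-1 : ℤ) 1 ×ˢ Finset.Icc (-1 : ℤ) 1).filter fun p =>
      p.1 ^ 2 + p.2.1 ^ 2 + p.2.2.1 ^ 2 + p.2.2.2 ^ 2 = 2 with hR
  let φ : ℤ × ℤ × ℤ × ℤ → ℍ[K,-1,-1] := fun p =>
    halfQuaternion ![p.1, p.2.1, p.2.2.1, p.2.2.2] 0
  let ψ : ℤ × ℤ × ℤ × ℤ → ℍ[K,-1,-1] := fun p =>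
    halfQuaternion 0 ![p.1, p.2.1, p.2.2.1, p.2.2.2]
  have hφ : Function.Injective φ := by
    rintro ⟨a, b, c, d⟩ ⟨a', b', c', d'⟩ h
    have h0 := congrArg (fun q => q.re.re) h
    have h1 := congrArg (fun q => q.imI.re) h
    have h2 := congrArg (fun q => q.imJ.re) h
    have h3 := congrArg (fun q => q.imK.re) h
    simp [φ, halfQuaternion] at h0 h1 h2 h3
    rw [h0, h1, h2, h3]
  have hψ : Function.Injective ψ := by
    rintro ⟨a, b, c, d⟩ ⟨a', b', c', d'⟩ h
    have h0 := congrArg (fun q => q.re.im) h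
    have h1 := congrArg (fun q => q.imI.im) h
    have h2 := congrArg (fun q => q.imJ.im) h
    have h3 := congrArg (fun q => q.imK.im) h
    simp [ψ, halfQuaternion] at h0 h1 h2 h3
    rw [h0, h1, h2, h3]
  have hdisj : Disjoint (P.image φ) (R.image ψ) := by
    rw [Finset.disjoint_left]
    rintro q hq hq'
    obtain ⟨⟨a, b, c, d⟩, hp, rfl⟩ := Finset.mem_image.1 hq
    obtain ⟨⟨a', b', c', d'⟩, hr, h⟩ := Finset.mem_image.1 hq'
    have h0 := congrArg (fun q => q.re.re) h
    have h1 := congrArg (fun q => q.imI.re) h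
    have h2 := congrArg (fun q => q.imJ.re) h
    have h3 := congrArg (fun q => q.imK.re) h
    simp [φ, ψ, halfQuaternion] at h0 h1 h2 h3
    have hz : ∀ n : ℤ, (0 : ℚ) = n / 2 → n = 0 := by
      intro n hn
      have : (n : ℚ) = 0 := by linarith
      exact_mod_cast this
    simp [hP, hz a h0, hz b h1, hz c h2, hz d h3] at hp
  have hset : cubianSphere 1 = ↑(P.image φ ∪ R.image ψ) := by
    ext q
    simp only [Finset.coe_union, Finset.coe_image, Set.mem_union, Set.mem_image, Finset.mem_coe]
    constructor
    · rintro ⟨hq, hqn⟩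
      obtain ⟨p, r, ⟨hp, hr⟩, rfl⟩ := exists_halfQuaternion hq
      have h := reducedNorm_halfQuaternion_re p r
      have h1 : ((1 : 𝓞 K) : K) = 1 := map_one (algebraMap (𝓞 K) K)
      rw [hqn, h1, QuadraticAlgebra.re_one, mul_one] at h
      have h' : p 0 ^ 2 + p 1 ^ 2 + p 2 ^ 2 + p 3 ^ 2 +
          2 * (r 0 ^ 2 + r 1 ^ 2 + r 2 ^ 2 + r 3 ^ 2) = 4 := by exact_mod_cast h.symm
      obtain ⟨m, hm⟩ := two_dvd_sum_sq_iff.2 hr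
      have hm0 : 0 ≤ r 0 ^ 2 + r 1 ^ 2 + r 2 ^ 2 + r 3 ^ 2 := by positivity
      have hp0 : 0 ≤ p 0 ^ 2 + p 1 ^ 2 + p 2 ^ 2 + p 3 ^ 2 := by positivity
      have hz : ∀ a b c d : ℤ, a ^ 2 + b ^ 2 + c ^ 2 + d ^ 2 = 0 →
          a = 0 ∧ b = 0 ∧ c = 0 ∧ d = 0 := by
        intro a b c d h
        refine ⟨?_, ?_, ?_, ?_⟩ <;> rw [← sq_eq_zero_iff] <;>
          linarith [sq_nonneg a, sq_nonneg b, sq_nonneg c, sq_nonneg d]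
      rcases (by omega : m = 0 ∨ m = 1) with rfl | rfl
      · left
        obtain ⟨r0, r1, r2, r3⟩ := hz _ _ _ _ (hm.trans (by norm_num))
        refine ⟨(p 0, p 1, p 2, p 3), ?_, ?_⟩
        · have hs : p 0 ^ 2 + p 1 ^ 2 + p 2 ^ 2 + p 3 ^ 2 = 4 := by linarith
          simp only [hP, Finset.mem_filter, Finset.mem_product, Finset.mem_Icc]
          refine ⟨⟨⟨?_, ?_⟩, ⟨?_, ?_⟩, ⟨?_, ?_⟩, ?_, ?_⟩, hp, hs⟩ <;>
            nlinarith only [hs, sq_nonneg (p 0), sq_nonneg (p 1), sq_nonneg (p 2), sq_nonneg (p 3)]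
        · simp [φ, halfQuaternion, r0, r1, r2, r3]
      · right
        obtain ⟨p0, p1, p2, p3⟩ := hz (p 0) (p 1) (p 2) (p 3) (by linarith)
        refine ⟨(r 0, r 1, r 2, r 3), ?_, ?_⟩
        · have hs : r 0 ^ 2 + r 1 ^ 2 + r 2 ^ 2 + r 3 ^ 2 = 2 := by linarith
          simp only [hR, Finset.mem_filter, Finset.mem_product, Finset.mem_Icc]
          refine ⟨⟨⟨?_, ?_⟩, ⟨?_, ?_⟩, ⟨?_, ?_⟩, ?_, ?_⟩, hs⟩ <;>
            nlinarith only [hs, sq_nonneg (r 0), sq_nonneg (r 1), sq_nonneg (r 2), sq_nonneg (r 3)]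
        · simp [ψ, halfQuaternion, p0, p1, p2, p3]
    · have h1 : ((1 : 𝓞 K) : K) = 1 := map_one (algebraMap (𝓞 K) K)
      rintro (⟨⟨a, b, c, d⟩, h, rfl⟩ | ⟨⟨a, b, c, d⟩, h, rfl⟩)
      · simp only [hP, Finset.mem_filter] at h
        refine ⟨halfQuaternion_mem ⟨h.2.1, by simp⟩, ?_⟩
        have hs : ((a ^ 2 + b ^ 2 + c ^ 2 + d ^ 2 : ℤ) : ℚ) = 4 := by rw [h.2.2]; norm_num
        push_cast at hs
        rw [h1]
        ext
        · rw [reducedNorm_re, QuadraticAlgebra.re_one]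
          simp [φ, halfQuaternion]
          linarith
        · rw [reducedNorm_im, QuadraticAlgebra.im_one]
          simp [φ, halfQuaternion]
      · simp only [hR, Finset.mem_filter] at h
        have hd : (2 : ℤ) ∣ a + b + c + d := two_dvd_sum_sq_iff.1 (dvd_of_eq h.2.symm)
        refine ⟨halfQuaternion_mem ⟨by simp, hd⟩, ?_⟩
        have hs : ((a ^ 2 + b ^ 2 + c ^ 2 + d ^ 2 : ℤ) : ℚ) = 2 := by rw [h.2]; norm_num
        push_cast at hs
        rw [h1]
        ext
        · rw [reducedNorm_re, QuadraticAlgebra.re_one]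
          simp [ψ, halfQuaternion]
          linarith
        · rw [reducedNorm_im, QuadraticAlgebra.im_one]
          simp [ψ, halfQuaternion]
  rw [hset]
  refine ⟨Finset.finite_toSet _, ?_⟩
  rw [Set.ncard_coe_finset, Finset.card_union_of_disjoint hdisj,
    Finset.card_image_of_injective _ hφ, Finset.card_image_of_injective _ hψ, hP, hR,
    card_hurwitz_units, card_root_system]

theorem cubianSphere_unit_sq_mul (η : (𝓞 K)ˣ) (α : 𝓞 K) :
    cubianSphere ((η : 𝓞 K) ^ 2 * α) = (fun q => ((η : 𝓞 K) : K) • q) '' cubianSphere α := by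
  have hηK : ((η : 𝓞 K) : K) * (((η⁻¹ : (𝓞 K)ˣ) : 𝓞 K) : K) = 1 := by simp
  ext q
  constructor
  · rintro ⟨hq, hqn⟩
    refine ⟨(((η⁻¹ : (𝓞 K)ˣ) : 𝓞 K) : K) • q, ⟨coe_smul_mem _ hq, ?_⟩, ?_⟩
    · rw [reducedNorm_smul, hqn]
      push_cast
      rw [← mul_assoc, ← mul_pow, mul_comm (((η⁻¹ : (𝓞 K)ˣ) : 𝓞 K) : K), hηK, one_pow, one_mul]
    · simp only
      rw [smul_smul, hηK, one_smul]
  · rintro ⟨z, ⟨hz, hzn⟩, rfl⟩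
    refine ⟨coe_smul_mem _ hz, ?_⟩
    rw [reducedNorm_smul, hzn]
    push_cast
    rfl

theorem cubianSphere_unit {α : 𝓞 K} (hα : IsUnit α) (hpos : TotPos (α : K)) :
    (cubianSphere α).Finite ∧ (cubianSphere α).ncard = 48 := by
  obtain ⟨ε, rfl⟩ := hα
  obtain ⟨η, rfl⟩ := exists_sq_of_totPos_unit hpos
  have h := cubianSphere_unit_sq_mul η 1
  rw [mul_one] at h
  have hη : ((η : 𝓞 K) : K) ≠ 0 := by simp
  rw [Units.val_pow_eq_pow_val, h]
  exact ⟨cubianSphere_one.1.image _,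
    (Set.ncard_image_of_injective _ (smul_right_injective _ hη)).trans cubianSphere_one.2⟩

/-! ### Representation numbers of odd elements -/

theorem cubianSphere_hecke_ideal {π : 𝓞 K} (hπ : Prime π) (h2 : ¬ π ∣ 2) (hpos : TotPos (π : K))
    {α : 𝓞 K} (hfin : (cubianSphere α).Finite) :
    (cubianSphere (π * α)).Finite ∧
      (cubianSphere (π * α)).ncard +
        Ideal.absNorm (Ideal.span {π}) * {q | q ∈ cubianOrder ∧ (π : K) * reducedNorm q = α}.ncard =
      (Ideal.absNorm (Ideal.span {π}) + 1) * (cubianSphere α).ncard := by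
  have hne : Ideal.span {π} ≠ ⊥ := by
    rw [Ne, Ideal.span_singleton_eq_bot]; exact hπ.ne_zero
  have hprime : (Ideal.span {π}).IsPrime := (Ideal.span_singleton_prime hπ.ne_zero).2 hπ
  have hmax : (Ideal.span {π}).IsMaximal := hprime.isMaximal hne
  let := Ideal.Quotient.field (Ideal.span {π})
  have : Finite (𝓞 K ⧸ Ideal.span {π}) := Ideal.finiteQuotientOfFreeOfNeBot _ hne
  have hker : ∀ a, Ideal.Quotient.mk (Ideal.span {π}) a = 0 ↔ π ∣ a := fun a => by
    rw [Ideal.Quotient.eq_zero_iff_mem, Ideal.mem_span_singleton]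
  refine cubianSphere_hecke (F := 𝓞 K ⧸ Ideal.span {π}) (f := Ideal.Quotient.mk (Ideal.span {π}))
    ?_ Ideal.Quotient.mk_surjective hker hπ hpos hfin
  intro h
  apply h2
  rw [← hker, map_ofNat]
  exact h

theorem setOf_mul_reducedNorm_eq {π : 𝓞 K} (hπ : π ≠ 0) (α : 𝓞 K) :
    {q | q ∈ cubianOrder ∧ (π : K) * reducedNorm q = (π * α : 𝓞 K)} = cubianSphere α := by
  have hπ0 : (π : K) ≠ 0 := by simpa using hπ
  ext q
  refine and_congr_right fun _ => ?_
  push_cast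
  exact mul_right_inj' hπ0

theorem setOf_mul_reducedNorm_eq_empty {π α : 𝓞 K} (h : ¬ π ∣ α) :
    {q | q ∈ cubianOrder ∧ (π : K) * reducedNorm q = α} = ∅ := by
  rw [Set.eq_empty_iff_forall_notMem]
  rintro q ⟨hq, hqn⟩
  obtain ⟨n, hn⟩ := exists_reducedNorm_eq hq
  rw [hn] at hqn
  refine h ⟨n, NumberField.RingOfIntegers.ext ?_⟩
  push_cast
  exact hqn.symm

/-- The Hecke relation is a second-order recursion in k, satisfied by the geometric sums 1 + N + ...
+ Nᵏ. At the first step the term for β/π is absent because π does not divide β. The induction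
carries two consecutive exponents. -/
theorem cubianSphere_prime_pow_mul {π : 𝓞 K} (hπ : Prime π) (h2 : ¬ π ∣ 2) (hpos : TotPos (π : K))
    {β : 𝓞 K} (hβ : ¬ π ∣ β) (hfin : (cubianSphere β).Finite) (k : ℕ) :
    (cubianSphere (π ^ k * β)).Finite ∧ (cubianSphere (π ^ k * β)).ncard =
      (∑ i ∈ Finset.range (k + 1), Ideal.absNorm (Ideal.span {π}) ^ i) *
        (cubianSphere β).ncard := by
  have h0 : (cubianSphere (π ^ 0 * β)).Finite ∧ (cubianSphere (π ^ 0 * β)).ncard =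
      (∑ i ∈ Finset.range (0 + 1), Ideal.absNorm (Ideal.span {π}) ^ i) *
        (cubianSphere β).ncard := by
    simpa using hfin
  have key : ∀ k, ((cubianSphere (π ^ k * β)).Finite ∧ (cubianSphere (π ^ k * β)).ncard =
      (∑ i ∈ Finset.range (k + 1), Ideal.absNorm (Ideal.span {π}) ^ i) *
        (cubianSphere β).ncard) ∧
      ((cubianSphere (π ^ (k + 1) * β)).Finite ∧ (cubianSphere (π ^ (k + 1) * β)).ncard =
      (∑ i ∈ Finset.range (k + 1 + 1), Ideal.absNorm (Ideal.span {π}) ^ i) *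
        (cubianSphere β).ncard) := by
    intro k
    induction k with
    | zero =>
      obtain ⟨h1, h3⟩ := cubianSphere_hecke_ideal hπ h2 hpos hfin
      rw [setOf_mul_reducedNorm_eq_empty hβ, Set.ncard_empty, mul_zero, add_zero] at h3
      refine ⟨h0, by rwa [zero_add, pow_one], ?_⟩
      rw [zero_add, pow_one, h3, Finset.sum_range_succ, Finset.sum_range_one, pow_one, pow_zero,
        add_comm 1]
    | succ k ih =>
      refine ⟨ih.2, ?_⟩
      obtain ⟨h1, h3⟩ := cubianSphere_hecke_ideal hπ h2 hpos ih.2.1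
      have e : π * (π ^ (k + 1) * β) = π ^ (k + 1 + 1) * β := by ring
      have e' : π ^ (k + 1) * β = π * (π ^ k * β) := by ring
      have hs : {q | q ∈ cubianOrder ∧ (π : K) * reducedNorm q = (π ^ (k + 1) * β : 𝓞 K)} =
          cubianSphere (π ^ k * β) := by
        rw [e', setOf_mul_reducedNorm_eq hπ.ne_zero]
      rw [hs, e] at h3
      rw [e] at h1
      refine ⟨h1, ?_⟩
      rw [ih.1.2, ih.2.2] at h3
      refine Nat.add_right_cancel (h3.trans ?_)
      rw [Finset.sum_range_succ _ (k + 1 + 1), Finset.sum_range_succ _ (k + 1)]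
      ring
  exact (key k).1

/-! ### Sums of norms of divisors -/

/-- The sum of the norms of all ideal divisors. -/
noncomputable def idealSigma (J : Ideal (𝓞 K)) : ℕ :=
  ∑ᶠ I ∈ {I : Ideal (𝓞 K) | I ∣ J}, Ideal.absNorm I

theorem finite_dvd_ideal {J : Ideal (𝓞 K)} (hJ : J ≠ 0) : {I : Ideal (𝓞 K) | I ∣ J}.Finite :=
  @Set.toFinite _ _ (@Finite.of_fintype _ (UniqueFactorizationMonoid.fintypeSubtypeDvd _ hJ))

theorem idealSigma_one : idealSigma 1 = 1 := by
  have : {I : Ideal (𝓞 K) | I ∣ 1} = {1} := by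
    ext I
    rw [Set.mem_ofPred_eq, Set.mem_singleton_iff, ← isUnit_iff_dvd_one, Ideal.isUnit_iff,
      Ideal.one_eq_top]
  rw [idealSigma, this, finsum_mem_singleton, map_one]

/-- Unique factorisation writes each divisor as Pⁱ times a divisor of `J`, uniquely. This is the
only case of multiplicativity needed, as it matches the recursion for representation numbers one
prime at a time. -/
theorem idealSigma_prime_pow_mul {P J : Ideal (𝓞 K)} (hP : Prime P) (hJ : J ≠ 0) (hPJ : ¬ P ∣ J)
    (k : ℕ) : idealSigma (P ^ k * J) =
      (∑ i ∈ Finset.range (k + 1), Ideal.absNorm P ^ i) * idealSigma J := by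
  classical
  obtain ⟨D, hD⟩ := (finite_dvd_ideal hJ).exists_finset_coe
  have hmem : ∀ I, I ∈ D ↔ I ∣ J := fun I => by
    rw [← Finset.mem_coe, hD]; rfl
  have himg : {I : Ideal (𝓞 K) | I ∣ P ^ k * J} =
      ↑((Finset.range (k + 1) ×ˢ D).image fun x => P ^ x.1 * x.2) := by
    ext I
    simp only [Set.mem_ofPred_eq, Finset.coe_image, Set.mem_image, Finset.mem_coe,
      Finset.mem_product, Finset.mem_range, hmem, Prod.exists]
    constructor
    · intro h
      obtain ⟨A, B, hA, hB, rfl⟩ := exists_dvd_and_dvd_of_dvd_mul h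
      obtain ⟨i, hi, hass⟩ := (dvd_prime_pow hP k).1 hA
      rw [associated_iff_eq] at hass
      exact ⟨i, B, ⟨by omega, hB⟩, by rw [hass]⟩
    · rintro ⟨i, B, ⟨hi, hB⟩, rfl⟩
      exact mul_dvd_mul (pow_dvd_pow P (by omega)) hB
  have hinj : Set.InjOn (fun x : ℕ × Ideal (𝓞 K) => P ^ x.1 * x.2)
      ↑(Finset.range (k + 1) ×ˢ D) := by
    have key : ∀ i j (A B : Ideal (𝓞 K)), A ∣ J → P ^ i * A = P ^ j * B → j ≤ i := by
      intro i j A B hA h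
      by_contra hij
      rw [not_le] at hij
      obtain ⟨d, rfl⟩ := Nat.exists_eq_add_of_lt hij
      rw [show i + d + 1 = i + (d + 1) by ring, pow_add, mul_assoc] at h
      have := mul_left_cancel₀ (pow_ne_zero i hP.ne_zero) h
      apply hPJ
      refine dvd_trans ?_ hA
      rw [this, pow_succ', mul_assoc]
      exact dvd_mul_right _ _
    rintro ⟨i, A⟩ hA ⟨j, B⟩ hB h
    simp only [Finset.coe_product, Set.mem_prod, Finset.mem_coe, hmem] at hA hB h
    have hij : i = j := le_antisymm (key _ _ _ _ hB.2 h.symm) (key _ _ _ _ hA.2 h)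
    subst hij
    rw [mul_left_cancel₀ (pow_ne_zero i hP.ne_zero) h]
  rw [idealSigma, himg, finsum_mem_coe_finset, Finset.sum_image hinj, idealSigma, ← hD,
    finsum_mem_coe_finset, Finset.sum_mul_sum, Finset.sum_product]
  simp only [map_mul, map_pow]

theorem oddDivisorSum_eq {e : ℕ} {α β : 𝓞 K} (hαβ : Ideal.span {α} = Ideal.span {rtInt} ^ e *
    Ideal.span {β}) (hβ : ¬ rtInt ∣ β) : oddDivisorSum α = idealSigma (Ideal.span {β}) := by
  have hset : oddDivisors α = {I : Ideal (𝓞 K) | I ∣ Ideal.span {β}} := by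
    have hP : Prime (Ideal.span {rtInt} : Ideal (𝓞 K)) := by
      refine Ideal.prime_of_isPrime ?_ ((Ideal.span_singleton_prime rtInt_ne_zero).2 prime_rtInt)
      rw [Ne, Ideal.span_singleton_eq_bot]
      exact rtInt_ne_zero
    ext I
    constructor
    · rintro ⟨-, hI, hI'⟩
      rw [hαβ] at hI
      obtain ⟨A, B, hA, hB, rfl⟩ := exists_dvd_and_dvd_of_dvd_mul hI
      obtain ⟨i, hi, hass⟩ := (dvd_prime_pow hP e).1 hA
      rw [associated_iff_eq] at hass
      have hi0 : i = 0 := by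
        by_contra h0
        apply hI'
        rw [hass]
        exact (dvd_pow_self _ h0).mul_right _
      rw [hass, hi0, pow_zero, one_mul]
      exact hB
    · intro hI
      refine ⟨?_, ?_, fun h => hβ ?_⟩
      -- The requirement that divisors be principal is automatic in a principal ideal domain.
      · obtain ⟨δ, hδ⟩ := (IsPrincipalIdealRing.principal I).principal
        exact ⟨δ, hδ⟩
      · rw [hαβ]
        exact Dvd.dvd.mul_left hI _
      · have := h.trans hI
        rwa [Ideal.dvd_iff_le, Ideal.span_singleton_le_span_singleton] at this
  rw [oddDivisorSum, hset, idealSigma]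

/-- Jacobi's theorem for the cubian order, at odd elements. -/
theorem cubianSphere_odd {β : 𝓞 K} (hpos : TotPos (β : K)) (hβ : ¬ rtInt ∣ β) :
    (cubianSphere β).Finite ∧
      (cubianSphere β).ncard = 48 * idealSigma (Ideal.span {β}) := by
  induction hN : natNorm β using Nat.strong_induction_on generalizing β with
  | _ N ih =>
  have hβ0 : β ≠ 0 := fun h => hpos.ne_zero (by rw [h]; simp)
  by_cases hu : IsUnit β
  · have h := cubianSphere_unit hu hpos
    rw [Ideal.span_singleton_eq_top.2 hu, ← Ideal.one_eq_top, idealSigma_one]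
    exact h
  obtain ⟨π₀, hirr, hdvd⟩ := WfDvdMonoid.exists_irreducible_factor hu hβ0
  obtain ⟨ε, hε⟩ := exists_unit_mul_totPos hirr.ne_zero
  have hass : Associated π₀ (π₀ * ε) := ⟨ε, rfl⟩
  set π := π₀ * (ε : 𝓞 K) with hπdef
  have hπ : Prime π := hass.prime hirr.prime
  have hπβ : π ∣ β := hass.dvd_iff_dvd_left.1 hdvd
  have h2 : ¬ π ∣ 2 := by
    intro h
    rw [← rtInt_sq] at h
    exact hβ ((hπ.associated_of_dvd prime_rtInt (hπ.dvd_of_dvd_pow h)).symm.dvd.trans hπβ)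
  -- The full power of π is removed at once, so that the cofactor is prime to π; total positivity of
  -- π makes the cofactor totally positive and eligible for induction.
  obtain ⟨γ, hγ, hπγ⟩ := (FiniteMultiplicity.of_prime_left hπ hβ0).exists_eq_pow_mul_and_not_dvd
  set k := multiplicity π β with hk
  have hk0 : k ≠ 0 := by
    intro h0
    rw [h0, pow_zero, one_mul] at hγ
    exact hπγ (hγ ▸ hπβ)
  have hposk : ∀ n, TotPos ((π ^ n : 𝓞 K) : K) := by
    intro n
    induction n with
    | zero => simpa using totPos_one
    | succ n ihn =>
      rw [pow_succ]
      push_cast at ihn ⊢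
      exact ihn.mul hε
  have hγpos : TotPos (γ : K) := by
    apply (hposk k).of_mul
    rw [hγ] at hpos
    exact_mod_cast hpos
  have hγ0 : γ ≠ 0 := fun h => hγpos.ne_zero (by rw [h]; simp)
  have hlt : natNorm γ < N := by
    rw [← hN, hγ, natNorm_mul]
    have h1 : natNorm γ ≠ 0 := by rwa [Ne, natNorm_eq_zero]
    have h3 : natNorm (π ^ k) ≠ 0 := by
      rw [Ne, natNorm_eq_zero]; exact pow_ne_zero k hπ.ne_zero
    have h4 : natNorm (π ^ k) ≠ 1 := by
      intro h
      exact hπ.not_isUnit ((isUnit_pow_iff hk0).1 (isUnit_of_natNorm h))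
    have : 2 ≤ natNorm (π ^ k) := by omega
    nlinarith [Nat.pos_of_ne_zero h1]
  obtain ⟨hfin, hcard⟩ := ih _ hlt hγpos (fun h => hβ (hγ ▸ h.mul_left _)) rfl
  have hrec := cubianSphere_prime_pow_mul hπ h2 hε hπγ hfin k
  rw [← hγ, hcard] at hrec
  refine ⟨hrec.1, ?_⟩
  have hP : Prime (Ideal.span {π} : Ideal (𝓞 K)) := by
    refine Ideal.prime_of_isPrime ?_ ((Ideal.span_singleton_prime hπ.ne_zero).2 hπ)
    rw [Ne, Ideal.span_singleton_eq_bot]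
    exact hπ.ne_zero
  have hspan : Ideal.span {β} = Ideal.span {π} ^ k * Ideal.span {γ} := by
    rw [Ideal.span_singleton_pow, Ideal.span_singleton_mul_span_singleton, ← hγ]
  rw [hrec.2, hspan, idealSigma_prime_pow_mul hP]
  · ring
  · rwa [Ne, Ideal.zero_eq_bot, Ideal.span_singleton_eq_bot]
  · rwa [Ideal.dvd_iff_le, Ideal.span_singleton_le_span_singleton]

/-! ### The recursion in the exponent of `√2` -/

theorem exists_natCast_of_mul {k n : ℕ} (hk : k ≠ 0) {x : ℕ∞} (h : (k : ℕ∞) * x = n) :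
    ∃ m : ℕ, x = m := by
  have hx : x ≠ ⊤ := by
    rintro rfl
    rw [ENat.mul_top (by exact_mod_cast hk)] at h
    exact ENat.top_ne_natCast n h
  exact ⟨x.toNat, (ENat.natCast_toNat hx).symm⟩

theorem exists_natCast_of_mul_add {k n : ℕ} (hk : k ≠ 0) {x y : ℕ∞}
    (h : (k : ℕ∞) * x + y = n) : ∃ m : ℕ, x = m := by
  have hx : x ≠ ⊤ := by
    rintro rfl
    rw [ENat.mul_top (by exact_mod_cast hk), top_add] at h
    exact ENat.top_ne_natCast n h
  exact ⟨x.toNat, (ENat.natCast_toNat hx).symm⟩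

theorem sum_Icc_two_pow (e : ℕ) : ∑ j ∈ Finset.Icc 2 (e + 3), 2 ^ j + 4 = 16 * 2 ^ e := by
  induction e with
  | zero => decide
  | succ e ih =>
    rw [show e + 1 + 3 = e + 3 + 1 by ring, Finset.sum_Icc_succ_top (by omega), add_right_comm, ih]
    ring

theorem levelFactor_add_three (e : ℕ) : levelFactor (e + 3) + 12 = 48 * 2 ^ e := by
  have h := sum_Icc_two_pow e
  have h' : 2 ^ (e + 3) = 8 * 2 ^ e := by ring
  have := Nat.one_le_two_pow (n := e)
  simp only [levelFactor]
  omega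

/-- The solution of the first recursion is a(e) = 48s(2ᵉ⁺¹ − 1), after which the other sequences are
linear consequences. The relations for α/p degenerate at e = 0, and this irregularity spreads down
the chain, so small e are treated separately. -/
theorem nat_recursion {s : ℕ} {a b c d : ℕ → ℕ} (ha0 : a 0 = 48 * s)
    (ha1 : a 1 = 3 * a 0) (ha : ∀ e, a (e + 2) + 2 * a e = 3 * a (e + 1))
    (hb0 : a 0 = 3 * b 0) (hb : ∀ e, a (e + 1) + 2 * a e = 3 * b (e + 1))
    (hc0 : b 0 = 2 * c 0) (hc : ∀ e, b (e + 1) + 2 * b e = 2 * c (e + 1) + a e)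
    (hd0 : c 0 = 2 * d 0) (hd : ∀ e, c (e + 1) + 2 * c e = 2 * d (e + 1) + b e) (e : ℕ) :
    d e = 4 * s * levelFactor e := by
  have key : ∀ e, a e + 48 * s = 96 * (s * 2 ^ e) ∧ a (e + 1) + 48 * s = 192 * (s * 2 ^ e) := by
    intro e
    induction e with
    | zero => rw [pow_zero, zero_add]; omega
    | succ e ih =>
      have : a (e + 1 + 1) + 2 * a e = 3 * a (e + 1) := ha e
      rw [pow_succ, ← mul_assoc s]
      omega
  match e with
  | 0 => simp only [levelFactor]; omega
  | 1 =>
    have := hb 0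
    have := hc 0
    have := hd 0
    simp only [levelFactor, zero_add] at *
    omega
  | 2 =>
    have h0 := key 0
    have h1 := key 1
    have := hb 0
    have := hb 1
    have := hc 0
    have := hc 1
    have := hd 1
    simp only [levelFactor, zero_add, Nat.reduceAdd, pow_zero, pow_one] at *
    omega
  | e + 3 =>
    have h0 := key e
    have h1 := key (e + 2)
    have hl : 4 * s * levelFactor (e + 3) + 48 * s = 192 * (s * 2 ^ e) := by
      linear_combination 4 * s * levelFactor_add_three e
    have := hb e
    have := hb (e + 1)
    have := hb (e + 2)
    have := hc (e + 1)
    have := hc (e + 2)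
    have := hd (e + 2)
    rw [pow_add, ← mul_assoc s] at h1
    simp only [add_assoc, Nat.reduceAdd, Nat.reducePow] at *
    omega

/-- Additive relations in ℕ∞ could hold trivially at infinity. Finiteness is therefore propagated
from `a 0` along each sequence and down the chain, and only then is the system transported to ℕ. -/
theorem enat_recursion {s : ℕ} {a b c d : ℕ → ℕ∞} (ha0 : a 0 = (48 * s : ℕ))
    (ha1 : a 1 = 3 * a 0) (ha : ∀ e, a (e + 2) + 2 * a e = 3 * a (e + 1))
    (hb0 : a 0 = 3 * b 0) (hb : ∀ e, a (e + 1) + 2 * a e = 3 * b (e + 1))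
    (hc0 : b 0 = 2 * c 0) (hc : ∀ e, b (e + 1) + 2 * b e = 2 * c (e + 1) + a e)
    (hd0 : c 0 = 2 * d 0) (hd : ∀ e, c (e + 1) + 2 * c e = 2 * d (e + 1) + b e) (e : ℕ) :
    d e = (4 * s * levelFactor e : ℕ) := by
  have fa : ∀ e, ∃ m : ℕ, a e = m := by
    suffices h : ∀ e, (∃ m : ℕ, a e = m) ∧ ∃ m : ℕ, a (e + 1) = m from fun e => (h e).1
    intro e
    induction e with
    | zero => exact ⟨⟨_, ha0⟩, 3 * (48 * s), by rw [ha1, ha0]; norm_cast⟩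
    | succ e ih =>
      obtain ⟨-, m, hm⟩ := ih
      refine ⟨⟨m, hm⟩,
        exists_natCast_of_mul_add (k := 1) (n := 3 * m) (y := 2 * a e) one_ne_zero ?_⟩
      rw [Nat.cast_one, one_mul, ha, hm]
      norm_cast
  choose a' ha' using fa
  have fb : ∀ e, ∃ m : ℕ, b e = m := by
    rintro (_ | e)
    · exact exists_natCast_of_mul (k := 3) (n := a' 0) (by decide) (by rw [← ha', hb0]; rfl)
    · refine exists_natCast_of_mul (k := 3) (n := a' (e + 1) + 2 * a' e) (by decide) ?_
      push_cast
      rw [← ha', ← ha', hb]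
  choose b' hb' using fb
  have fc : ∀ e, ∃ m : ℕ, c e = m := by
    rintro (_ | e)
    · exact exists_natCast_of_mul (k := 2) (n := b' 0) (by decide) (by rw [← hb', hc0]; rfl)
    · refine exists_natCast_of_mul_add (k := 2) (n := b' (e + 1) + 2 * b' e) (y := a e)
        (by decide) ?_
      push_cast
      rw [← hb', ← hb', hc]
  choose c' hc' using fc
  have fd : ∀ e, ∃ m : ℕ, d e = m := by
    rintro (_ | e)
    · exact exists_natCast_of_mul (k := 2) (n := c' 0) (by decide) (by rw [← hc', hd0]; rfl)
    · refine exists_natCast_of_mul_add (k := 2) (n := c' (e + 1) + 2 * c' e) (y := b e)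
        (by decide) ?_
      push_cast
      rw [← hc', ← hc', hd]
  choose d' hd' using fd
  simp only [ha', hb', hc', hd'] at *
  norm_cast at *
  exact nat_recursion ha0 ha1 ha hb0 hb hc0 hc hd0 hd e

/-! ### The representation numbers of `gOrder` -/

theorem setOf_two_add_rtInt_mul_eq_empty {f : (Fin 4 → 𝓞 K) → 𝓞 K} {β : 𝓞 K}
    (hβ : ¬ rtInt ∣ β) : {v | (2 + rtInt) * f v = β} = ∅ := by
  refine Set.eq_empty_of_forall_notMem fun v hv => hβ (two_add_rtInt_dvd_iff.1 ?_)
  exact ⟨_, Eq.symm hv⟩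

theorem setOf_two_add_rtInt_mul_eq (f : (Fin 4 → 𝓞 K) → 𝓞 K) (β : 𝓞 K) (e : ℕ) :
    {v | (2 + rtInt) * f v = (2 + rtInt) ^ (e + 1) * β} = {v | f v = (2 + rtInt) ^ e * β} := by
  ext v
  rw [Set.mem_ofPred_eq, Set.mem_ofPred_eq, pow_succ', mul_assoc,
    mul_right_inj' two_add_rtInt_ne_zero]

/-- At e = 0 all terms for β/(2 + √2) vanish because β is odd; at positive exponents division by 2 +
√2 just lowers the exponent. This turns the lattice relations into the recursion of
`enat_recursion`. -/
theorem repCount_gOrder_two_add_rtInt_pow_mul {β : 𝓞 K} (hpos : TotPos (β : K))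
    (hβ : ¬ rtInt ∣ β) (e : ℕ) :
    repCount gOrder ((2 + rtInt) ^ e * β) =
      (4 * idealSigma (Ideal.span {β}) * levelFactor e : ℕ) := by
  have hempty : ∀ f : (Fin 4 → 𝓞 K) → 𝓞 K, {v | (2 + rtInt) * f v = β}.encard = 0 := fun f => by
    rw [setOf_two_add_rtInt_mul_eq_empty hβ, Set.encard_empty]
  have hsucc := fun f e => congrArg Set.encard (setOf_two_add_rtInt_mul_eq f β e)
  rw [repCount_gOrder]
  refine enat_recursion
    (a := fun e => {v | form0 rtInt v = (2 + rtInt) ^ e * β}.encard)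
    (b := fun e => {v | form1 rtInt v = (2 + rtInt) ^ e * β}.encard)
    (c := fun e => {v | form2 rtInt v = (2 + rtInt) ^ e * β}.encard)
    (d := fun e => {v | form3 rtInt v = (2 + rtInt) ^ e * β}.encard)
    ?_ ?_ (fun e => ?_) ?_ (fun e => ?_) ?_ (fun e => ?_) ?_ (fun e => ?_) e
  · obtain ⟨hfin, hcard⟩ := cubianSphere_odd hpos hβ
    rw [pow_zero, one_mul, ← repCount_cubianOrder, ← hcard, hfin.cast_ncard_eq]
    rfl
  · have h := encard_form0_two_add_rtInt_mul β
    rw [hempty, mul_zero, add_zero] at h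
    simpa only [pow_one, pow_zero, one_mul] using h
  · have h := encard_form0_two_add_rtInt_mul ((2 + rtInt) ^ (e + 1) * β)
    rw [hsucc, ← mul_assoc, ← pow_succ'] at h
    exact h
  · have h := encard_form0_add β
    rw [hempty, mul_zero, add_zero] at h
    simpa only [pow_zero, one_mul] using h
  · have h := encard_form0_add ((2 + rtInt) ^ (e + 1) * β)
    rwa [hsucc] at h
  · have h := encard_form1_add β
    rw [hempty, hempty, mul_zero, add_zero, add_zero] at h
    simpa only [pow_zero, one_mul] using h
  · have h := encard_form1_add ((2 + rtInt) ^ (e + 1) * β)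
    rwa [hsucc, hsucc] at h
  · have h := encard_form2_add β
    rw [hempty, hempty, mul_zero, add_zero, add_zero] at h
    simpa only [pow_zero, one_mul] using h
  · have h := encard_form2_add ((2 + rtInt) ^ (e + 1) * β)
    rwa [hsucc, hsucc] at h

theorem totPos_two_add_rtInt_pow (e : ℕ) : TotPos (((2 + rtInt) ^ e : 𝓞 K) : K) := by
  induction e with
  | zero => simpa using totPos_one
  | succ e ih =>
    have h : TotPos ((2 + rtInt : 𝓞 K) : K) := by
      have : (2 + rtInt : 𝓞 K) = ofPair (2, 1) := by simp [ofPair]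
      rw [this, coe_ofPair]
      refine ⟨by norm_num, ?_⟩
      rw [norm_eq]
      norm_num
    rw [pow_succ]
    push_cast at ih h ⊢
    exact ih.mul h

theorem repCount_gOrder_eq {α : 𝓞 K} (hα : TotallyPositive α) {e : ℕ}
    (he : α ∈ Ideal.span {rtInt ^ e}) (he' : α ∉ Ideal.span {rtInt ^ (e + 1)}) :
    repCount gOrder α = (4 * oddDivisorSum α * levelFactor e : ℕ) := by
  rw [Ideal.mem_span_singleton] at he he'
  obtain ⟨γ, rfl⟩ := he
  have hγ : ¬ rtInt ∣ γ := fun h => he' (by rw [pow_succ]; exact mul_dvd_mul_left _ h)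
  have hunit : (1 + rtInt) * (rtInt - 1) = 1 := by linear_combination rtInt_sq
  have hass : Associated γ ((rtInt - 1) ^ e * γ) := by
    have hu : IsUnit ((rtInt - 1) ^ e) := (IsUnit.of_mul_eq_one_right _ hunit).pow e
    exact associated_unit_mul_right γ _ hu
  -- The cofactor γ itself need not be totally positive. Trading √2 for 2 + √2 multiplies it by (√2
  -- − 1)ᵉ, and the new cofactor is a quotient of totally positive elements; the ideals involved do
  -- not change.
  have hαβ : rtInt ^ e * γ = (2 + rtInt) ^ e * ((rtInt - 1) ^ e * γ) := by
    rw [two_add_rtInt_eq, mul_pow, mul_assoc, ← mul_assoc ((1 + rtInt) ^ e), ← mul_pow, hunit,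
      one_pow, one_mul]
  have hβ : ¬ rtInt ∣ (rtInt - 1) ^ e * γ := fun h => hγ (hass.dvd_iff_dvd_right.2 h)
  have hpos : TotPos (((rtInt - 1) ^ e * γ : 𝓞 K) : K) := by
    apply (totPos_two_add_rtInt_pow e).of_mul
    have := hα.totPos
    rw [hαβ] at this
    exact_mod_cast this
  have hsum : oddDivisorSum (rtInt ^ e * γ) = idealSigma (Ideal.span {(rtInt - 1) ^ e * γ}) := by
    refine oddDivisorSum_eq (e := e) ?_ hβ
    rw [Ideal.span_singleton_pow, Ideal.span_singleton_mul_span_singleton,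
      Ideal.span_singleton_eq_span_singleton]
    exact hass.mul_left _
  rw [hsum, hαβ, repCount_gOrder_two_add_rtInt_pow_mul hpos hβ]

end CubianSuborder

theorem mainTheorem11
    (α : NumberField.RingOfIntegers CubianSuborder.K)
    (hα : CubianSuborder.TotallyPositive α)
    (e : ℕ)
    (he : α ∈ Ideal.span {CubianSuborder.rtInt ^ e})
    (he' : α ∉ Ideal.span {CubianSuborder.rtInt ^ (e + 1)}) :
    CubianSuborder.repCount CubianSuborder.gOrder α =
      ((4 * CubianSuborder.oddDivisorSum α * CubianSuborder.levelFactor e : ℕ) : ℕ∞) :=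
  CubianSuborder.repCount_gOrder_eq hα he he'
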